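/- **Conventions.** $\Phi=\{j\pi/4 : j=0,\dots,7\}$, $\mathsf R_Z(\theta)=e^{-i\theta Z/2}$, and in $\mathsf{CNOT}$ the first qubit is the control. For a finite simple graph $G=(V,E)$ and $\vec\theta\in\Phi^{V}$, the *blind graph state* is $$|G(\vec\theta)\rangle=\prod_{(v,w)\in E}\mathsf{CZ}_{v,w}\ \prod_{v\in V}\mathsf R_Z^{v}(\theta_v)\ \bigotimes_{v\in V}|+\rangle_v .$$ **Framework (Abstract Cryptography, two parties, adversarial Bob).** A resource takes inputs from Alice and Bob, applies a quantum channel (CPTP map) and outputs to both; a converter is the sequence of channels, with internal memory, that a party applies between its outer interface and the successive calls to a resource. Two (interactive) resources with the same interfaces are $\varepsilon$-indistinguishable if every distinguisher (an arbitrary sequence of channels with quantum memory, which provides all inputs, receives all outputs, and finally outputs a bit) outputs $1$ with probabilities that differ by at most $\varepsilon$. A protocol $(\pi_A,\pi_B)$ *$\varepsilon$-constructs* $\mathcal S$ from $n$ instances of $\mathcal R$ if (correctness) $\pi_A\mathcal R^{n}\pi_B$ and $\mathcal S$ are $\varepsilon$-indistinguishable and (security) there is a simulator $\sigma$, attached to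 Bob's interface of $\mathcal S$, such that $\pi_A\mathcal R^{n}$ and $\mathcal S\sigma$ are $\varepsilon$-indistinguishable. The construction is *perfect* if $\varepsilon=0$. **Resources.** * *Blind Graph State Extender*: Alice inputs $\theta\in\Phi$, Bob inputs a qubit $\rho_B$. The resource samples a uniform bit $b$ and sends to Bob the two qubits $\mathsf R_Z((-1)^b\theta)\,\mathsf{CNOT}(\rho_B\otimes|0\rangle\langle 0|)$, with $\mathsf R_Z$ acting on the second qubit, together with $b$. * *Remote Blind Graph State Preparation*: Alice inputs a graph $G=(V,E)$ and $\vec\theta\in\Phi^{V}$. The resource sends $|G(\vec\theta)\rangle$ and the description of $G$ to Bob. **Protocol.** Public: the graph $G$ and an ordering $<$ of $V$. Bob has finitely many quantum emitters, each with a spin qubit; each vertex $v$ is assigned to one emitter, and $V_q$ is the list, ordered by $<$, of the vertices of emitter $q$. It is assumed that $(v,w)\in E$ whenever $v,w$ are consecutive in some $V_q$. Alice's input is $\vec\theta\in\Phi^V$. 1. Bob initialises all spins in $|+\rangle$. 2. For each $v\in V$ in the order $<$, with $v\in V_q$: (a) Alice and Bob call the Blind Graph State Extender; Alice inputs $\theta_v$,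 Bob the spin of $q$; Bob receives the spin, a photon of $v$ (its main photon) and the bit $b_v$. (b) Bob applies $X^{b_v}$ to both qubits, and $Z^{b_v}$ to any one photon, not consumed so far, at the vertex $v'$ preceding $v$ in $V_q$, if it exists. (c) Bob emits a number $n_v$ of his choice of additional photons at $v$, each by a $\mathsf{CNOT}$ from the spin of $q$ onto a photon in the state $|0\rangle$. (d) For every earlier $w<v$ with $(v,w)\in E$ and $w\neq v'$, Bob creates the edge, either by a $\mathsf{CZ}$ between the spins of $q$ and of the emitter $r$ of $w$, if $r$ is still situated at $w$, or by a successful fusion of one additional photon of $v$ and one of $w$, each photon being used at most once (measurement of the pair in the basis $\mathsf{CZ}|\pm\rangle|\pm\rangle$; an outcome $-$ of a photon is corrected by $Z$ on the main photon of its vertex). (e) Bob applies a Hadamard gate to the spin of $q$, which then leaves the vertex $v$; he may delay this gate until the end of any later round that comes before the round of the next vertex of $V_q$. 3. Bob measures each spin $q$ in the computational basis, with outcome $c_q$, and applies $Z^{c_q}$ to any one unconsumed photon of the last vertex of $V_q$, if it exists. 4. Bob measures all leftover additional photons in the basis $|\pm\rangle$, and applies $Z^{d_v}$ to the main photon of $v$,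 where $d_v$ is the sum of the outcomes at $v$. He outputs the main photons and the description of $G$. **Theorem.** For every finite graph $G=(V,E)$, every ordering of $V$, every assignment of emitters as above and all of Bob's admissible choices, this protocol perfectly constructs (error $0$), in the Abstract Cryptography framework against adversarial Bob, the Remote Blind Graph State Preparation resource (for the public graph $G$) from $|V|$ instances of the Blind Graph State Extender resource. Moreover, security holds with error $0$ for the following simulator. It calls the Remote Blind Graph State Preparation resource once, receives a state of the qubits labelled by $V$ and $G$, and applies $\prod_{(v,w)\in E}\mathsf{CZ}_{v,w}$. Then, for each $v$ in the order $<$, it receives a qubit from Bob, applies $\mathsf{CNOT}$ from this qubit to its qubit $v$, measures its qubit $v$ in the computational basis with outcome $b_{s,v}$, applies $\mathsf{CNOT}$ from Bob's qubit to a fresh qubit in the state $|0\rangle$, and sends these two qubits and $b_{s,v}$ to Bob. -/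

import Mathlib

open scoped ComplexOrder Matrix Kronecker

noncomputable section

namespace BlindGraph

/-! ## Quantum channels on finite-dimensional registers

A register is a finite type `I` of computational basis labels; its states are density matrices in
`Matrix I I ℂ`, and the joint register of `I` and `J` is `I × J`. A qubit is `Bool`
(`false` is `|0⟩`, `true` is `|1⟩`) and a family of qubits labelled by `Q` is `Q → Bool`. -/

/-- The linear map `id_D ⊗ Φ`. -/
def ampliate (D : Type) {I J : Type} (Φ : Matrix I I ℂ →ₗ[ℂ] Matrix J J ℂ) :
    Matrix (D × I) (D × I) ℂ →ₗ[ℂ] Matrix (D × J) (D × J) ℂ where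
  toFun ρ := Matrix.of fun p q => Φ (Matrix.of fun i i' => ρ (p.1, i) (q.1, i')) p.2 q.2
  map_add' ρ σ := by
    ext p q
    exact congrFun (congrFun (Φ.map_add (Matrix.of fun i i' => ρ (p.1, i) (q.1, i'))
      (Matrix.of fun i i' => σ (p.1, i) (q.1, i'))) p.2) q.2
  map_smul' c ρ := by
    ext p q
    exact congrFun (congrFun (Φ.map_smul c (Matrix.of fun i i' => ρ (p.1, i) (q.1, i'))) p.2) q.2

/-- A quantum channel: a completely positive trace-preserving linear map. -/
structure Channel (I J : Type) [Fintype I] [Fintype J] where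
  toLin : Matrix I I ℂ →ₗ[ℂ] Matrix J J ℂ
  completelyPositive : ∀ (D : Type) [Fintype D] (ρ : Matrix (D × I) (D × I) ℂ),
    ρ.PosSemidef → (ampliate D toLin ρ).PosSemidef
  tracePreserving : ∀ ρ, (toLin ρ).trace = ρ.trace

namespace Channel

variable {I J K L D C E : Type} [Fintype I] [Fintype J] [Fintype K] [Fintype L] [Fintype D]
  [Fintype C] [Fintype E]

/-- The identity channel. -/
def id (I : Type) [Fintype I] : Channel I I where
  toLin := LinearMap.id
  completelyPositive _ _ _ h := h
  tracePreserving _ := rfl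

/-- Sequential composition: first `Φ`, then `Ψ`. -/
def comp (Ψ : Channel J K) (Φ : Channel I J) : Channel I K where
  toLin := Ψ.toLin ∘ₗ Φ.toLin
  completelyPositive D _ ρ h := Ψ.completelyPositive D _ (Φ.completelyPositive D ρ h)
  tracePreserving ρ := (Ψ.tracePreserving _).trans (Φ.tracePreserving ρ)

/-- `Φ` followed by `Ψ`. -/
def andThen (Φ : Channel I J) (Ψ : Channel J K) : Channel I K := Ψ.comp Φ

/-- Relabelling of the computational basis. -/
def relabel (e : I ≃ J) : Channel I J where
  toLin :=
    { toFun := fun ρ => ρ.submatrix e.symm e.symm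
      map_add' := fun _ _ => rfl
      map_smul' := fun _ _ => rfl }
  completelyPositive D _ _ h := h.submatrix (fun p : D × J => (p.1, e.symm p.2))
  tracePreserving ρ := Equiv.sum_comp e.symm ρ.diag

/-- The channel `id_D ⊗ Φ`. -/
def onRight (D : Type) [Fintype D] (Φ : Channel I J) : Channel (D × I) (D × J) where
  toLin := ampliate D Φ.toLin
  completelyPositive D' _ ρ h :=
    (Φ.completelyPositive (D' × D) _
      (h.submatrix (fun p : (D' × D) × I => (p.1.1, (p.1.2, p.2))))).submatrix
      (fun p : D' × (D × J) => ((p.1, p.2.1), p.2.2))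
  tracePreserving ρ := by
    have h : ∀ d : D, ∑ j, Φ.toLin (Matrix.of fun i i' => ρ (d, i) (d, i')) j j = ∑ i, ρ (d, i) (d, i) :=
      fun d => Φ.tracePreserving (Matrix.of fun i i' => ρ (d, i) (d, i'))
    simp only [Matrix.trace, Matrix.diag, Fintype.sum_prod_type]
    exact Finset.sum_congr rfl fun d _ => h d

/-- The channel `Φ ⊗ id_D`. -/
def onLeft (D : Type) [Fintype D] (Φ : Channel I J) : Channel (I × D) (J × D) :=
  ((relabel (Equiv.prodComm I D)).andThen (Φ.onRight D)).andThen (relabel (Equiv.prodComm D J))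

/-- The channel `Φ ⊗ Ψ`. -/
def tensor (Φ : Channel I J) (Ψ : Channel K L) : Channel (I × K) (J × L) :=
  (Φ.onLeft K).andThen (Ψ.onRight J)

/-- The linear map `ρ ↦ ∑ₖ Kₖ ρ Kₖᴴ`. -/
def krausMap {κ : Type} [Fintype κ] (M : κ → Matrix J I ℂ) :
    Matrix I I ℂ →ₗ[ℂ] Matrix J J ℂ where
  toFun ρ := ∑ k, M k * ρ * (M k)ᴴ
  map_add' ρ σ := by simp [Matrix.mul_add, Matrix.add_mul, Finset.sum_add_distrib]
  map_smul' c ρ := by simp [Finset.smul_sum]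

/-- The channel `ρ ↦ ∑ₖ Kₖ ρ Kₖᴴ` with Kraus operators `Kₖ`. -/
def ofKraus {κ : Type} [Fintype κ] [DecidableEq I] (M : κ → Matrix J I ℂ)
    (hM : ∑ k, (M k)ᴴ * M k = 1) : Channel I J where
  toLin := krausMap M
  completelyPositive D _ ρ h := by
    classical
    have key : ampliate D (krausMap M) ρ
        = ∑ k, ((1 : Matrix D D ℂ) ⊗ₖ M k) * ρ * ((1 : Matrix D D ℂ) ⊗ₖ M k)ᴴ := by
      ext p q
      simp only [ampliate, krausMap, LinearMap.coe_mk, AddHom.coe_mk, Matrix.sum_apply,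
        Matrix.of_apply]
      refine Finset.sum_congr rfl fun k _ => ?_
      simp only [Matrix.mul_apply, Matrix.conjTranspose_apply, Matrix.kroneckerMap_apply,
        Fintype.sum_prod_type, Matrix.one_apply, Matrix.of_apply]
      simp [ite_mul, apply_ite]
    rw [key]
    exact Matrix.posSemidef_sum _ fun k _ => h.mul_mul_conjTranspose_same _
  tracePreserving ρ := by
    simp only [krausMap, LinearMap.coe_mk, AddHom.coe_mk, Matrix.trace_sum]
    have h : ∀ k, (M k * ρ * (M k)ᴴ).trace = ((M k)ᴴ * M k * ρ).trace := fun k => by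
      rw [Matrix.trace_mul_comm, ← Matrix.mul_assoc]
    simp only [h, ← Matrix.trace_sum, ← Matrix.sum_mul, hM, Matrix.one_mul]

/-- Conjugation by a unitary (or an isometry) `U`. -/
def ofUnitary [DecidableEq I] (U : Matrix J I ℂ) (hU : Uᴴ * U = 1) : Channel I J :=
  ofKraus (fun _ : Unit => U) (by simpa using hU)

/-- Preparation of the pure state with amplitudes `ψ`. -/
def prepare (ψ : J → ℂ) (hψ : ∑ j, star (ψ j) * ψ j = 1) : Channel Unit J :=
  ofUnitary (Matrix.of fun j _ => ψ j) (by
    ext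
    simpa [Matrix.mul_apply] using hψ)

/-- Classical processing: measure the input in the computational basis and output the basis
state labelled by `f` of the outcome. -/
def classical [DecidableEq I] [DecidableEq J] (f : I → J) : Channel I J :=
  ofKraus (fun i : I => Matrix.single (f i) i (1 : ℂ)) (by
    simp only [Matrix.conjTranspose_single, Matrix.single_mul_single_same]
    simpa using Matrix.sum_single_one (m := I) (α := ℂ))

/-- Append a fresh register in the basis state `e`: `ρ ↦ ρ ⊗ |e⟩⟨e|`. -/
def attach [DecidableEq I] [DecidableEq E] (e : E) : Channel I (I × E) :=
  ofUnitary (Matrix.of fun p i => if p = (i, e) then 1 else 0) (by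
    ext a b
    simp [Matrix.mul_apply, Matrix.one_apply, eq_comm])

/-- The partial trace over the second register. -/
def traceRight : Matrix (I × E) (I × E) ℂ →ₗ[ℂ] Matrix I I ℂ where
  toFun ρ := Matrix.of fun i i' => ∑ e, ρ (i, e) (i', e)
  map_add' ρ σ := by ext; simp [Finset.sum_add_distrib]
  map_smul' c ρ := by ext; simp [Finset.mul_sum]

/-- Discard (trace out) the second register. -/
def discardRight : Channel (I × E) I where
  toLin := traceRight
  completelyPositive D _ ρ h := by
    have key := Matrix.posSemidef_sum Finset.univ (fun (e : E) _ =>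
      h.submatrix (fun p : D × I => (p.1, (p.2, e))))
    convert key using 1
    ext p q
    simp [ampliate, traceRight, Matrix.sum_apply]
  tracePreserving ρ := by
    simp [traceRight, Matrix.trace, Fintype.sum_prod_type]

/-- The diagonal block `⟨c| ρ |c⟩` of `ρ`. -/
def block (c : C) : Matrix (C × I) (C × I) ℂ →ₗ[ℂ] Matrix I I ℂ where
  toFun ρ := Matrix.of fun i i' => ρ (c, i) (c, i')
  map_add' _ _ := rfl
  map_smul' _ _ := rfl

/-- Classical control: measure the register `C` in the computational basis and, on outcome `c`,
apply `Φ c` to the other register. -/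
def controlled (Φ : C → Channel I J) : Channel (C × I) J where
  toLin := ∑ c, (Φ c).toLin ∘ₗ block c
  completelyPositive D _ ρ h := by
    have key := Matrix.posSemidef_sum Finset.univ (fun (c : C) _ =>
      (Φ c).completelyPositive D _ (h.submatrix (fun p : D × I => (p.1, (c, p.2)))))
    convert key using 1
    ext p q
    simp only [ampliate, LinearMap.coe_mk, AddHom.coe_mk, Matrix.of_apply, Matrix.sum_apply,
      LinearMap.sum_apply, LinearMap.comp_apply]
    rfl
  tracePreserving ρ := by
    simp only [LinearMap.sum_apply, LinearMap.comp_apply, Matrix.trace_sum,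
      (Φ _).tracePreserving]
    exact (Fintype.sum_prod_type (fun p : C × I => ρ p p)).symm

/-- `f 0`, then `f 1`, ..., then `f (n - 1)`. -/
def iterate : (n : ℕ) → (Fin n → Channel I I) → Channel I I
  | 0, _ => id I
  | n + 1, f => (iterate n fun i => f i.castSucc).andThen (f (Fin.last n))

end Channel

/-! ## Resources, converters and indistinguishability -/

/-- A two-party resource: once both parties have given their inputs (`inA` from Alice, `inB` from
Bob), a fixed channel produces their outputs. -/
abbrev Resource (inA inB outA outB : Type) [Fintype inA] [Fintype inB] [Fintype outA]
    [Fintype outB] := Channel (inA × inB) (outA × outB)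

/-- The converter of an honest party which receives an input `X` from the outside, takes part in
`n` successive calls to a resource (giving it `In` and receiving `Out` each time) and finally
delivers an output `Y`. -/
structure Converter (X Y In Out : Type) [Fintype X] [Fintype Y] [Fintype In] [Fintype Out]
    (n : ℕ) where
  Mem : Type
  [memFintype : Fintype Mem]
  start : Channel X Mem
  send : Fin n → Channel Mem (Mem × In)
  receive : Fin n → Channel (Mem × Out) Mem
  finish : Channel Mem Y

attribute [instance] Converter.memFintype

/-- A resource in its general, interactive form, as seen from the outside: a sequence of channels
with an internal state. It takes an input `X`, then answers `n` messages `In` by messages `Out`,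
and finally outputs `Y`. -/
structure System (X Y In Out : Type) [Fintype X] [Fintype Y] [Fintype In] [Fintype Out]
    (n : ℕ) where
  Mem : Type
  [memFintype : Fintype Mem]
  start : Channel X Mem
  step : Fin n → Channel (Mem × In) (Mem × Out)
  finish : Channel Mem Y

attribute [instance] System.memFintype

/-- A distinguisher: it prepares the input (possibly entangled with its own memory), chooses each
message adaptively, and finally outputs a bit. -/
structure Distinguisher (X Y In Out : Type) [Fintype X] [Fintype Y] [Fintype In] [Fintype Out]
    (n : ℕ) where
  Mem : Type
  [memFintype : Fintype Mem]
  init : Channel Unit (Mem × X)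
  ask : Fin n → Channel Mem (Mem × In)
  hear : Fin n → Channel (Mem × Out) Mem
  guess : Channel (Mem × Y) Bool

attribute [instance] Distinguisher.memFintype

section Framework

variable {XA XB YA YB inA inB outA outB : Type} [Fintype XA] [Fintype XB] [Fintype YA]
  [Fintype YB] [Fintype inA] [Fintype inB] [Fintype outA] [Fintype outB] {n : ℕ}

/-- `(m, i), k ↦ (m, k), i` -/
def swapLast (M I K : Type) : (M × I) × K ≃ (M × K) × I where
  toFun p := ((p.1.1, p.2), p.1.2)
  invFun p := ((p.1.1, p.2), p.1.2)
  left_inv _ := rfl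
  right_inv _ := rfl

/-- The interaction of a distinguisher with a system, up to the distinguisher's output bit. -/
def Distinguisher.interact (𝒟 : Distinguisher XA YA inB outB n) (S : System XA YA inB outB n) :
    Channel Unit Bool :=
  ((𝒟.init.andThen (S.start.onRight 𝒟.Mem)).andThen
    (Channel.iterate n fun i =>
      (((((𝒟.ask i).onLeft S.Mem).andThen
        (Channel.relabel ((swapLast 𝒟.Mem inB S.Mem).trans (Equiv.prodAssoc _ _ _)))).andThen
        ((S.step i).onRight 𝒟.Mem)).andThen
        (Channel.relabel ((Equiv.prodAssoc _ _ _).symm.trans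
          (swapLast 𝒟.Mem S.Mem outB)))).andThen
        ((𝒟.hear i).onLeft S.Mem))).andThen
    ((S.finish.onRight 𝒟.Mem).andThen 𝒟.guess)

/-- The probability that the distinguisher outputs `1`. -/
def Distinguisher.prob (𝒟 : Distinguisher XA YA inB outB n) (S : System XA YA inB outB n) : ℝ :=
  ((𝒟.interact S).toLin 1 true true).re

/-- `ε`-statistical indistinguishability: no distinguisher, of whatever complexity, has an
advantage greater than `ε`. -/
def Indistinguishable (ε : ℝ) (S T : System XA YA inB outB n) : Prop :=
  ∀ 𝒟 : Distinguisher XA YA inB outB n, |𝒟.prob S - 𝒟.prob T| ≤ ε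

/-- A resource as a system whose only interaction is taking the inputs of both parties and
delivering their outputs. -/
def Resource.toSystem (S : Resource XA XB YA YB) :
    System (XA × XB) (YA × YB) Unit Unit 0 where
  Mem := YA × YB
  start := S
  step i := i.elim0
  finish := Channel.id _

/-- Regrouping of the joint register of Alice, Bob and their resource messages. -/
def regroup (M N I K : Type) : (M × I) × (N × K) ≃ (M × N) × (I × K) := Equiv.prodProdProdComm M I N K

/-- Both honest parties run their converters on `n` successive calls to fresh instances of `R`. -/
def honestSystem (πA : Converter XA YA inA outA n) (πB : Converter XB YB inB outB n)
    (R : Resource inA inB outA outB) : System (XA × XB) (YA × YB) Unit Unit 0 where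
  Mem := πA.Mem × πB.Mem
  start := (πA.start.tensor πB.start).andThen
    (Channel.iterate n fun i =>
      (((((πA.send i).tensor (πB.send i)).andThen
        (Channel.relabel (regroup _ _ _ _))).andThen
        (R.onRight (πA.Mem × πB.Mem))).andThen
        (Channel.relabel (regroup _ _ _ _).symm)).andThen
        ((πA.receive i).tensor (πB.receive i)))
  step i := i.elim0
  finish := πA.finish.tensor πB.finish

/-- Only Alice is honest: her converter is attached to the `n` instances of `R`, whose interfaces
on Bob's side are left open. -/
def realSystem (πA : Converter XA YA inA outA n) (R : Resource inA inB outA outB) :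
    System XA YA inB outB n where
  Mem := πA.Mem
  start := πA.start
  step i := ((((((πA.send i).onLeft inB).andThen
    (Channel.relabel (Equiv.prodAssoc _ _ _))).andThen
    (R.onRight πA.Mem)).andThen
    (Channel.relabel (Equiv.prodAssoc _ _ _).symm)).andThen
    ((πA.receive i).onLeft outB))
  finish := πA.finish

/-- A simulator: it calls the ideal resource once on Bob's interface, with input `XB` and answer
`YB`, and then answers the `n` messages that a corrupted Bob sends to the resources used by the
protocol. -/
structure Simulator (XB YB inB outB : Type) [Fintype XB] [Fintype YB] [Fintype inB]
    [Fintype outB] (n : ℕ) where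
  Mem : Type
  [memFintype : Fintype Mem]
  init : Channel Unit (XB × Mem)
  absorb : Channel (YB × Mem) Mem
  step : Fin n → Channel (Mem × inB) (Mem × outB)

attribute [instance] Simulator.memFintype

/-- The ideal resource `S` with the simulator `σ` attached to Bob's interface. -/
def idealSystem (S : Resource XA XB YA YB) (σ : Simulator XB YB inB outB n) :
    System XA YA inB outB n where
  Mem := YA × σ.Mem
  start := (((((Channel.relabel (Equiv.prodPUnit XA).symm).andThen
    (σ.init.onRight XA)).andThen
    (Channel.relabel (Equiv.prodAssoc _ _ _).symm)).andThen
    (S.onLeft σ.Mem)).andThen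
    (Channel.relabel (Equiv.prodAssoc _ _ _))).andThen
    (σ.absorb.onRight YA)
  step i := ((Channel.relabel (Equiv.prodAssoc _ _ _)).andThen
    ((σ.step i).onRight YA)).andThen (Channel.relabel (Equiv.prodAssoc _ _ _).symm)
  finish := Channel.discardRight

/-- Correctness: the honest execution is `ε`-indistinguishable from `S`. -/
def IsCorrect (ε : ℝ) (πA : Converter XA YA inA outA n) (πB : Converter XB YB inB outB n)
    (R : Resource inA inB outA outB) (S : Resource XA XB YA YB) : Prop :=
  Indistinguishable ε (honestSystem πA πB R) (Resource.toSystem S)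

/-- The simulator `σ` witnesses `ε`-security against a corrupted Bob. -/
def IsSimulatedBy (ε : ℝ) (πA : Converter XA YA inA outA n)
    (R : Resource inA inB outA outB) (S : Resource XA XB YA YB)
    (σ : Simulator XB YB inB outB n) : Prop :=
  Indistinguishable ε (realSystem πA R) (idealSystem S σ)

/-- The protocol `(πA, πB)` `ε`-constructs `S` from `n` instances of `R` against adversarial Bob. -/
def Constructs (ε : ℝ) (πA : Converter XA YA inA outA n) (πB : Converter XB YB inB outB n)
    (R : Resource inA inB outA outB) (S : Resource XA XB YA YB) : Prop :=
  IsCorrect ε πA πB R S ∧ ∃ σ : Simulator XB YB inB outB n, IsSimulatedBy ε πA R S σ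

end Framework

/-! ## Circuits -/

/-- Elementary operations on qubits labelled by `Q`. A measured qubit is left in the basis state
given by the outcome, so that a gate controlled by the outcome is a gate controlled by that qubit. -/
inductive Instr (Q : Type) : Type
  /-- Hadamard gate. -/
  | had (q : Q)
  /-- Controlled-`Z` gate. -/
  | cz (p q : Q)
  /-- Controlled-`X` gate with control `p` and target `q`. -/
  | cnot (p q : Q) (h : p ≠ q)
  /-- Measurement in the computational basis. -/
  | meas (q : Q)

section Circuits

variable {Q : Type} [Fintype Q] [DecidableEq Q]

/-- Matrix of the Hadamard gate on qubit `q`. -/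
def hadMatrix (q : Q) : Matrix (Q → Bool) (Q → Bool) ℂ := Matrix.of fun x y =>
  if ∀ r, r ≠ q → x r = y r then
    (if x q = true ∧ y q = true then -1 else 1) * ((Real.sqrt 2 : ℝ) : ℂ)⁻¹ else 0

/-- Matrix of the controlled-`Z` gate on qubits `p` and `q`. -/
def czMatrix (p q : Q) : Matrix (Q → Bool) (Q → Bool) ℂ :=
  Matrix.diagonal fun x => if x p = true ∧ x q = true then -1 else 1

/-- Matrix of the controlled-`X` gate with control `p` and target `q`. -/
def cnotMatrix (p q : Q) : Matrix (Q → Bool) (Q → Bool) ℂ := Matrix.of fun x y =>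
  if x = Function.update y q (xor (y q) (y p)) then 1 else 0

/-- Projector onto outcome `b` of the computational basis measurement of qubit `q`. -/
def projMatrix (q : Q) (b : Bool) : Matrix (Q → Bool) (Q → Bool) ℂ :=
  Matrix.diagonal fun x => if x q = b then 1 else 0

lemma hadMatrix_isometry (q : Q) : (hadMatrix q)ᴴ * hadMatrix q = 1 := by
  have h2 : ((Real.sqrt 2 : ℝ) : ℂ)⁻¹ * ((Real.sqrt 2 : ℝ) : ℂ)⁻¹ = 1 / 2 := by
    rw [← mul_inv, ← Complex.ofReal_mul, Real.mul_self_sqrt (by norm_num)]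
    norm_num
  ext x y
  rw [Matrix.mul_apply, Matrix.one_apply,
    ← Finset.sum_subset (Finset.subset_univ
      {Function.update x q false, Function.update x q true})]
  · rw [Finset.sum_pair (by
      intro h
      simpa using congrFun h q)]
    by_cases hxy : ∀ r, r ≠ q → x r = y r
    · have e1 : ∀ b, ∀ r, r ≠ q → Function.update x q b r = x r := fun b r hr => by simp [hr]
      have e2 : ∀ b, ∀ r, r ≠ q → Function.update x q b r = y r := fun b r hr => by
        simp [hr, hxy r hr]
      simp only [Matrix.conjTranspose_apply, hadMatrix, Matrix.of_apply, if_pos (e1 _),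
        if_pos (e2 _), Function.update_self]
      have hiff : x = y ↔ x q = y q := ⟨fun h => by rw [h], fun h => by
        funext r
        by_cases hr : r = q
        · rw [hr, h]
        · exact hxy r hr⟩
      cases hx : x q <;> cases hy : y q <;>
        simp [hiff, hx, hy, h2]
      all_goals norm_num
    · have hne : x ≠ y := fun h => hxy (by simp [h])
      have e2 : ∀ b, ¬ ∀ r, r ≠ q → Function.update x q b r = y r := fun b h => hxy fun r hr => by
        simpa [hr] using h r hr
      simp [hadMatrix, if_neg (e2 _), hne]
  · intro z _ hz
    have : ¬ ∀ r, r ≠ q → z r = x r := by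
      intro h
      apply hz
      have : z = Function.update x q (z q) := by
        funext r
        by_cases hr : r = q
        · subst hr; simp
        · simp [hr, h r hr]
      rw [this]
      cases z q <;> simp
    simp [hadMatrix, if_neg this]

lemma czMatrix_isometry (p q : Q) : (czMatrix p q)ᴴ * czMatrix p q = 1 := by
  rw [czMatrix, Matrix.diagonal_conjTranspose, Matrix.diagonal_mul_diagonal,
    ← Matrix.diagonal_one]
  congr 1
  ext x
  simp only [Pi.star_apply]
  split_ifs <;> simp

lemma cnotMatrix_isometry {p q : Q} (h : p ≠ q) : (cnotMatrix p q)ᴴ * cnotMatrix p q = 1 := by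
  have hinj : ∀ x y : Q → Bool,
      Function.update x q (xor (x q) (x p)) = Function.update y q (xor (y q) (y p)) ↔ x = y := by
    refine fun x y => ⟨fun e => ?_, fun e => by rw [e]⟩
    have h1 : ∀ r, r ≠ q → x r = y r := fun r hr => by simpa [hr] using congrFun e r
    have h2 := congrFun e q
    simp only [Function.update_self, h1 p h, Bool.xor_left_inj] at h2
    funext r
    by_cases hr : r = q
    · rw [hr, h2]
    · exact h1 r hr
  ext x y
  simp [Matrix.mul_apply, cnotMatrix, Matrix.one_apply, hinj, eq_comm]

lemma projMatrix_complete (q : Q) : ∑ b, (projMatrix q b)ᴴ * projMatrix q b = 1 := by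
  simp only [projMatrix, Matrix.diagonal_conjTranspose, Matrix.diagonal_mul_diagonal]
  rw [Fintype.sum_bool, Matrix.diagonal_add, ← Matrix.diagonal_one]
  congr 1
  ext x
  cases h : x q <;> simp [h]

/-- The channel of an elementary operation. -/
def Instr.channel : Instr Q → Channel (Q → Bool) (Q → Bool)
  | .had q => Channel.ofUnitary (hadMatrix q) (hadMatrix_isometry q)
  | .cz p q => Channel.ofUnitary (czMatrix p q) (czMatrix_isometry p q)
  | .cnot p q h => Channel.ofUnitary (cnotMatrix p q) (cnotMatrix_isometry h)
  | .meas q => Channel.ofKraus (projMatrix q) (projMatrix_complete q)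

/-- The channel of a circuit; the head of the list is executed first. -/
def run : List (Instr Q) → Channel (Q → Bool) (Q → Bool)
  | [] => Channel.id _
  | g :: c => g.channel.andThen (run c)

/-- Exchange the content of qubit `q` of a register with an external qubit. -/
def swapOne (q : Q) : (Q → Bool) × Bool ≃ (Q → Bool) × Bool where
  toFun p := (Function.update p.1 q p.2, p.1 q)
  invFun p := (Function.update p.1 q p.2, p.1 q)
  left_inv p := by simp
  right_inv p := by simp

lemma swapThree_aux (p q r : Q) (hpq : p ≠ q) (hpr : p ≠ r) (hqr : q ≠ r)
    (m : (Q → Bool) × (Bool × Bool × Bool)) :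
    (fun m : (Q → Bool) × (Bool × Bool × Bool) =>
      ((Function.update (Function.update (Function.update m.1 p m.2.1) q m.2.2.1) r m.2.2.2,
        (m.1 p, m.1 q, m.1 r)) : (Q → Bool) × (Bool × Bool × Bool)))
      (Function.update (Function.update (Function.update m.1 p m.2.1) q m.2.2.1) r m.2.2.2,
        (m.1 p, m.1 q, m.1 r)) = m := by
  rcases m with ⟨x, a, b, c⟩
  simp only [Prod.mk.injEq]
  refine ⟨?_, ?_, ?_, ?_⟩
  · funext s
    by_cases h1 : s = r
    · simp [h1]
    · by_cases h2 : s = q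
      · simp [h2, hqr]
      · by_cases h3 : s = p
        · simp [h3, hpq, hpr]
        · simp [h1, h2, h3]
  · simp [hpq, hpr]
  · simp [hqr]
  · simp

/-- Exchange the contents of three qubits of a register with three external qubits. -/
def swapThree (p q r : Q) (hpq : p ≠ q) (hpr : p ≠ r) (hqr : q ≠ r) :
    (Q → Bool) × (Bool × Bool × Bool) ≃ (Q → Bool) × (Bool × Bool × Bool) where
  toFun m := (Function.update (Function.update (Function.update m.1 p m.2.1) q m.2.2.1) r m.2.2.2,
    (m.1 p, m.1 q, m.1 r))
  invFun m := (Function.update (Function.update (Function.update m.1 p m.2.1) q m.2.2.1) r m.2.2.2,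
    (m.1 p, m.1 q, m.1 r))
  left_inv m := swapThree_aux p q r hpq hpr hqr m
  right_inv m := swapThree_aux p q r hpq hpr hqr m

end Circuits

/-! ## The two resources -/

/-- `R_Z(φ) = exp(-i φ Z / 2)`. -/
def rz (φ : ℝ) : Matrix Bool Bool ℂ :=
  Matrix.diagonal fun x => Complex.exp (((if x then φ / 2 else -(φ / 2) : ℝ) : ℂ) * Complex.I)

/-- The angle set `Φ = {j π / 4 | j = 0, …, 7}`; an angle is given by its index `j`. -/
abbrev Angle := Fin 8

/-- The value `j π / 4` of an angle. -/
def angleValue (j : Angle) : ℝ := (j : ℕ) * Real.pi / 4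

/-- `|y⟩ ↦ |y⟩ ⊗ |0⟩`. -/
def appendZero : Matrix (Bool × Bool) Bool ℂ := Matrix.of fun p y => if p = (y, false) then 1 else 0

/-- The controlled-`X` gate with the first qubit as control and the second as target. -/
def cnot₂ : Matrix (Bool × Bool) (Bool × Bool) ℂ := Matrix.of fun p q =>
  if p = (q.1, xor q.2 q.1) then 1 else 0

/-- The isometry `R_Z((-1)^b θ) CNOT (· ⊗ |0⟩)`, with `R_Z` applied to the second qubit. -/
def extendMatrix (θ : Angle) (b : Bool) : Matrix (Bool × Bool) Bool ℂ :=
  ((1 : Matrix Bool Bool ℂ) ⊗ₖ rz ((if b then -1 else 1) * angleValue θ)) * cnot₂ * appendZero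

/-- Kraus operator for the sampled bit `b`, which has probability `1/2` and is sent along with the
two qubits. -/
def extendKraus (θ : Angle) (b : Bool) : Matrix (Unit × (Bool × Bool × Bool)) Bool ℂ :=
  Matrix.of fun p y => if p.2.2.2 = b then
    ((Real.sqrt 2 : ℝ) : ℂ)⁻¹ * extendMatrix θ b (p.2.1, p.2.2.1) y else 0

lemma rz_star_mul (φ : ℝ) (x : Bool) : star (rz φ x x) * rz φ x x = 1 := by
  have h : ‖rz φ x x‖ = 1 := by
    rw [rz, Matrix.diagonal_apply_eq, Complex.norm_exp_ofReal_mul_I]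
  rw [Complex.star_def, Complex.conj_mul', h]
  norm_num

lemma inv_sqrt_two_mul_self :
    ((Real.sqrt 2 : ℝ) : ℂ)⁻¹ * ((Real.sqrt 2 : ℝ) : ℂ)⁻¹ = 1 / 2 := by
  rw [← mul_inv, ← Complex.ofReal_mul, Real.mul_self_sqrt (by norm_num)]
  norm_num

lemma extendMatrix_apply (θ : Angle) (b : Bool) (y z x : Bool) :
    extendMatrix θ b (y, z) x =
      if y = x ∧ z = x then rz ((if b then -1 else 1) * angleValue θ) x x else 0 := by
  cases x <;> cases y <;> cases z <;>
    simp [extendMatrix, Matrix.mul_apply, cnot₂, appendZero, rz]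

lemma extendKraus_complete (θ : Angle) : ∑ b, (extendKraus θ b)ᴴ * extendKraus θ b = 1 := by
  have hs := inv_sqrt_two_mul_self
  have h : ∀ (φ : ℝ) (x : Bool), ((Real.sqrt 2 : ℝ) : ℂ)⁻¹ * (starRingEnd ℂ) (rz φ x x) *
      (((Real.sqrt 2 : ℝ) : ℂ)⁻¹ * rz φ x x) = 1 / 2 := by
    intro φ x
    rw [mul_mul_mul_comm, hs, ← Complex.star_def, rz_star_mul, mul_one]
  ext x y
  simp only [Matrix.add_apply, Fintype.sum_bool, Matrix.mul_apply, Fintype.sum_prod_type,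
    Matrix.conjTranspose_apply, extendKraus, Matrix.of_apply, extendMatrix_apply, Matrix.one_apply]
  cases x <;> cases y <;> simp [h] <;> norm_num

/-- Blind Graph State Extender. Alice inputs an angle `θ` and Bob a qubit `ρ`; for a uniformly
random bit `b`, Bob receives `R_Z((-1)^b θ) CNOT (ρ ⊗ |0⟩⟨0|)` (first the control qubit, then the
new qubit) and `b`. -/
def extender : Resource Angle Bool Unit (Bool × Bool × Bool) :=
  Channel.controlled fun θ : Angle => Channel.ofKraus (extendKraus θ) (extendKraus_complete θ)

section Graphs

variable {V : Type} [Fintype V] [DecidableEq V]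

open Classical in
/-- Amplitudes of the blind graph state
`|G(θ)⟩ = (∏_{e ∈ E} CZ_e) (∏_v R_Z^v(θ_v)) ⨂_v |+⟩_v`; all the gates are diagonal. -/
def blindGraphState (G : SimpleGraph V) (θ : V → Angle) (x : V → Bool) : ℂ :=
  (∏ e ∈ G.edgeFinset, if ∀ v ∈ e, x v = true then (-1 : ℂ) else 1) *
    (∏ v, rz (angleValue (θ v)) (x v) (x v)) * ∏ _v : V, ((Real.sqrt 2 : ℝ) : ℂ)⁻¹

lemma blindGraphState_normalized (G : SimpleGraph V) (θ : V → Angle) :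
    ∑ x, star (blindGraphState G θ x) * blindGraphState G θ x = 1 := by
  classical
  have hx : ∀ x, star (blindGraphState G θ x) * blindGraphState G θ x
      = (1 / 2) ^ Fintype.card V := by
    intro x
    have hn : ‖blindGraphState G θ x‖ = (Real.sqrt 2)⁻¹ ^ Fintype.card V := by
      rw [blindGraphState, norm_mul, norm_mul, norm_prod, norm_prod, norm_prod,
        Finset.prod_eq_one, Finset.prod_eq_one]
      · simp [abs_of_nonneg]
      · intro v _
        rw [rz, Matrix.diagonal_apply_eq, Complex.norm_exp_ofReal_mul_I]
      · intro e _
        split_ifs <;> simp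
    rw [Complex.star_def, Complex.conj_mul', hn]
    push_cast
    rw [← pow_mul, mul_comm, pow_mul, sq, inv_sqrt_two_mul_self]
  simp only [hx, Finset.sum_const, Finset.card_univ, Fintype.card_fun, Fintype.card_bool]
  simp

instance : DecidableEq (SimpleGraph V) := Classical.decEq _

/-- Remote Blind Graph State Preparation on vertex set `V`. Alice inputs a graph `G` and angles
`θ`; Bob receives `|G(θ)⟩` and the description of `G`. -/
def rsp : Resource (SimpleGraph V × (V → Angle)) Unit Unit ((V → Bool) × SimpleGraph V) :=
  Channel.controlled fun c : SimpleGraph V × (V → Angle) =>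
    ((Channel.prepare (blindGraphState c.1 c.2) (blindGraphState_normalized c.1 c.2)).andThen
      (Channel.attach c.1)).andThen (Channel.relabel (Equiv.punitProd _).symm)

/-- The resource `rsp` with the public graph `G` as Alice's first input. -/
def rspFor (G : SimpleGraph V) :
    Resource (V → Angle) Unit Unit ((V → Bool) × SimpleGraph V) :=
  (Channel.classical fun p : (V → Angle) × Unit => ((G, p.1), ())).andThen rsp

end Graphs

/-! ## The protocol -/

section Protocol

variable {V : Type} [Fintype V] [DecidableEq V] {Qe : Type} [Fintype Qe] [DecidableEq Qe]

/-- The vertices in the order in which they are generated are `ord 0, ord 1, …`; emitter `q`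
generates the vertices `v` with `em v = q`. `Precedes ord em u v` says that `u` is the vertex
right before `v` in the list of its emitter. -/
def Precedes (ord : Fin (Fintype.card V) ≃ V) (em : V → Qe) (u v : V) : Prop :=
  em u = em v ∧ ord.symm u < ord.symm v ∧
    ∀ w, em w = em v → ¬ (ord.symm u < ord.symm w ∧ ord.symm w < ord.symm v)

/-- `v` is the last vertex in the list of emitter `q`. -/
def IsLast (ord : Fin (Fintype.card V) ≃ V) (em : V → Qe) (q : Qe) (v : V) : Prop :=
  em v = q ∧ ∀ w, em w = q → ord.symm w ≤ ord.symm v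

/-- The edge between `v` and the earlier vertex `w` has to be created by an entangling operation
(an edge between consecutive vertices of one emitter arises from the emission itself). -/
def IsLink (G : SimpleGraph V) (ord : Fin (Fintype.card V) ≃ V) (em : V → Qe) (v w : V) : Prop :=
  G.Adj v w ∧ ord.symm w < ord.symm v ∧ ¬ Precedes ord em w v

/-- The choices left to Bob. Vertex `v` carries a main photon (the one coming from the resource)
and `extra v` additional photons. -/
structure BobChoices (G : SimpleGraph V) (ord : Fin (Fintype.card V) ≃ V) (em : V → Qe) where
  /-- Number of additional photons at each vertex. -/
  extra : V → ℕ
  /-- The round at the end of which the emitter of `v` leaves `v` by a Hadamard gate. -/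
  release : V → Fin (Fintype.card V)
  /-- How the edge between `v` and the earlier vertex `w` is created: by a `CZ` between the two
  emitters (`none`), or by fusion of the given additional photons of `v` and `w`. -/
  fuse : (v w : V) → Option (Fin (extra v) × Fin (extra w))
  /-- The photon of `u` which gets the correction `Z^{b_v}` when `u` precedes `v`
  (`none` is the main photon). -/
  corr : (v u : V) → Option (Fin (extra u))
  /-- The photon of `u` which gets the correction `Z^{c_q}` when `u` is the last vertex of `q`. -/
  corrLast : (u : V) → Option (Fin (extra u))
  /-- The emitter cannot leave `v` before `v` is generated, ... -/
  le_release : ∀ v, ord.symm v ≤ release v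
  /-- ... and has left it before it is used for its next vertex. -/
  release_lt : ∀ u v, Precedes ord em u v → release u < ord.symm v
  /-- A `CZ` between emitters requires that the emitter of `w` is still situated at `w`. -/
  still_there : ∀ v w, IsLink G ord em v w → fuse v w = none → ord.symm v ≤ release w
  /-- An additional photon is consumed by at most one fusion. -/
  fuse_once : ∀ v w v' w' p p', IsLink G ord em v w → IsLink G ord em v' w' →
    fuse v w = some p → fuse v' w' = some p' → (v, w) ≠ (v', w') →
    ∀ s ∈ ({⟨v, p.1⟩, ⟨w, p.2⟩} : Finset (Σ u, Fin (extra u))),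
      s ∉ ({⟨v', p'.1⟩, ⟨w', p'.2⟩} : Finset (Σ u, Fin (extra u)))
  /-- The photon which gets the correction `Z^{b_v}` has not been consumed before. -/
  corr_available : ∀ u v k, Precedes ord em u v → corr v u = some k →
    ∀ v' w' p, IsLink G ord em v' w' → ord.symm v' < ord.symm v → fuse v' w' = some p →
      (⟨u, k⟩ : Σ u, Fin (extra u)) ∉ ({⟨v', p.1⟩, ⟨w', p.2⟩} : Finset (Σ u, Fin (extra u)))
  /-- The photon which gets the correction `Z^{c_q}` has not been consumed. -/
  corrLast_available : ∀ u k, corrLast u = some k →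
    ∀ v' w' p, IsLink G ord em v' w' → fuse v' w' = some p →
      (⟨u, k⟩ : Σ u, Fin (extra u)) ∉ ({⟨v', p.1⟩, ⟨w', p.2⟩} : Finset (Σ u, Fin (extra u)))

/-- Bob's qubits: a main photon for each vertex, the spin qubit of each emitter, the additional
photons, and a register for each bit `b_v`. -/
abbrev BobQubit (V Qe : Type) (extra : V → ℕ) : Type :=
  V ⊕ (Qe ⊕ ((Σ v : V, Fin (extra v)) ⊕ V))

section BobQubits

variable {extra : V → ℕ}

/-- The main photon of `v`. -/
def mainPhoton (v : V) : BobQubit V Qe extra := .inl v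

/-- The spin qubit of emitter `q`. -/
def spin (q : Qe) : BobQubit V Qe extra := .inr (.inl q)

/-- The additional photon `s.2` of vertex `s.1`. -/
def addPhoton (s : Σ v : V, Fin (extra v)) : BobQubit V Qe extra := .inr (.inr (.inl s))

/-- The register holding `b_v`. -/
def bitReg (v : V) : BobQubit V Qe extra := .inr (.inr (.inr v))

/-- The main photon of `v` (`none`) or one of its additional photons. -/
def photon (v : V) : Option (Fin (extra v)) → BobQubit V Qe extra
  | none => mainPhoton v
  | some k => addPhoton ⟨v, k⟩

end BobQubits

namespace BobChoices

variable {G : SimpleGraph V} {ord : Fin (Fintype.card V) ≃ V} {em : V → Qe}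
  (B : BobChoices G ord em)

/-- Bob's qubits for the given choices. -/
abbrev Qubit : Type := BobQubit V Qe B.extra

/-- The vertices, in the order in which they are generated. -/
def vertices (ord : Fin (Fintype.card V) ≃ V) : List V := List.ofFn ord

/-- Measurement of qubit `a` in the basis `|±⟩` with outcome `s`, followed by the correction `Z^s`
on qubit `r`. -/
def measX (a r : B.Qubit) : List (Instr B.Qubit) := [.had a, .meas a, .cz a r]

/-- (Successful) fusion of additional photons `s` and `t`: measurement in the maximally entangled
basis `CZ |±⟩|±⟩` (a Bell measurement after a Hadamard gate on one photon), and `Z` corrections on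
the main photons of both vertices, which creates an edge between the vertices. -/
def fusion (s t : Σ v, Fin (B.extra v)) : List (Instr B.Qubit) :=
  [.cz (addPhoton s) (addPhoton t), .had (addPhoton s), .had (addPhoton t),
    .meas (addPhoton s), .meas (addPhoton t),
    .cz (addPhoton s) (mainPhoton s.1), .cz (addPhoton t) (mainPhoton t.1)]

/-- Creation of the edge between `v` and the earlier vertex `w`. -/
def entangle (v w : V) : List (Instr B.Qubit) :=
  match B.fuse v w with
  | none => [.cz (spin (em v)) (spin (em w))]
  | some p => B.fusion ⟨v, p.1⟩ ⟨w, p.2⟩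

/-- The emitters are initialised in the state `|+⟩` (from `|0⟩`). -/
def initCircuit : List (Instr B.Qubit) :=
  (Finset.univ : Finset Qe).toList.map fun q => .had (spin q)

open Classical in
/-- The correction `X^{b_v}` on both qubits received from the resource and `Z^{b_v}` on a photon of
the vertex preceding `v`, if it exists. -/
def correctionCircuit (v : V) : List (Instr B.Qubit) :=
  [.cnot (bitReg v) (spin (em v)) (by simp [bitReg, spin]),
    .cnot (bitReg v) (mainPhoton v) (by simp [bitReg, mainPhoton])] ++
  ((vertices ord).filter fun u => Precedes ord em u v).map fun u =>
    .cz (bitReg v) (photon u (B.corr v u))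

/-- Emission of the additional photons of `v` by `E_qe`, i.e. by a `CNOT` onto a photon in the
state `|0⟩`. -/
def emissionCircuit (v : V) : List (Instr B.Qubit) :=
  (List.finRange (B.extra v)).map fun k =>
    .cnot (spin (em v)) (addPhoton ⟨v, k⟩) (by simp [spin, addPhoton])

open Classical in
/-- The entangling operations between `v` and earlier vertices. -/
def entanglingCircuit (v : V) : List (Instr B.Qubit) :=
  ((vertices ord).filter fun w => IsLink G ord em v w).flatMap fun w => B.entangle v w

/-- The Hadamard gates on the emitters that leave their vertex at the end of round `i`. -/
def releaseCircuit (i : Fin (Fintype.card V)) : List (Instr B.Qubit) :=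
  ((vertices ord).filter fun u => B.release u = i).map fun u => .had (spin (em u))

/-- Bob's operations in round `i` after he has received the answer of the resource. -/
def roundCircuit (i : Fin (Fintype.card V)) : List (Instr B.Qubit) :=
  B.correctionCircuit (ord i) ++ B.emissionCircuit (ord i) ++ B.entanglingCircuit (ord i) ++
    B.releaseCircuit i

open Classical in
/-- Measurement of the spin of emitter `q`, and correction on its last vertex, if it exists. -/
def spinCircuit (q : Qe) : List (Instr B.Qubit) :=
  .meas (spin q) :: ((vertices ord).filter fun v => IsLast ord em q v).map fun v =>
    .cz (spin q) (photon v (B.corrLast v))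

/-- The additional photon `s` is consumed by a fusion. -/
def IsConsumed (s : Σ v, Fin (B.extra v)) : Prop :=
  ∃ v w p, IsLink G ord em v w ∧ B.fuse v w = some p ∧ (s = ⟨v, p.1⟩ ∨ s = ⟨w, p.2⟩)

open Classical in
/-- Measurement of the leftover additional photons in the basis `|±⟩`, with corrections. -/
def leftoverCircuit : List (Instr B.Qubit) :=
  ((Finset.univ : Finset (Σ v, Fin (B.extra v))).toList.filter fun s => ¬ B.IsConsumed s).flatMap
    fun s => B.measX (addPhoton s) (mainPhoton s.1)

/-- Bob's operations after the last round. -/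
def finalCircuit : List (Instr B.Qubit) :=
  (Finset.univ : Finset Qe).toList.flatMap B.spinCircuit ++ B.leftoverCircuit

/-- Bob's converter. He outputs the main photons and the description of the public graph. -/
def converter :
    Converter Unit ((V → Bool) × SimpleGraph V) Bool (Bool × Bool × Bool) (Fintype.card V) where
  Mem := B.Qubit → Bool
  start := (Channel.classical fun _ => fun _ => false).andThen (run B.initCircuit)
  send i := (Channel.attach false).andThen (Channel.relabel (swapOne (spin (em (ord i)))))
  receive i := ((Channel.relabel (swapThree (spin (em (ord i))) (mainPhoton (ord i))
    (bitReg (ord i)) (by simp [spin, mainPhoton]) (by simp [spin, bitReg])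
    (by simp [mainPhoton, bitReg]))).andThen Channel.discardRight).andThen (run (B.roundCircuit i))
  finish := (((run B.finalCircuit).andThen
    (Channel.relabel (Equiv.sumArrowEquivProdArrow _ _ _))).andThen
    Channel.discardRight).andThen (Channel.attach G)

end BobChoices

/-- Alice's converter: she stores her (classical) angles and inputs `θ_v` in the round of `v`. -/
def aliceConverter (ord : Fin (Fintype.card V) ≃ V) :
    Converter (V → Angle) Unit Angle Unit (Fintype.card V) where
  Mem := V → Angle
  start := Channel.classical fun θ => θ
  send i := Channel.classical fun θ => (θ, θ (ord i))
  receive _ := Channel.discardRight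
  finish := Channel.classical fun _ => ()

open Classical in
/-- The simulator's undoing of the `CZ` gates of the graph `G`, one for each edge. -/
def uncomputeCircuit (ord : Fin (Fintype.card V) ≃ V) (G : SimpleGraph V) : List (Instr V) :=
  ((Finset.univ : Finset (V × V)).filter fun p =>
    ord.symm p.1 < ord.symm p.2 ∧ G.Adj p.1 p.2).toList.map fun p => .cz p.1 p.2

/-- The simulator's register together with Bob's qubit (`0`), a fresh qubit (`1`) and a register
for the bit (`2`). -/
def simRegister (V : Type) :
    ((V → Bool) × Bool) × (Bool × Bool) ≃ (V ⊕ Fin 3 → Bool) where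
  toFun m := Sum.elim m.1.1 ![m.1.2, m.2.1, m.2.2]
  invFun x := ((fun v => x (.inl v), x (.inr 0)), (x (.inr 1), x (.inr 2)))
  left_inv _ := rfl
  right_inv x := by
    funext s
    rcases s with v | k
    · rfl
    · fin_cases k <;> rfl

/-- The same register, with the three qubits sent back to Bob separated. -/
def simOutput (V : Type) : (V ⊕ Fin 3 → Bool) ≃ (V → Bool) × (Bool × Bool × Bool) :=
  ((simRegister V).symm.trans (Equiv.prodAssoc _ _ _))

/-- The simulator's answer to a message for vertex `v`: a `CNOT` from Bob's qubit onto the qubit of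
`v`, a measurement of the latter, a `CNOT` from Bob's qubit onto a fresh qubit, and a copy of the
outcome. -/
def answerCircuit (v : V) : List (Instr (V ⊕ Fin 3)) :=
  [.cnot (.inr 0) (.inl v) (by simp), .meas (.inl v), .cnot (.inr 0) (.inr 1) (by simp),
    .cnot (.inl v) (.inr 2) (by simp)]

/-- The CNOT-and-measure simulator. -/
def graphSimulator (ord : Fin (Fintype.card V) ≃ V) :
    Simulator Unit ((V → Bool) × SimpleGraph V) Bool (Bool × Bool × Bool) (Fintype.card V) where
  Mem := V → Bool
  init := Channel.classical fun _ => ((), fun _ => false)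
  absorb := (Channel.discardRight.andThen (Channel.relabel (Equiv.prodComm _ _))).andThen
    (Channel.controlled fun G : SimpleGraph V => run (uncomputeCircuit ord G))
  step i := (((Channel.attach (false, false)).andThen
    (Channel.relabel (simRegister V))).andThen (run (answerCircuit (ord i)))).andThen
    (Channel.relabel (simOutput V))

end Protocol

end BlindGraph

end

/-!
Perfect construction of remote blind graph state preparation from blind graph state extenders.

**Security.** A state shared with a distinguisher is handled through its blocks with respect to the
distinguisher's memory, so that two systems are perfectly indistinguishable as soon as their
internal states satisfy, throughout the interaction, linear relations that determine the outputs
(`prob_eq_of_simulationRelation`). Here the relation (`securityRelation`) says that the qubits which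
the simulator has not measured yet are in the states `R_Z(θ_v) |+⟩`, those already measured being
traced out. It holds at first because the simulator undoes the `CZ` gates of the graph. It is
preserved in a round (`securityRelation_step`) because measuring the qubit `v` with outcome `b`,
after a `CNOT` from Bob's qubit `|x⟩`, leaves the amplitude of `R_Z(θ_v) |+⟩` at `x + b`. Up to a
phase this is the amplitude of `R_Z((-1)^b θ_v) |+⟩` at `x`, and both values of `b` are equally
likely.

**Correctness.** For fixed angles, Bob's register is always in a pure state some of whose qubits have
been measured (`dephased`): a correction controlled by an outcome is a gate controlled by the
measured qubit, so amplitudes can be followed as if nothing had been measured. These amplitudes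
factor (`IsWave`) into those of a partially built graph state on the main photons (`amplitude`) and
one factor for each other qubit, which depends only on its `Status`: it is still `|0⟩`, or
independent of the rest, or a copy of the main photon of some vertex, or such a copy after a Hadamard
gate. Each of Bob's operations changes these data in a simple way:
* a gate between copies of the main photons of `v` and `w`, be it a `CZ` of spins or a fusion,
  creates the edge from `v` to `w` (`IsWave.cz_carries`, `IsWave.fusion`);
* a copy after a Hadamard gate is decoupled by a measurement with a `Z` correction
  (`IsWave.cz_dual`);
* sending the spin, left from `u` by a Hadamard gate, to the extender makes it a copy of the new main
  photon, creates the edge from `u` to `v`, and leaves a sign `(-1)^(b x_u)`, removed by the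
  correction `Z^{b_v}` (`IsWave.extend`).

The invariant `BobChoices.Stage` records all the statuses at a given point of the protocol, whatever
Bob's choices are. It is established by the initialisation (`BobChoices.completed_init`) and
maintained by the rounds (`BobChoices.Completed.round`), and the final measurements decouple all
qubits but the main photons (`BobChoices.Completed.final`). What is left is the blind graph state, up
to a constant, which has to be `1` since channels preserve the trace. Alice's angles, which Alice
stores classically, are dealt with one value at a time (`classicalQuantum`).
-/

open scoped ComplexOrder Matrix Kronecker

noncomputable section

set_option linter.unusedSectionVars false

namespace BlindGraph

/-! ### Entries of the images of channels -/

namespace Channel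

variable {I J K L D C E : Type} [Fintype I] [Fintype J] [Fintype K] [Fintype L] [Fintype D]
  [Fintype C] [Fintype E]

lemma andThen_toLin (Φ : Channel I J) (Ψ : Channel J K) (ρ : Matrix I I ℂ) :
    (Φ.andThen Ψ).toLin ρ = Ψ.toLin (Φ.toLin ρ) := rfl

lemma relabel_apply (e : I ≃ J) (ρ : Matrix I I ℂ) (p q : J) :
    (relabel e).toLin ρ p q = ρ (e.symm p) (e.symm q) := rfl

lemma onRight_apply (Φ : Channel I J) (ρ : Matrix (D × I) (D × I) ℂ) (p q : D × J) :
    (Φ.onRight D).toLin ρ p q =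
      Φ.toLin (Matrix.of fun i i' => ρ (p.1, i) (q.1, i')) p.2 q.2 := rfl

lemma onLeft_apply (Φ : Channel I J) (ρ : Matrix (I × D) (I × D) ℂ) (p q : J × D) :
    (Φ.onLeft D).toLin ρ p q =
      Φ.toLin (Matrix.of fun i i' => ρ (i, p.2) (i', q.2)) p.1 q.1 := rfl

lemma tensor_toLin (Φ : Channel I J) (Ψ : Channel K L) (ρ : Matrix (I × K) (I × K) ℂ) :
    (Φ.tensor Ψ).toLin ρ = (Ψ.onRight J).toLin ((Φ.onLeft K).toLin ρ) := rfl

lemma discardRight_apply (ρ : Matrix (I × E) (I × E) ℂ) (i i' : I) :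
    (discardRight : Channel (I × E) I).toLin ρ i i' = ∑ e, ρ (i, e) (i', e) := rfl

lemma controlled_apply (Φ : C → Channel I J) (ρ : Matrix (C × I) (C × I) ℂ) :
    (controlled Φ).toLin ρ =
      ∑ c, (Φ c).toLin (Matrix.of fun i i' => ρ (c, i) (c, i')) := by
  simp only [controlled, LinearMap.sum_apply]
  rfl

lemma ofKraus_toLin {κ : Type} [Fintype κ] [DecidableEq I] (M : κ → Matrix J I ℂ)
    (hM : ∑ k, (M k)ᴴ * M k = 1) (ρ : Matrix I I ℂ) :
    (ofKraus M hM).toLin ρ = ∑ k, M k * ρ * (M k)ᴴ := rfl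

lemma ofUnitary_toLin [DecidableEq I] (U : Matrix J I ℂ) (hU : Uᴴ * U = 1) (ρ : Matrix I I ℂ) :
    (ofUnitary U hU).toLin ρ = U * ρ * Uᴴ := by
  simp [ofUnitary, ofKraus_toLin]

lemma classical_apply [DecidableEq I] [DecidableEq J] (f : I → J) (ρ : Matrix I I ℂ) (j j' : J) :
    (classical f).toLin ρ j j' = ∑ i, if f i = j ∧ f i = j' then ρ i i else 0 := by
  rw [classical, ofKraus_toLin, Matrix.sum_apply]
  refine Finset.sum_congr rfl fun i _ => ?_
  rw [Matrix.conjTranspose_single, Matrix.single_mul_mul_single, star_one, one_mul, mul_one,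
    Matrix.single_apply]

lemma attach_apply [DecidableEq I] [DecidableEq E] (e : E) (ρ : Matrix I I ℂ) (p q : I × E) :
    (attach e).toLin ρ p q = if p.2 = e ∧ q.2 = e then ρ p.1 q.1 else 0 := by
  obtain ⟨i, a⟩ := p
  obtain ⟨i', a'⟩ := q
  rw [attach, ofUnitary_toLin]
  simp only [Matrix.mul_apply, Matrix.conjTranspose_apply, Matrix.of_apply, Prod.mk.injEq]
  by_cases h : a = e <;> by_cases h' : a' = e <;> simp [h, h']

/-- Every entry of `Φ ρ` is a fixed linear combination of the entries of `ρ`. -/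
lemma toLin_apply_eq_sum (Φ : Channel I J) (j j' : J) :
    ∃ c : I → I → ℂ, ∀ ρ : Matrix I I ℂ, Φ.toLin ρ j j' = ∑ i, ∑ i', c i i' * ρ i i' := by
  classical
  refine ⟨fun i i' => Φ.toLin (Matrix.single i i' 1) j j', fun ρ => ?_⟩
  conv_lhs => rw [Matrix.matrix_eq_sum_single ρ]
  simp only [map_sum, Matrix.sum_apply]
  refine Finset.sum_congr rfl fun i _ => Finset.sum_congr rfl fun i' _ => ?_
  have : Matrix.single i i' (ρ i i') = ρ i i' • Matrix.single i i' (1 : ℂ) := by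
    simp [Matrix.smul_single]
  rw [this, map_smul, Matrix.smul_apply, smul_eq_mul, mul_comm]

lemma iterate_rel {n : ℕ} (f : Fin n → Channel I I) (g : Fin n → Channel J J)
    (R : ℕ → Matrix I I ℂ → Matrix J J ℂ → Prop)
    (h : ∀ (i : Fin n) ρ σ, R i ρ σ → R (i + 1) ((f i).toLin ρ) ((g i).toLin σ))
    {ρ : Matrix I I ℂ} {σ : Matrix J J ℂ} (h0 : R 0 ρ σ) :
    R n ((iterate n f).toLin ρ) ((iterate n g).toLin σ) := by
  induction n with
  | zero => exact h0
  | succ n ih => exact h (Fin.last n) _ _ (ih _ _ (fun i => h i.castSucc))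

lemma iterate_induction {n : ℕ} (f : Fin n → Channel I I) (P : ℕ → Matrix I I ℂ → Prop)
    (h : ∀ (i : Fin n) ρ, P i ρ → P (i + 1) ((f i).toLin ρ))
    {ρ : Matrix I I ℂ} (h0 : P 0 ρ) : P n ((iterate n f).toLin ρ) :=
  iterate_rel f f (fun k ρ _ => P k ρ) (fun i ρ _ => h i ρ) (σ := ρ) h0

end Channel

/-! ### Indistinguishability by simulation relations -/

section Simulation

variable {X Y In Out : Type} [Fintype X] [Fintype Y] [Fintype In] [Fintype Out] {n : ℕ}

/-- The block of `ρ` given by the indices `i`, `i'` of the first register. -/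
def sliceLeft {I K : Type} (ρ : Matrix (I × K) (I × K) ℂ) (i i' : I) : Matrix K K ℂ :=
  Matrix.of fun k k' => ρ (i, k) (i', k')

/-- The block of `ρ` given by the indices `k`, `k'` of the second register. -/
def sliceRight {I K : Type} (ρ : Matrix (I × K) (I × K) ℂ) (k k' : K) : Matrix I I ℂ :=
  Matrix.of fun i i' => ρ (i, k) (i', k')

/-- Operations on a side register preserve every linear relation between the blocks. -/
lemma mem_of_sideOperation {I J K L : Type} [Fintype I] [Fintype J] [Fintype K] [Fintype L]
    (Φ : Channel I J) (R : Submodule ℂ (Matrix K K ℂ × Matrix L L ℂ))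
    (ρ : Matrix (I × K) (I × K) ℂ) (σ : Matrix (I × L) (I × L) ℂ)
    (h : ∀ i i', (sliceLeft ρ i i', sliceLeft σ i i') ∈ R) (j j' : J) :
    (sliceLeft ((Φ.onLeft K).toLin ρ) j j', sliceLeft ((Φ.onLeft L).toLin σ) j j') ∈ R := by
  obtain ⟨c, hc⟩ := Φ.toLin_apply_eq_sum j j'
  have h1 : sliceLeft ((Φ.onLeft K).toLin ρ) j j' = ∑ i, ∑ i', c i i' • sliceLeft ρ i i' := by
    ext k k'
    simp only [sliceLeft, Matrix.of_apply, Channel.onLeft_apply, hc, Matrix.sum_apply,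
      Matrix.smul_apply, smul_eq_mul]
  have h2 : sliceLeft ((Φ.onLeft L).toLin σ) j j' = ∑ i, ∑ i', c i i' • sliceLeft σ i i' := by
    ext k k'
    simp only [sliceLeft, Matrix.of_apply, Channel.onLeft_apply, hc, Matrix.sum_apply,
      Matrix.smul_apply, smul_eq_mul]
  have h3 : (sliceLeft ((Φ.onLeft K).toLin ρ) j j', sliceLeft ((Φ.onLeft L).toLin σ) j j')
      = ∑ i, ∑ i', c i i' • (sliceLeft ρ i i', sliceLeft σ i i') := by
    rw [h1, h2]
    refine Prod.ext ?_ ?_ <;> simp only [Prod.fst_sum, Prod.snd_sum, Prod.smul_mk]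
  rw [h3]
  exact R.sum_mem fun i _ => R.sum_mem fun i' _ => R.smul_mem _ (h i i')

/-- Two systems are perfectly indistinguishable if their internal states are related, throughout
the interaction, by linear relations that determine the final outputs. Linearity is what allows the
relation to be imposed on the blocks of a state that is entangled with the distinguisher. -/
theorem prob_eq_of_simulationRelation (S T : System X Y In Out n)
    (R : ℕ → Submodule ℂ (Matrix S.Mem S.Mem ℂ × Matrix T.Mem T.Mem ℂ))
    (hstart : ∀ ρ, (S.start.toLin ρ, T.start.toLin ρ) ∈ R 0)
    (hstep : ∀ (k : Fin n) (ρ : Matrix (S.Mem × In) (S.Mem × In) ℂ)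
      (σ : Matrix (T.Mem × In) (T.Mem × In) ℂ),
      (∀ i i', (sliceRight ρ i i', sliceRight σ i i') ∈ R k) →
      ∀ o o', (sliceRight ((S.step k).toLin ρ) o o', sliceRight ((T.step k).toLin σ) o o') ∈
        R (k + 1))
    (hfinish : ∀ p ∈ R n, S.finish.toLin p.1 = T.finish.toLin p.2)
    (𝒟 : Distinguisher X Y In Out n) : 𝒟.prob S = 𝒟.prob T := by
  have key : (𝒟.interact S).toLin 1 = (𝒟.interact T).toLin 1 := by
    simp only [Distinguisher.interact, Channel.andThen_toLin]
    congr 1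
    have hit := Channel.iterate_rel
      (fun i => (((((𝒟.ask i).onLeft S.Mem).andThen
        (Channel.relabel ((swapLast 𝒟.Mem In S.Mem).trans (Equiv.prodAssoc _ _ _)))).andThen
        ((S.step i).onRight 𝒟.Mem)).andThen
        (Channel.relabel ((Equiv.prodAssoc _ _ _).symm.trans
          (swapLast 𝒟.Mem S.Mem Out)))).andThen
        ((𝒟.hear i).onLeft S.Mem))
      (fun i => (((((𝒟.ask i).onLeft T.Mem).andThen
        (Channel.relabel ((swapLast 𝒟.Mem In T.Mem).trans (Equiv.prodAssoc _ _ _)))).andThen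
        ((T.step i).onRight 𝒟.Mem)).andThen
        (Channel.relabel ((Equiv.prodAssoc _ _ _).symm.trans
          (swapLast 𝒟.Mem T.Mem Out)))).andThen
        ((𝒟.hear i).onLeft T.Mem))
      (fun k ρ σ => ∀ d d', (sliceLeft ρ d d', sliceLeft σ d d') ∈ R k)
      (ρ := (S.start.onRight 𝒟.Mem).toLin (𝒟.init.toLin 1))
      (σ := (T.start.onRight 𝒟.Mem).toLin (𝒟.init.toLin 1))
      (fun k ρ σ h => by
        simp only [Channel.andThen_toLin]
        refine mem_of_sideOperation _ _ _ _ ?_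
        rintro ⟨d, o⟩ ⟨d', o'⟩
        have hask := mem_of_sideOperation (𝒟.ask k) _ _ _ h
        exact hstep k
          (Matrix.of fun m m' => (((𝒟.ask k).onLeft S.Mem).toLin ρ)
            ((d, m.2), m.1) ((d', m'.2), m'.1))
          (Matrix.of fun m m' => (((𝒟.ask k).onLeft T.Mem).toLin σ)
            ((d, m.2), m.1) ((d', m'.2), m'.1))
          (fun i i' => hask (d, i) (d', i')) o o')
      (fun d d' => hstart (sliceLeft (𝒟.init.toLin 1) d d'))
    ext p q
    exact congrFun (congrFun (hfinish _ (hit p.1 q.1)) p.2) q.2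
  rw [Distinguisher.prob, Distinguisher.prob, key]

theorem indistinguishable_of_prob_eq {S T : System X Y In Out n}
    (h : ∀ 𝒟 : Distinguisher X Y In Out n, 𝒟.prob S = 𝒟.prob T) : Indistinguishable 0 S T := by
  intro 𝒟
  rw [h 𝒟, sub_self, abs_zero]

/-- Systems without intermediate messages are indistinguishable if they are equal as channels. -/
theorem indistinguishable_of_toLin_eq {S T : System X Y In Out 0}
    (h : ∀ ρ, S.finish.toLin (S.start.toLin ρ) = T.finish.toLin (T.start.toLin ρ)) :
    Indistinguishable 0 S T :=
  indistinguishable_of_prob_eq <| prob_eq_of_simulationRelation S T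
    (fun _ => LinearMap.eqLocus (S.finish.toLin ∘ₗ LinearMap.fst ℂ _ _)
      (T.finish.toLin ∘ₗ LinearMap.snd ℂ _ _))
    h (fun k => k.elim0) (fun _ hp => hp)

end Simulation

/-! ### Matrix elements of gates, circuits and resources -/

/-- The sign `(-1)^b`. -/
def sgn (b : Bool) : ℂ := if b then -1 else 1

@[simp] lemma sgn_false : sgn false = 1 := rfl

@[simp] lemma sgn_true : sgn true = -1 := rfl

@[simp] lemma star_sgn (b : Bool) : star (sgn b) = sgn b := by cases b <;> simp

lemma sgn_mul_self (b : Bool) : sgn b * sgn b = 1 := by cases b <;> simp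

lemma sgn_xor (a b : Bool) : sgn (xor a b) = sgn a * sgn b := by cases a <;> cases b <;> simp

/-- The phase `⟨x| R_Z(θ) |x⟩`. -/
def phase (θ : Angle) (x : Bool) : ℂ := rz (angleValue θ) x x

/-- Conjugation by `X` inverts the angle of a `Z` rotation. -/
lemma rz_signed (θ : Angle) (b x : Bool) :
    rz ((if b then -1 else 1) * angleValue θ) x x = phase θ (xor x b) := by
  cases b <;> cases x <;> simp [rz, phase, neg_div]

section Gates

variable {Q : Type} [Fintype Q] [DecidableEq Q]

lemma run_nil (ρ : Matrix (Q → Bool) (Q → Bool) ℂ) : (run []).toLin ρ = ρ := rfl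

lemma run_cons (g : Instr Q) (c : List (Instr Q)) (ρ : Matrix (Q → Bool) (Q → Bool) ℂ) :
    (run (g :: c)).toLin ρ = (run c).toLin (g.channel.toLin ρ) := rfl

lemma run_append (c d : List (Instr Q)) (ρ : Matrix (Q → Bool) (Q → Bool) ℂ) :
    (run (c ++ d)).toLin ρ = (run d).toLin ((run c).toLin ρ) := by
  induction c generalizing ρ with
  | nil => rfl
  | cons g c ih => simp only [List.cons_append, run_cons, ih]

lemma cz_apply (p q : Q) (ρ : Matrix (Q → Bool) (Q → Bool) ℂ) (x x' : Q → Bool) :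
    (Instr.cz p q).channel.toLin ρ x x' =
      sgn (x p && x q) * sgn (x' p && x' q) * ρ x x' := by
  rw [Instr.channel, Channel.ofUnitary_toLin, czMatrix, Matrix.diagonal_conjTranspose,
    Matrix.mul_diagonal, Matrix.diagonal_mul]
  have h : ∀ z : Q → Bool, (if z p = true ∧ z q = true then (-1 : ℂ) else 1) =
      sgn (z p && z q) := fun z => by cases z p <;> cases z q <;> simp
  simp only [Pi.star_apply, h, star_sgn]
  ring

lemma cnot_apply (p q : Q) (h : p ≠ q) (ρ : Matrix (Q → Bool) (Q → Bool) ℂ) (x x' : Q → Bool) :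
    (Instr.cnot p q h).channel.toLin ρ x x' =
      ρ (Function.update x q (xor (x q) (x p))) (Function.update x' q (xor (x' q) (x' p))) := by
  have key : ∀ z y : Q → Bool, z = Function.update y q (xor (y q) (y p)) ↔
      y = Function.update z q (xor (z q) (z p)) := by
    intro z y
    constructor <;> rintro rfl <;> simp [h]
  rw [Instr.channel, Channel.ofUnitary_toLin]
  simp only [Matrix.mul_apply, Matrix.conjTranspose_apply, cnotMatrix, Matrix.of_apply,
    key x, key x']
  simp

lemma meas_apply (q : Q) (ρ : Matrix (Q → Bool) (Q → Bool) ℂ) (x x' : Q → Bool) :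
    (Instr.meas q).channel.toLin ρ x x' = if x q = x' q then ρ x x' else 0 := by
  rw [Instr.channel, Channel.ofKraus_toLin, Matrix.sum_apply]
  simp only [projMatrix, Matrix.diagonal_conjTranspose, Matrix.mul_diagonal, Matrix.diagonal_mul,
    Fintype.sum_bool, Pi.star_apply]
  cases x q <;> cases x' q <;> simp

lemma hadMatrix_mulVec (q : Q) (f : (Q → Bool) → ℂ) (x : Q → Bool) :
    ∑ y, hadMatrix q x y * f y =
      ∑ b, ((Real.sqrt 2 : ℝ) : ℂ)⁻¹ * sgn (x q && b) * f (Function.update x q b) := by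
  have hinj : Function.Injective fun b : Bool => Function.update x q b := fun b c h => by
    simpa using congrFun h q
  rw [← Finset.sum_subset (Finset.subset_univ
    (Finset.univ.image fun b : Bool => Function.update x q b)), Finset.sum_image hinj.injOn]
  · refine Finset.sum_congr rfl fun b _ => ?_
    have h : ∀ r, r ≠ q → x r = Function.update x q b r := fun r hr => by simp [hr]
    rw [hadMatrix, Matrix.of_apply, if_pos h, Function.update_self]
    cases x q <;> cases b <;> simp
  · intro y _ hy
    have h : ¬ ∀ r, r ≠ q → x r = y r := fun h => hy <| Finset.mem_image.2
      ⟨y q, Finset.mem_univ _, by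
        funext r
        by_cases hr : r = q
        · subst hr; simp
        · simp [hr, h r hr]⟩
    rw [hadMatrix, Matrix.of_apply, if_neg h, zero_mul]

lemma had_apply (q : Q) (ρ : Matrix (Q → Bool) (Q → Bool) ℂ) (x x' : Q → Bool) :
    (Instr.had q).channel.toLin ρ x x' =
      ∑ b, ((Real.sqrt 2 : ℝ) : ℂ)⁻¹ * sgn (x q && b) *
        ∑ b', ((Real.sqrt 2 : ℝ) : ℂ)⁻¹ * sgn (x' q && b') *
          ρ (Function.update x q b) (Function.update x' q b') := by
  have hstar : ∀ z y : Q → Bool, star (hadMatrix q z y) = hadMatrix q z y := fun z y => by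
    simp only [hadMatrix, Matrix.of_apply]
    split_ifs <;> simp
  rw [Instr.channel, Channel.ofUnitary_toLin, Matrix.mul_assoc, Matrix.mul_apply,
    hadMatrix_mulVec]
  refine Finset.sum_congr rfl fun b _ => ?_
  congr 1
  rw [Matrix.mul_apply, ← hadMatrix_mulVec]
  refine Finset.sum_congr rfl fun y _ => ?_
  rw [Matrix.conjTranspose_apply, hstar, mul_comm]

/-- A circuit of controlled-`Z` gates multiplies matrix elements by signs. -/
lemma run_cz_apply {ι : Type} (l : List ι) (p q : ι → Q) (ρ : Matrix (Q → Bool) (Q → Bool) ℂ)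
    (x x' : Q → Bool) :
    (run (l.map fun i => Instr.cz (p i) (q i))).toLin ρ x x' =
      (l.map fun i => sgn (x (p i) && x (q i))).prod *
        (l.map fun i => sgn (x' (p i) && x' (q i))).prod * ρ x x' := by
  induction l generalizing ρ with
  | nil => simp [run_nil]
  | cons i l ih =>
    simp only [List.map_cons, run_cons, ih, cz_apply, List.prod_cons]
    ring

end Gates

lemma extender_ofKraus_apply (θ : Angle) (τ : Matrix Bool Bool ℂ) (u u' : Unit)
    (s f b s' f' b' : Bool) :
    (Channel.ofKraus (extendKraus θ) (extendKraus_complete θ)).toLin τ (u, s, f, b) (u', s', f', b')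
      = if f = s ∧ f' = s' ∧ b = b' then
          1 / 2 * (phase θ (xor s b) * star (phase θ (xor s' b))) * τ s s' else 0 := by
  have hs := inv_sqrt_two_mul_self
  have hss : (starRingEnd ℂ) ((Real.sqrt 2 : ℝ) : ℂ)⁻¹ = ((Real.sqrt 2 : ℝ) : ℂ)⁻¹ := by simp
  rw [Channel.ofKraus_toLin, Matrix.sum_apply]
  simp only [Matrix.mul_apply, Matrix.conjTranspose_apply, extendKraus, Matrix.of_apply,
    extendMatrix_apply, rz_signed, Fintype.sum_bool]
  rw [← hs]
  generalize ((Real.sqrt 2 : ℝ) : ℂ)⁻¹ = r at *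
  cases s <;> cases f <;> cases b <;> cases s' <;> cases f' <;> cases b' <;>
    simp [hss] <;> ring

lemma extender_apply (τ : Matrix (Angle × Bool) (Angle × Bool) ℂ) (u u' : Unit)
    (s f b s' f' b' : Bool) :
    extender.toLin τ (u, s, f, b) (u', s', f', b') =
      ∑ θ, if f = s ∧ f' = s' ∧ b = b' then
        1 / 2 * (phase θ (xor s b) * star (phase θ (xor s' b))) * τ (θ, s) (θ, s') else 0 := by
  rw [extender, Channel.controlled_apply, Matrix.sum_apply]
  simp only [extender_ofKraus_apply, Matrix.of_apply]

section Graphs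

variable {V : Type} [Fintype V] [DecidableEq V]

lemma rspFor_apply (G : SimpleGraph V) (ρ : Matrix ((V → Angle) × Unit) ((V → Angle) × Unit) ℂ)
    (u u' : Unit) (x x' : V → Bool) (g g' : SimpleGraph V) :
    (rspFor G).toLin ρ (u, x, g) (u', x', g') =
      if g = G ∧ g' = G then
        ∑ θ, blindGraphState G θ x * star (blindGraphState G θ x') * ρ (θ, ()) (θ, ()) else 0 := by
  have hterm : ∀ (c : SimpleGraph V × (V → Angle)) (τ : Matrix Unit Unit ℂ),
      (((Channel.prepare (blindGraphState c.1 c.2) (blindGraphState_normalized c.1 c.2)).andThen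
        (Channel.attach c.1)).andThen (Channel.relabel (Equiv.punitProd _).symm)).toLin τ
        (u, x, g) (u', x', g') = if g = c.1 ∧ g' = c.1 then
          blindGraphState c.1 c.2 x * star (blindGraphState c.1 c.2 x') * τ () () else 0 := by
    intro c τ
    simp only [Channel.andThen_toLin, Channel.relabel_apply, Channel.attach_apply,
      Channel.prepare, Channel.ofUnitary_toLin, Matrix.mul_apply, Matrix.conjTranspose_apply,
      Matrix.of_apply, Equiv.symm_symm, Equiv.punitProd_apply, Finset.univ_unique,
      Finset.sum_singleton, PUnit.default_eq_unit]
    congr 1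
    ring
  rw [rspFor, Channel.andThen_toLin, rsp, Channel.controlled_apply, Matrix.sum_apply]
  simp only [hterm, Matrix.of_apply, Channel.classical_apply]
  rw [Fintype.sum_prod_type, Finset.sum_eq_single G]
  · by_cases h : g = G ∧ g' = G
    · simp only [h, and_self, if_true]
      refine Finset.sum_congr rfl fun θ _ => ?_
      simp [Fintype.sum_prod_type, Prod.ext_iff]
    · simp [h]
  · intro G' _ hG'
    refine Finset.sum_eq_zero fun θ _ => ?_
    rw [Finset.sum_eq_zero]
    · simp
    · intro i _
      rw [if_neg]
      rintro ⟨h, -⟩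
      exact hG' (congrArg (fun z => z.1.1) h).symm
  · simp

/-- The signs of the `CZ` gates of `G`, with each edge written from its later to its earlier
vertex. -/
lemma prod_edgeFinset_eq (G : SimpleGraph V) [DecidableRel G.Adj] [Fintype G.edgeSet]
    (ord : Fin (Fintype.card V) ≃ V) (x : V → Bool) :
    (∏ e ∈ G.edgeFinset, if ∀ v ∈ e, x v = true then (-1 : ℂ) else 1) =
      ∏ p ∈ (Finset.univ : Finset (V × V)).filter
        (fun p => ord.symm p.1 < ord.symm p.2 ∧ G.Adj p.1 p.2), sgn (x p.1 && x p.2) := by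
  symm
  refine Finset.prod_bij (fun p _ => s(p.1, p.2)) ?_ ?_ ?_ ?_
  · rintro ⟨v, w⟩ h
    simpa using (Finset.mem_filter.1 h).2.2
  · rintro ⟨v, w⟩ h ⟨v', w'⟩ h' he
    simp only [Finset.mem_filter, Finset.mem_univ, true_and] at h h'
    rcases Sym2.eq_iff.1 he with ⟨h1, h2⟩ | ⟨h1, h2⟩
    · exact Prod.ext h1 h2
    · simp only at h1 h2
      subst h1 h2
      exact absurd h.1 (not_lt.2 h'.1.le)
  · intro e he
    induction e using Sym2.ind with
    | _ v w =>
      have hvw : G.Adj v w := by simpa using he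
      rcases lt_trichotomy (ord.symm v) (ord.symm w) with h | h | h
      · exact ⟨(v, w), by simpa using ⟨h, hvw⟩, rfl⟩
      · exact absurd (ord.symm.injective h) hvw.ne
      · exact ⟨(w, v), by simpa using ⟨h, hvw.symm⟩, Sym2.eq_swap⟩
  · rintro ⟨v, w⟩ _
    simp only [Sym2.mem_iff, forall_eq_or_imp, forall_eq]
    cases x v <;> cases x w <;> simp

end Graphs

/-! ### Security of the CNOT-and-measure simulator -/

section Security

variable {V : Type} [Fintype V] [DecidableEq V]

/-- The basis state that agrees with `z` on the first `k` vertices and with `y` on the others. -/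
def mergeAt (ord : Fin (Fintype.card V) ≃ V) (k : ℕ) (z y : V → Bool) : V → Bool :=
  fun v => if (ord.symm v : ℕ) < k then z v else y v

/-- Matrix elements of `∏ R_Z(θ_v) |+⟩⟨+|` over the vertices from the `k`-th one on, without the
normalisation. -/
def phaseTail (ord : Fin (Fintype.card V) ≃ V) (k : ℕ) (θ : V → Angle) (y y' : V → Bool) : ℂ :=
  ∏ v, if (ord.symm v : ℕ) < k then 1 else phase (θ v) (y v) * star (phase (θ v) (y' v))

/-- The relation between Alice's memory (her angles) and that of the simulator with the ideal
resource before round `k`: after tracing out the simulator's first `k` qubits, which it has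
measured, the others are in the states `R_Z(θ_v) |+⟩`. The sum over `z` counts each state of the
traced-out qubits `2 ^ (card V - k)` times, which makes up for the missing normalisation of
`phaseTail`. -/
def securityRelation (ord : Fin (Fintype.card V) ≃ V) (k : ℕ) :
    Submodule ℂ (Matrix (V → Angle) (V → Angle) ℂ ×
      Matrix (Unit × (V → Bool)) (Unit × (V → Bool)) ℂ) where
  carrier := {p | ∀ y y', ∑ z, p.2 ((), mergeAt ord k z y) ((), mergeAt ord k z y') =
    ∑ θ, phaseTail ord k θ y y' * p.1 θ θ}
  add_mem' {p q} hp hq y y' := by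
    simp only [Prod.fst_add, Prod.snd_add, Matrix.add_apply, mul_add, Finset.sum_add_distrib,
      hp y y', hq y y']
  zero_mem' y y' := by simp
  smul_mem' c p hp y y' := by
    simp only [Prod.smul_fst, Prod.smul_snd, Matrix.smul_apply, smul_eq_mul, ← Finset.mul_sum,
      hp y y', mul_left_comm]

/-- Fixing one bit of a sum over bit strings. -/
lemma sum_update_eq (v : V) (b : Bool) (f : (V → Bool) → ℂ) :
    ∑ z, (if z v = b then f z else 0) = 1 / 2 * ∑ z, f (Function.update z v b) := by
  have hmap : ∑ z : V → Bool, (if z v = b then f z else 0) =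
      ∑ z : V → Bool, (if z v ≠ b then f (Function.update z v b) else 0) := by
    rw [← Finset.sum_filter, ← Finset.sum_filter]
    refine Finset.sum_bij' (fun z _ => Function.update z v (!b)) (fun z _ => Function.update z v b)
      ?_ ?_ ?_ ?_ ?_
    · intro z _; simp
    · intro z _; simp
    · intro z hz; simp [← (Finset.mem_filter.1 hz).2]
    · intro z hz
      have : z v = !b := by simpa [Bool.eq_not] using (Finset.mem_filter.1 hz).2
      simp [← this]
    · intro z hz; simp [← (Finset.mem_filter.1 hz).2]
  have hsplit : ∑ z, f (Function.update z v b) =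
      ∑ z : V → Bool, (if z v = b then f z else 0) +
        ∑ z : V → Bool, (if z v ≠ b then f (Function.update z v b) else 0) := by
    rw [← Finset.sum_add_distrib]
    refine Finset.sum_congr rfl fun z _ => ?_
    by_cases h : z v = b
    · simp [← h]
    · simp [h]
  rw [hsplit, ← hmap]
  ring

/-- A round of the real system: Alice's converter with the extender. -/
def realStep (ord : Fin (Fintype.card V) ≃ V) (i : Fin (Fintype.card V)) :
    Channel ((V → Angle) × Bool) ((V → Angle) × (Bool × Bool × Bool)) :=
  ((((((Channel.classical fun θ : V → Angle => (θ, θ (ord i))).onLeft Bool).andThen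
    (Channel.relabel (Equiv.prodAssoc _ _ _))).andThen
    (extender.onRight (V → Angle))).andThen
    (Channel.relabel (Equiv.prodAssoc _ _ _).symm)).andThen
    (Channel.onLeft (Bool × Bool × Bool)
      (Channel.discardRight : Channel ((V → Angle) × Unit) (V → Angle))))

lemma realStep_apply (ord : Fin (Fintype.card V) ≃ V) (i : Fin (Fintype.card V))
    (ρ : Matrix ((V → Angle) × Bool) ((V → Angle) × Bool) ℂ) (θ : V → Angle)
    (s f b s' f' b' : Bool) :
    (realStep ord i).toLin ρ (θ, s, f, b) (θ, s', f', b') =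
      if f = s ∧ f' = s' ∧ b = b' then 1 / 2 * (phase (θ (ord i)) (xor s b) *
        star (phase (θ (ord i)) (xor s' b))) * ρ (θ, s) (θ, s') else 0 := by
  simp only [realStep, Channel.andThen_toLin, Channel.onLeft_apply,
    Channel.discardRight_apply, Channel.relabel_apply, Channel.onRight_apply, Matrix.of_apply,
    Finset.univ_unique, Finset.sum_singleton, Equiv.symm_symm, Equiv.prodAssoc_apply,
    extender_apply, Equiv.prodAssoc_symm_apply, Channel.classical_apply, Prod.mk.injEq]
  rw [Finset.sum_eq_single (θ (ord i))]
  · congr 2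
    rw [Finset.sum_eq_single θ] <;> simp +contextual
  · intro α _ hα
    rw [Finset.sum_eq_zero]
    · simp
    · rintro η -
      rw [if_neg]
      rintro ⟨⟨rfl, h⟩, -⟩
      exact hα h.symm
  · simp

/-- A round of the simulator. -/
def simulatorStep (ord : Fin (Fintype.card V) ≃ V) (i : Fin (Fintype.card V)) :
    Channel ((V → Bool) × Bool) ((V → Bool) × (Bool × Bool × Bool)) :=
  (((Channel.attach (false, false)).andThen
    (Channel.relabel (simRegister V))).andThen (run (answerCircuit (ord i)))).andThen
    (Channel.relabel (simOutput V))

lemma simulatorStep_apply (ord : Fin (Fintype.card V) ≃ V) (i : Fin (Fintype.card V))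
    (ρ : Matrix ((V → Bool) × Bool) ((V → Bool) × Bool) ℂ) (y y' : V → Bool)
    (s f b s' f' b' : Bool) :
    (simulatorStep ord i).toLin ρ (y, s, f, b) (y', s', f', b') =
      if (f = s ∧ f' = s' ∧ b = b') ∧ y (ord i) = b ∧ y' (ord i) = b then
        ρ (Function.update y (ord i) (xor s b), s) (Function.update y' (ord i) (xor s' b), s')
      else 0 := by
  have h1 : ∀ s f b c : Bool, Function.update ![s, f, b] 1 c = ![s, c, b] := fun s f b c => by
    funext k; fin_cases k <;> rfl
  have h2 : ∀ s f b c : Bool, Function.update ![s, f, b] 2 c = ![s, f, c] := fun s f b c => by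
    funext k; fin_cases k <;> rfl
  have g0 : ∀ s f b : Bool, ![s, f, b] 0 = s := fun _ _ _ => rfl
  have g1 : ∀ s f b : Bool, ![s, f, b] 1 = f := fun _ _ _ => rfl
  have g2 : ∀ s f b : Bool, ![s, f, b] 2 = b := fun _ _ _ => rfl
  have hsim : ∀ z, (simRegister V).symm z =
    ((fun v => z (.inl v), z (.inr 0)), (z (.inr 1), z (.inr 2))) := fun _ => rfl
  have hout : ∀ m, (simOutput V).symm m = Sum.elim m.1 ![m.2.1, m.2.2.1, m.2.2.2] := fun _ => rfl
  simp only [simulatorStep, Channel.andThen_toLin, Channel.relabel_apply, answerCircuit, run_cons,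
    run_nil, cnot_apply, meas_apply, Channel.attach_apply, hsim, hout, Sum.update_elim_inr, Sum.update_elim_inl, Sum.elim_inl, Sum.elim_inr,
    h1, h2, g0, g1, g2, Prod.mk.injEq]
  cases s <;> cases f <;> cases b <;> cases s' <;> cases f' <;> cases b' <;>
    cases hy : y (ord i) <;> cases hy' : y' (ord i) <;> rfl

lemma symm_lt_succ_iff (ord : Fin (Fintype.card V) ≃ V) (i : Fin (Fintype.card V)) (v : V) :
    (ord.symm v : ℕ) < (i : ℕ) + 1 ↔ (ord.symm v : ℕ) < i ∨ v = ord i := by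
  rw [Nat.lt_succ_iff_lt_or_eq, ← Fin.ext_iff, Equiv.symm_apply_eq]

lemma mergeAt_self (ord : Fin (Fintype.card V) ≃ V) (i : Fin (Fintype.card V)) (z y : V → Bool) :
    mergeAt ord (i + 1) z y (ord i) = z (ord i) := by
  simp [mergeAt]

lemma update_mergeAt (ord : Fin (Fintype.card V) ≃ V) (i : Fin (Fintype.card V)) (z y : V → Bool)
    (c : Bool) :
    Function.update (mergeAt ord (i + 1) z y) (ord i) c =
      mergeAt ord i z (Function.update y (ord i) c) := by
  funext v
  by_cases h : v = ord i
  · subst h; simp [mergeAt]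
  · simp only [mergeAt, h, symm_lt_succ_iff, or_false, ne_eq, not_false_eq_true,
      Function.update_of_ne]

lemma mergeAt_update (ord : Fin (Fintype.card V) ≃ V) (i : Fin (Fintype.card V)) (z y : V → Bool)
    (c : Bool) : mergeAt ord i (Function.update z (ord i) c) y = mergeAt ord i z y := by
  funext v
  by_cases h : v = ord i
  · subst h; simp [mergeAt]
  · simp [mergeAt, h]

lemma phaseTail_update (ord : Fin (Fintype.card V) ≃ V) (i : Fin (Fintype.card V))
    (θ : V → Angle) (y y' : V → Bool) (c c' : Bool) :
    phaseTail ord i θ (Function.update y (ord i) c) (Function.update y' (ord i) c') =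
      phase (θ (ord i)) c * star (phase (θ (ord i)) c') * phaseTail ord (i + 1) θ y y' := by
  rw [phaseTail, phaseTail, ← Finset.mul_prod_erase _ _ (Finset.mem_univ (ord i)),
    ← Finset.mul_prod_erase _ _ (Finset.mem_univ (ord i))]
  simp only [Equiv.symm_apply_apply, lt_irrefl, if_false, Function.update_self, Nat.lt_succ_self,
    if_true, one_mul]
  congr 1
  refine Finset.prod_congr rfl fun v hv => ?_
  have h : v ≠ ord i := Finset.ne_of_mem_erase hv
  simp only [h, symm_lt_succ_iff, or_false, ne_eq, not_false_eq_true, Function.update_of_ne]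

/-- A round of the simulator and a round of the real system preserve the relation: the outcome `b`
of the simulator is uniform, and projecting `R_Z(θ) |+⟩` after the `CNOT` leaves the phase
`R_Z((-1)^b θ)` on the qubit sent by Bob. -/
lemma securityRelation_step (ord : Fin (Fintype.card V) ≃ V) (i : Fin (Fintype.card V))
    (ρ : Matrix ((V → Angle) × Bool) ((V → Angle) × Bool) ℂ)
    (σ : Matrix ((Unit × (V → Bool)) × Bool) ((Unit × (V → Bool)) × Bool) ℂ)
    (h : ∀ s s', (sliceRight ρ s s', sliceRight σ s s') ∈ securityRelation ord i)
    (o o' : Bool × Bool × Bool) (y y' : V → Bool) :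
    ∑ z, (simulatorStep ord i).toLin
        (Matrix.of fun m m' => σ (((), m.1), m.2) (((), m'.1), m'.2))
        (mergeAt ord (i + 1) z y, o) (mergeAt ord (i + 1) z y', o') =
      ∑ θ, phaseTail ord (i + 1) θ y y' * (realStep ord i).toLin ρ (θ, o) (θ, o') := by
  obtain ⟨s, f, b⟩ := o
  obtain ⟨s', f', b'⟩ := o'
  simp only [simulatorStep_apply, realStep_apply, mergeAt_self, update_mergeAt, Matrix.of_apply]
  by_cases hC : f = s ∧ f' = s' ∧ b = b'
  · simp only [hC, and_self, true_and, if_true]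
    rw [sum_update_eq (ord i) b' fun z =>
      σ (((), mergeAt ord i z (Function.update y (ord i) (xor s b'))), s)
        (((), mergeAt ord i z (Function.update y' (ord i) (xor s' b'))), s')]
    simp only [mergeAt_update]
    refine (congrArg (fun t => 1 / 2 * t) (h s s' _ _)).trans ?_
    simp only [phaseTail_update, Finset.mul_sum, sliceRight, Matrix.of_apply]
    refine Finset.sum_congr rfl fun θ _ => ?_
    ring
  · simp [hC]

/-- The ideal resource, after the simulator has undone the `CZ` gates of the graph. -/
def idealStart (ord : Fin (Fintype.card V) ≃ V) (G : SimpleGraph V) :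
    Channel (V → Angle) (Unit × (V → Bool)) :=
  (((((Channel.relabel (Equiv.prodPUnit (V → Angle)).symm).andThen
    ((Channel.classical fun _ : Unit => ((), fun _ : V => false)).onRight (V → Angle))).andThen
    (Channel.relabel (Equiv.prodAssoc _ _ _).symm)).andThen
    ((rspFor G).onLeft (V → Bool))).andThen
    (Channel.relabel (Equiv.prodAssoc _ _ _))).andThen
    (((Channel.discardRight.andThen (Channel.relabel (Equiv.prodComm _ _))).andThen
    (Channel.controlled fun G : SimpleGraph V => run (uncomputeCircuit ord G))).onRight Unit)

lemma idealStart_apply (ord : Fin (Fintype.card V) ≃ V) (G : SimpleGraph V)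
    (ρ : Matrix (V → Angle) (V → Angle) ℂ) (x x' : V → Bool) :
    (idealStart ord G).toLin ρ ((), x) ((), x') =
      ∑ θ, (1 / 2) ^ Fintype.card V * phaseTail ord 0 θ x x' * ρ θ θ := by
  classical
  have hE : ∀ (θ : V → Angle) (x : V → Bool), ((((Finset.univ : Finset (V × V)).filter fun p =>
      ord.symm p.1 < ord.symm p.2 ∧ G.Adj p.1 p.2).toList.map fun p => sgn (x p.1 && x p.2)).prod) *
      blindGraphState G θ x = (∏ v, phase (θ v) (x v)) * ∏ _v : V, ((Real.sqrt 2 : ℝ) : ℂ)⁻¹ := by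
    intro θ x
    rw [blindGraphState, prod_edgeFinset_eq G ord, Finset.prod_map_toList, ← mul_assoc, ← mul_assoc,
      ← Finset.prod_mul_distrib]
    simp only [sgn_mul_self, Finset.prod_const_one, one_mul, phase]
  simp only [idealStart, Channel.andThen_toLin, Channel.onRight_apply, Channel.controlled_apply,
    Matrix.sum_apply, Channel.relabel_apply, Channel.discardRight_apply, Channel.onLeft_apply,
    uncomputeCircuit]
  simp only [run_cz_apply, Matrix.of_apply, Equiv.symm_symm, Equiv.prodAssoc_apply, Equiv.prodAssoc_symm_apply,
    Equiv.prodComm_symm, Equiv.prodComm_apply, Prod.swap_prod_mk, rspFor_apply,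
    Channel.classical_apply, Equiv.prodPUnit_apply]
  rw [Finset.sum_eq_single G (fun G' _ h => by simp [h]) (by simp),
    Finset.sum_eq_single (fun _ => false) (fun e _ h => by simp [h.symm]) (by simp)]
  simp only [and_self, if_true, Finset.univ_unique, Finset.sum_singleton, Finset.mul_sum]
  refine Finset.sum_congr rfl fun θ _ => ?_
  have hstar : ∀ l : List (V × V), star ((l.map fun p => sgn (x' p.1 && x' p.2)).prod) =
      (l.map fun p => sgn (x' p.1 && x' p.2)).prod := by
    intro l
    induction l with
    | nil => simp
    | cons p l ih => rw [List.map_cons, List.prod_cons, star_mul', ih, star_sgn]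
  have h2 : star (∏ _v : V, ((Real.sqrt 2 : ℝ) : ℂ)⁻¹) = ∏ _v : V, ((Real.sqrt 2 : ℝ) : ℂ)⁻¹ := by
    simp
  have h3 : (∏ _v : V, ((Real.sqrt 2 : ℝ) : ℂ)⁻¹) * (∏ _v : V, ((Real.sqrt 2 : ℝ) : ℂ)⁻¹) =
      (1 / 2) ^ Fintype.card V := by
    rw [← Finset.prod_mul_distrib, inv_sqrt_two_mul_self, Finset.prod_const, Finset.card_univ]
  have h4 := hE θ x
  have h5 := congrArg star (hE θ x')
  rw [star_mul', star_mul', hstar, h2, star_prod] at h5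
  have h6 : phaseTail ord 0 θ x x' =
      (∏ v, phase (θ v) (x v)) * ∏ v, star (phase (θ v) (x' v)) := by
    simp only [phaseTail, Nat.not_lt_zero, if_false, Finset.prod_mul_distrib]
  rw [h6, ← h3]
  have h7 := congr($h4 * $h5)
  linear_combination ρ θ θ * h7

/-- The CNOT-and-measure simulator is perfect. -/
theorem isSimulatedBy_graphSimulator (ord : Fin (Fintype.card V) ≃ V) (G : SimpleGraph V) :
    IsSimulatedBy 0 (aliceConverter ord) extender (rspFor G) (graphSimulator ord) := by
  refine indistinguishable_of_prob_eq <|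
    prob_eq_of_simulationRelation _ _ (securityRelation ord) ?_ ?_ ?_
  · intro ρ y y'
    change ∑ z, (idealStart ord G).toLin ρ ((), mergeAt ord 0 z y) ((), mergeAt ord 0 z y') =
      ∑ θ, phaseTail ord 0 θ y y' * (Channel.classical fun θ : V → Angle => θ).toLin ρ θ θ
    have h : ∀ z y : V → Bool, mergeAt ord 0 z y = y := fun z y => by
      funext v; simp [mergeAt]
    simp only [h, idealStart_apply, Channel.classical_apply, and_self, Finset.sum_const,
      Finset.card_univ, Fintype.card_fun, Fintype.card_bool, Finset.smul_sum]
    refine Finset.sum_congr rfl fun θ _ => ?_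
    rw [Finset.sum_ite_eq' Finset.univ θ fun η => ρ η η, if_pos (Finset.mem_univ _), nsmul_eq_mul]
    push_cast
    rw [← mul_assoc, ← mul_assoc, ← mul_pow]
    norm_num
  · intro k ρ σ h o o' y y'
    exact securityRelation_step ord k ρ σ h o o' y y'
  · rintro ⟨ρ, σ⟩ h
    ext ⟨⟩ ⟨⟩
    have h' := h (fun _ => false) (fun _ => false)
    have hm : ∀ z y : V → Bool, mergeAt ord (Fintype.card V) z y = z := fun z y => by
      funext v; simp [mergeAt]
    have ht : ∀ θ y y', phaseTail ord (Fintype.card V) θ y y' = 1 := fun θ y y' => by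
      simp [phaseTail]
    simp only [hm, ht, one_mul] at h'
    refine (Channel.classical_apply (fun _ : V → Angle => ()) ρ () ()).trans ?_
    have e : ∑ θ : V → Angle, (if () = () ∧ () = () then ρ θ θ else 0) = ∑ θ, ρ θ θ :=
      Finset.sum_congr rfl fun θ _ => if_pos ⟨rfl, rfl⟩
    exact e.trans h'.symm

end Security

/-! ### Partially measured pure states -/

section Dephased

variable {Q : Type} [Fintype Q] [DecidableEq Q]

/-- The basis states `x` and `x'` assign the same bits to the qubits in `M`. -/
def AgreeOn (M : Set Q) (x x' : Q → Bool) : Prop := ∀ r ∈ M, x r = x' r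

instance (M : Set Q) (x x' : Q → Bool) : Decidable (AgreeOn M x x') := Classical.propDecidable _

/-- The (unnormalised) state obtained from the vector `ψ` by measuring the qubits in `M`, each of
which is left in the basis state given by its outcome. -/
def dephased (M : Set Q) (ψ : (Q → Bool) → ℂ) : Matrix (Q → Bool) (Q → Bool) ℂ :=
  Matrix.of fun x x' => if AgreeOn M x x' then ψ x * star (ψ x') else 0

variable {M : Set Q} {ψ : (Q → Bool) → ℂ}

lemma agreeOn_update {q : Q} (hq : q ∉ M) (x x' : Q → Bool) (b b' : Bool) :
    AgreeOn M (Function.update x q b) (Function.update x' q b') ↔ AgreeOn M x x' := by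
  refine forall₂_congr fun r hr => ?_
  have h : r ≠ q := fun h => hq (h ▸ hr)
  simp [h]

lemma agreeOn_insert (q : Q) (x x' : Q → Bool) :
    AgreeOn (insert q M) x x' ↔ x q = x' q ∧ AgreeOn M x x' := Set.forall_mem_insert ..

lemma cz_dephased (p q : Q) : (Instr.cz p q).channel.toLin (dephased M ψ) =
    dephased M fun x => sgn (x p && x q) * ψ x := by
  ext x x'
  simp only [cz_apply, dephased, Matrix.of_apply, star_mul', star_sgn]
  split_ifs <;> ring

lemma cnot_dephased (p q : Q) (h : p ≠ q) (hq : q ∉ M) :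
    (Instr.cnot p q h).channel.toLin (dephased M ψ) =
      dephased M fun x => ψ (Function.update x q (xor (x q) (x p))) := by
  ext x x'
  simp only [cnot_apply, dephased, Matrix.of_apply, agreeOn_update hq]

lemma meas_dephased (q : Q) :
    (Instr.meas q).channel.toLin (dephased M ψ) = dephased (insert q M) ψ := by
  ext x x'
  simp only [meas_apply, dephased, Matrix.of_apply, agreeOn_insert, ← ite_and]

lemma had_dephased (q : Q) (hq : q ∉ M) : (Instr.had q).channel.toLin (dephased M ψ) =
    dephased M fun x => ∑ b, ((Real.sqrt 2 : ℝ) : ℂ)⁻¹ * sgn (x q && b) *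
      ψ (Function.update x q b) := by
  have hr : star ((Real.sqrt 2 : ℝ) : ℂ)⁻¹ = ((Real.sqrt 2 : ℝ) : ℂ)⁻¹ := by simp
  ext x x'
  simp only [had_apply, dephased, Matrix.of_apply, agreeOn_update hq, star_sum, star_mul',
    star_sgn, hr]
  split_ifs
  · rw [Finset.sum_mul]
    refine Finset.sum_congr rfl fun b _ => ?_
    rw [Finset.mul_sum, Finset.mul_sum]
    exact Finset.sum_congr rfl fun b' _ => by ring
  · simp

/-- What happens to Bob's register when he sends the qubit `sp` to the extender, with Alice's
input `θ`, and stores the answer in `sp`, `ma` and `bi`. -/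
def extendChannel (θ : Angle) (sp ma bi : Q) (h1 : sp ≠ ma) (h2 : sp ≠ bi) (h3 : ma ≠ bi) :
    Channel (Q → Bool) (Q → Bool) :=
  (((((Channel.attach false).andThen (Channel.relabel (swapOne sp))).andThen
    ((Channel.ofKraus (extendKraus θ) (extendKraus_complete θ)).onRight (Q → Bool))).andThen
    (Channel.relabel (Equiv.prodCongr (Equiv.refl _) (Equiv.punitProd _)))).andThen
    (Channel.relabel (swapThree sp ma bi h1 h2 h3))).andThen Channel.discardRight

lemma extendChannel_apply (θ : Angle) (sp ma bi : Q) (h1 : sp ≠ ma) (h2 : sp ≠ bi) (h3 : ma ≠ bi)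
    (ρ : Matrix (Q → Bool) (Q → Bool) ℂ) (x x' : Q → Bool) :
    (extendChannel θ sp ma bi h1 h2 h3).toLin ρ x x' =
      if x ma = x sp ∧ x' ma = x' sp ∧ x bi = x' bi then
        1 / 2 * (phase θ (xor (x sp) (x bi)) * star (phase θ (xor (x' sp) (x bi)))) *
          ∑ e, ∑ f, ρ (Function.update (Function.update x ma e) bi f)
            (Function.update (Function.update x' ma e) bi f) else 0 := by
  have hS : ∀ m, (swapThree sp ma bi h1 h2 h3).symm m =
      (Function.update (Function.update (Function.update m.1 sp m.2.1) ma m.2.2.1) bi m.2.2.2,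
        (m.1 sp, m.1 ma, m.1 bi)) := fun _ => rfl
  have hO : ∀ m : (Q → Bool) × Bool,
      (swapOne sp).symm m = (Function.update m.1 sp m.2, m.1 sp) := fun _ => rfl
  have hp : ∀ m : (Q → Bool) × (Bool × Bool × Bool),
      (Equiv.prodCongr (Equiv.refl (Q → Bool)) (Equiv.punitProd (Bool × Bool × Bool))).symm m =
        (m.1, ((), m.2)) := fun _ => rfl
  have hu : ∀ (x : Q → Bool) (e f c d : Bool), Function.update (Function.update (Function.update
      (Function.update x sp c) ma e) bi f) sp d =
        Function.update (Function.update (Function.update x sp d) ma e) bi f := by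
    intro x e f c d
    rw [Function.update_comm h2.symm, Function.update_comm h1.symm, Function.update_idem]
  simp only [extendChannel, Channel.andThen_toLin, Channel.discardRight_apply,
    Channel.relabel_apply, hS, hO, hp, Channel.onRight_apply, extender_ofKraus_apply,
    Matrix.of_apply, Channel.attach_apply, hu, Function.update_eq_self]
  rw [Fintype.sum_prod_type, Fintype.sum_bool]
  simp only [Fintype.sum_prod_type, Function.update_of_ne h2, Function.update_of_ne h1,
    Function.update_self, Bool.true_eq_false, and_self, if_false, if_true, mul_zero, ite_self,
    Finset.sum_const_zero, zero_add]
  split_ifs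
  · simp only [Finset.mul_sum]
  · simp

/-- The extender followed by the correction `X^b` on both qubits: the angle no longer depends on
`b`, and the qubit sent to the extender has been flipped by `X^b`. -/
lemma extend_dephased (θ : Angle) (sp ma bi : Q) (h1 : sp ≠ ma) (h2 : sp ≠ bi) (h3 : ma ≠ bi)
    (hsp : sp ∉ M) (hma : ma ∉ M) (hbi : bi ∉ M)
    (hψma : ∀ x, x ma = true → ψ x = 0) (hψbi : ∀ x, x bi = true → ψ x = 0) :
    (run [.cnot bi sp h2.symm, .cnot bi ma h3.symm]).toLin
        ((extendChannel θ sp ma bi h1 h2 h3).toLin (dephased M ψ)) =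
      dephased (insert bi M) fun x => if x ma = x sp then ((Real.sqrt 2 : ℝ) : ℂ)⁻¹ *
        phase θ (x sp) * ψ (Function.update (Function.update
          (Function.update x sp (xor (x sp) (x bi))) ma false) bi false) else 0 := by
  have hr : star ((Real.sqrt 2 : ℝ) : ℂ)⁻¹ = ((Real.sqrt 2 : ℝ) : ℂ)⁻¹ := by simp
  have hext : (extendChannel θ sp ma bi h1 h2 h3).toLin (dephased M ψ) =
      dephased (insert bi M) fun x => if x ma = x sp then ((Real.sqrt 2 : ℝ) : ℂ)⁻¹ *
        phase θ (xor (x sp) (x bi)) *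
          ψ (Function.update (Function.update x ma false) bi false) else 0 := by
    ext x x'
    have hz : ∀ e f, (e = true ∨ f = true) →
        ψ (Function.update (Function.update x ma e) bi f) = 0 := by
      rintro e f (rfl | rfl)
      · exact hψma _ (by simp [h3])
      · exact hψbi _ (by simp)
    simp only [extendChannel_apply, dephased, Matrix.of_apply, agreeOn_update hma,
      agreeOn_update hbi, agreeOn_insert, Fintype.sum_bool]
    by_cases hb : x bi = x' bi
    · by_cases hM : AgreeOn M x x'
      · by_cases e1 : x ma = x sp
        · by_cases e2 : x' ma = x' sp
          · simp only [hb, e1, e2, and_self, if_true, hM, hz, true_or, or_true,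
              zero_mul, zero_add, star_mul', hr, ← inv_sqrt_two_mul_self]
            ring
          · simp [e2]
        · simp [e1]
      · simp [hM]
    · simp [hb]
  rw [hext, run_cons, run_cons, run_nil, cnot_dephased _ _ _ (by simp [hsp, h2]),
    cnot_dephased _ _ _ (by simp [hma, h3])]
  congr 1
  funext x
  simp only [Function.update_of_ne h1, Function.update_of_ne h2.symm,
    Function.update_of_ne h3.symm, Function.update_of_ne h1.symm, Function.update_self,
    Bool.xor_assoc, Bool.xor_self, Bool.xor_false, Bool.xor_left_inj]
  rw [Function.update_comm h1, Function.update_idem, Function.update_comm h1.symm]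

end Dephased

/-! ### States carried redundantly by ancillary qubits -/

/-- How an ancillary qubit is correlated with the main photons: it is in the state `|0⟩`, or in
`|+⟩` (or its corrections have made it independent of the rest), or it is a copy of the main photon
of `v`, or it carries the sign `(-1)^(a x_v)`, with `a` its own bit and `x_v` that of the main photon
of `v`: the state of a copy after a Hadamard gate. -/
inductive Status (V : Type) : Type
  | zero
  | plus
  | copy (v : V)
  | dual (v : V)

/-- The amplitude of the value `b` of an ancillary qubit of the given status, for the values `y` of
the main photons. -/
def Status.factor {V : Type} : Status V → Bool → (V → Bool) → ℂ
  | .zero, b, _ => if b then 0 else 1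
  | .plus, _, _ => 1
  | .copy v, b, y => if b = y v then 1 else 0
  | .dual v, b, y => sgn (b && y v)

section Wave

variable {V N : Type} [Fintype V] [DecidableEq V] [Fintype N] [DecidableEq N]

/-- The vector with amplitudes `F` for the main photons `V`, and the ancillary qubits `N` correlated
with them as given by `st`. -/
def wave (F : (V → Bool) → ℂ) (st : N → Status V) (x : V ⊕ N → Bool) : ℂ :=
  F (fun v => x (.inl v)) * ∏ n, (st n).factor (x (.inr n)) fun v => x (.inl v)

/-- `ρ` is, up to a constant, the state with vector `wave F st` after a measurement of the ancillary
qubits in `M`. -/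
def IsWave (ρ : Matrix (V ⊕ N → Bool) (V ⊕ N → Bool) ℂ) (F : (V → Bool) → ℂ) (st : N → Status V)
    (M : Set N) : Prop :=
  ∃ c : ℂ, ρ = dephased (Sum.inr '' M) fun x => c * wave F st x

/-- `wave F st` without the factor of the qubit `n`. -/
def waveRest (F : (V → Bool) → ℂ) (st : N → Status V) (n : N) (x : V ⊕ N → Bool) : ℂ :=
  F (fun v => x (.inl v)) *
    ∏ m ∈ Finset.univ.erase n, (st m).factor (x (.inr m)) fun v => x (.inl v)

variable {F : (V → Bool) → ℂ} {st : N → Status V} {M : Set N}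
  {ρ : Matrix (V ⊕ N → Bool) (V ⊕ N → Bool) ℂ}

lemma wave_eq_factor_mul (n : N) (x : V ⊕ N → Bool) :
    wave F st x = (st n).factor (x (.inr n)) (fun v => x (.inl v)) * waveRest F st n x := by
  rw [wave, waveRest, ← Finset.mul_prod_erase _ _ (Finset.mem_univ n)]
  ring

lemma waveRest_update_status (n : N) (s : Status V) (x : V ⊕ N → Bool) :
    waveRest F (Function.update st n s) n x = waveRest F st n x := by
  rw [waveRest, waveRest]
  congr 1
  refine Finset.prod_congr rfl fun m hm => ?_
  rw [Function.update_of_ne (Finset.ne_of_mem_erase hm)]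

lemma wave_update_status (n : N) (s : Status V) (x : V ⊕ N → Bool) :
    wave F (Function.update st n s) x =
      s.factor (x (.inr n)) (fun v => x (.inl v)) * waveRest F st n x := by
  rw [wave_eq_factor_mul n, waveRest_update_status, Function.update_self]

lemma waveRest_update (n : N) (x : V ⊕ N → Bool) (b : Bool) :
    waveRest F st n (Function.update x (.inr n) b) = waveRest F st n x := by
  simp only [waveRest, Function.update_of_ne (Sum.inl_ne_inr (a := _) (b := n))]
  congr 1
  refine Finset.prod_congr rfl fun m hm => ?_
  rw [Function.update_of_ne fun h => Finset.ne_of_mem_erase hm (Sum.inr_injective h)]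

lemma wave_update (n : N) (x : V ⊕ N → Bool) (b : Bool) :
    wave F st (Function.update x (.inr n) b) =
      (st n).factor b (fun v => x (.inl v)) * waveRest F st n x := by
  rw [wave_eq_factor_mul n, waveRest_update]
  simp only [Function.update_self, Function.update_of_ne (Sum.inl_ne_inr (a := _) (b := n))]

lemma inr_notMem_image {n : N} (hn : n ∉ M) : (Sum.inr n : V ⊕ N) ∉ Sum.inr '' M := by
  simpa using hn

lemma isWave_of_eq {ψ : (V ⊕ N → Bool) → ℂ} (d : ℂ) (h : ∀ x, ψ x = d * wave F st x) :
    IsWave (dephased (Sum.inr '' M) ψ) F st M :=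
  ⟨d, by rw [← funext h]⟩

/-- The qubit `r` is the main photon of `v` or a copy of it. -/
def Carries (st : N → Status V) (r : V ⊕ N) (v : V) : Prop :=
  r = .inl v ∨ ∃ n, r = .inr n ∧ st n = .copy v

lemma Carries.eq_of_wave_ne_zero {r : V ⊕ N} {v : V} (h : Carries st r v) {x : V ⊕ N → Bool}
    (hx : wave F st x ≠ 0) : x r = x (.inl v) := by
  rcases h with rfl | ⟨n, rfl, hn⟩
  · rfl
  · by_contra hne
    apply hx
    rw [wave_eq_factor_mul n, hn]
    simp [Status.factor, hne]

namespace IsWave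

/-- A Hadamard gate on an ancillary qubit transforms the factor of this qubit. -/
lemma had_aux (h : IsWave ρ F st M) (n : N) (hn : n ∉ M) (s : Status V)
    (hs : ∀ b y, ∑ b', sgn (b && b') * (st n).factor b' y = s.factor b y) :
    IsWave ((Instr.had (.inr n)).channel.toLin ρ) F (Function.update st n s) M := by
  obtain ⟨c, rfl⟩ := h
  rw [had_dephased _ (inr_notMem_image hn)]
  refine isWave_of_eq (((Real.sqrt 2 : ℝ) : ℂ)⁻¹ * c) fun x => ?_
  rw [wave_update_status, ← hs, Finset.sum_mul, Finset.mul_sum]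
  refine Finset.sum_congr rfl fun b _ => ?_
  rw [wave_update]
  ring

lemma had_zero (h : IsWave ρ F st M) {n : N} (hn : n ∉ M) (hs : st n = .zero) :
    IsWave ((Instr.had (.inr n)).channel.toLin ρ) F (Function.update st n .plus) M :=
  h.had_aux n hn _ fun b y => by simp [hs, Status.factor]

lemma had_copy (h : IsWave ρ F st M) {n : N} (hn : n ∉ M) {v : V} (hs : st n = .copy v) :
    IsWave ((Instr.had (.inr n)).channel.toLin ρ) F (Function.update st n (.dual v)) M :=
  h.had_aux n hn _ fun b y => by
    rw [hs]
    cases b <;> cases hy : y v <;> simp [Status.factor, hy]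

/-- A `Z` correction controlled by a qubit of status `dual v` decouples this qubit. -/
lemma cz_dual (h : IsWave ρ F st M) {n : N} {v : V} (hs : st n = .dual v) {r : V ⊕ N}
    (hr : Carries st r v) :
    IsWave ((Instr.cz (.inr n) r).channel.toLin ρ) F (Function.update st n .plus) M := by
  obtain ⟨c, rfl⟩ := h
  rw [cz_dephased]
  refine isWave_of_eq c fun x => ?_
  by_cases hx : wave F st x = 0
  · rw [hx]
    rw [wave_eq_factor_mul n, hs] at hx
    have hne : (Status.dual v).factor (x (.inr n)) (fun v => x (.inl v)) ≠ 0 := by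
      simp only [Status.factor, sgn]
      split_ifs <;> norm_num
    rw [wave_update_status, (mul_eq_zero.1 hx).resolve_left hne]
    simp
  · rw [hr.eq_of_wave_ne_zero hx, wave_update_status, wave_eq_factor_mul n, hs, Status.factor,
      Status.factor]
    linear_combination c * waveRest F st n x * sgn_mul_self (x (.inr n) && x (.inl v))

/-- A `CZ` gate on qubits that carry the bits of `v` and `w` acts like one on the main photons. -/
lemma cz_carries (h : IsWave ρ F st M) {p r : V ⊕ N} {v w : V} (hp : Carries st p v)
    (hr : Carries st r w) :
    IsWave ((Instr.cz p r).channel.toLin ρ) (fun y => F y * sgn (y v && y w)) st M := by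
  obtain ⟨c, rfl⟩ := h
  rw [cz_dephased]
  refine isWave_of_eq c fun x => ?_
  have hw : wave (fun y => F y * sgn (y v && y w)) st x =
      sgn (x (.inl v) && x (.inl w)) * wave F st x := by
    rw [wave, wave]; ring
  rw [hw]
  by_cases hx : wave F st x = 0
  · simp [hx]
  · rw [hp.eq_of_wave_ne_zero hx, hr.eq_of_wave_ne_zero hx]
    ring

lemma meas (h : IsWave ρ F st M) (n : N) :
    IsWave ((Instr.meas (.inr n)).channel.toLin ρ) F st (insert n M) := by
  obtain ⟨c, rfl⟩ := h
  rw [meas_dephased, ← Set.image_insert_eq]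
  exact ⟨c, rfl⟩

/-- A `CNOT` from a copy onto a qubit in the state `|0⟩` makes another copy. -/
lemma cnot_copy (h : IsWave ρ F st M) {n m : N} {v : V} (hn : st n = .copy v) (hm : st m = .zero)
    (hmM : m ∉ M) (hne : (Sum.inr n : V ⊕ N) ≠ .inr m) :
    IsWave ((Instr.cnot (.inr n) (.inr m) hne).channel.toLin ρ) F
      (Function.update st m (.copy v)) M := by
  obtain ⟨c, rfl⟩ := h
  rw [cnot_dephased _ _ _ (inr_notMem_image hmM)]
  refine isWave_of_eq c fun x => ?_
  rw [wave_update, wave_update_status, hm]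
  by_cases hx : waveRest F st m x = 0
  · simp [hx]
  · have hnm : n ≠ m := fun e => hne (by rw [e])
    have hv : x (.inr n) = x (.inl v) := by
      by_contra hv
      apply hx
      rw [waveRest, Finset.prod_eq_zero (Finset.mem_erase.2 ⟨hnm, Finset.mem_univ _⟩), mul_zero]
      rw [hn]
      simp [Status.factor, hv]
    have hz : ∀ (a : Bool) (y : V → Bool),
        Status.zero.factor (xor a (y v)) y = (Status.copy v).factor a y := by
      intro a y
      cases a <;> cases hy : y v <;> simp [Status.factor, hy]
    rw [hv, ← hz]

end IsWave

lemma Status.factor_update {s : Status V} {v : V} (h1 : s ≠ .copy v) (h2 : s ≠ .dual v) (b c : Bool)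
    (y : V → Bool) : s.factor b (Function.update y v c) = s.factor b y := by
  cases s with
  | zero => rfl
  | plus => rfl
  | copy u =>
    have : u ≠ v := fun e => h1 (by rw [e])
    simp [factor, this]
  | dual u =>
    have : u ≠ v := fun e => h2 (by rw [e])
    simp [factor, this]

/-- A call to the extender followed by the corrections `X^b`. The status of the spin is either
`plus` or `dual u`. The correction `X^b` turns the sign `(-1)^(a x_u)` of the spin into
`(-1)^(a x_u) (-1)^(b x_u)`: the first factor is the new edge, and the second one gives the register
of the bit `b` the former status of the spin. -/
lemma IsWave.extend (h : IsWave ρ F st M) (θ : Angle) {v : V} {sp bi : N}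
    (h1 : (.inr sp : V ⊕ N) ≠ .inl v) (h2 : (.inr sp : V ⊕ N) ≠ .inr bi)
    (h3 : (.inl v : V ⊕ N) ≠ .inr bi)
    (hsp : st sp = .plus ∨ ∃ u, st sp = .dual u) (hbi : st bi = .zero)
    (hspM : sp ∉ M) (hbiM : bi ∉ M) (hfresh : ∀ n, st n ≠ .copy v ∧ st n ≠ .dual v)
    (hF : ∀ y, y v = true → F y = 0) :
    IsWave ((run [.cnot (.inr bi) (.inr sp) h2.symm, .cnot (.inr bi) (.inl v) h3.symm]).toLin
        ((extendChannel θ (.inr sp) (.inl v) (.inr bi) h1 h2 h3).toLin ρ))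
      (fun y => phase θ (y v) * (st sp).factor (y v) y * F (Function.update y v false))
      (Function.update (Function.update st bi (st sp)) sp (.copy v)) (insert bi M) := by
  have hne : sp ≠ bi := fun e => h2 (by rw [e])
  obtain ⟨c, rfl⟩ := h
  rw [extend_dephased θ _ _ _ h1 h2 h3 (inr_notMem_image hspM) (by simp) (inr_notMem_image hbiM),
    ← Set.image_insert_eq]
  · refine isWave_of_eq (((Real.sqrt 2 : ℝ) : ℂ)⁻¹ * c) fun x => ?_
    rw [wave_update_status]
    by_cases hx : x (.inl v) = x (.inr sp)
    · rw [if_pos hx, wave_update, hbi]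
      have hmul : ∀ (b b' : Bool) (y : V → Bool),
          (st sp).factor (xor b b') y = (st sp).factor b y * (st sp).factor b' y := by
        intro b b' y
        rcases hsp with e | ⟨u, e⟩ <;> rw [e]
        · simp [Status.factor]
        · simp only [Status.factor, ← sgn_xor]
          cases b <;> cases b' <;> cases y u <;> simp
      have hy : (fun w => Function.update (Function.update x (Sum.inr sp)
          (xor (x (.inr sp)) (x (.inr bi)))) (.inl v) false (.inl w)) =
          Function.update (fun w => x (.inl w)) v false := by
        funext w
        by_cases hw : w = v
        · subst hw; simp
        · simp [hw]
      have hrest : ∀ n, n ≠ sp → Function.update (Function.update x (Sum.inr sp)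
          (xor (x (.inr sp)) (x (.inr bi)))) (.inl v) false (.inr n) = x (.inr n) := by
        intro n hn
        simp [hn]
      have hfac : ∀ (n : N) (b : Bool),
          (st n).factor b (Function.update (fun w => x (.inl w)) v false) =
            (st n).factor b fun w => x (.inl w) :=
        fun n b => Status.factor_update (hfresh n).1 (hfresh n).2 _ _ _
      have hspmem : sp ∈ Finset.univ.erase bi := Finset.mem_erase.2 ⟨hne, Finset.mem_univ _⟩
      have hbimem : bi ∈ Finset.univ.erase sp := Finset.mem_erase.2 ⟨hne.symm, Finset.mem_univ _⟩
      have L : waveRest F st bi (Function.update (Function.update x (Sum.inr sp)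
          (xor (x (.inr sp)) (x (.inr bi)))) (.inl v) false) =
          F (Function.update (fun w => x (.inl w)) v false) *
            ((st sp).factor (xor (x (.inr sp)) (x (.inr bi))) (fun w => x (.inl w)) *
            ∏ n ∈ (Finset.univ.erase bi).erase sp,
              (st n).factor (x (.inr n)) fun w => x (.inl w)) := by
        rw [waveRest, hy, ← Finset.mul_prod_erase _ _ hspmem]
        simp only [hfac]
        congr 2
        · simp
        · refine Finset.prod_congr rfl fun n hn => ?_
          rw [hrest n (Finset.ne_of_mem_erase hn)]
      have R : waveRest (fun y => phase θ (y v) * (st sp).factor (y v) y *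
          F (Function.update y v false)) (Function.update st bi (st sp)) sp x =
          phase θ (x (.inl v)) * (st sp).factor (x (.inl v)) (fun w => x (.inl w)) *
            F (Function.update (fun w => x (.inl w)) v false) *
            ((st sp).factor (x (.inr bi)) (fun w => x (.inl w)) *
            ∏ n ∈ (Finset.univ.erase sp).erase bi,
              (st n).factor (x (.inr n)) fun w => x (.inl w)) := by
        rw [waveRest, ← Finset.mul_prod_erase _ _ hbimem, Function.update_self]
        congr 2
        refine Finset.prod_congr rfl fun n hn => ?_
        rw [Function.update_of_ne (Finset.ne_of_mem_erase hn)]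
      rw [L, R, hmul, Finset.erase_right_comm, ← hx]
      simp only [Status.factor, if_true, Bool.false_eq_true, if_false]
      ring
    · rw [if_neg hx]
      simp [Status.factor, Ne.symm hx]
  · intro x hx
    rw [wave, hF _ hx, zero_mul, mul_zero]
  · intro x hx
    rw [wave_eq_factor_mul bi, hbi, hx]
    simp [Status.factor]

end Wave

/-! ### Lists of vertices of an emitter -/

section Order

variable {V : Type} [Fintype V] [DecidableEq V] {Qe : Type} {ord : Fin (Fintype.card V) ≃ V}
  {em : V → Qe}

lemma nodup_vertices : (BobChoices.vertices ord).Nodup :=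
  List.nodup_ofFn.2 ord.injective

lemma mem_vertices (v : V) : v ∈ BobChoices.vertices ord :=
  List.mem_ofFn.2 ⟨ord.symm v, ord.apply_symm_apply v⟩

lemma filter_vertices_eq_singleton {p : V → Bool} {u : V} (h : ∀ a, p a = true ↔ a = u) :
    (BobChoices.vertices ord).filter p = [u] := by
  refine List.perm_singleton.1 <| (List.perm_ext_iff_of_nodup (nodup_vertices.filter _)
    (List.nodup_singleton u)).2 fun a => ?_
  simp [mem_vertices, h]

lemma Precedes.unique {u u' v : V} (h : Precedes ord em u v) (h' : Precedes ord em u' v) :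
    u = u' := by
  rcases lt_trichotomy (ord.symm u) (ord.symm u') with hlt | heq | hgt
  · exact absurd ⟨hlt, h'.2.1⟩ (h.2.2 u' h'.1)
  · exact ord.symm.injective heq
  · exact absurd ⟨hgt, h.2.1⟩ (h'.2.2 u h.1)

lemma exists_precedes_right {u v : V} (he : em u = em v) (hlt : ord.symm u < ord.symm v) :
    ∃ w, Precedes ord em u w ∧ ord.symm w ≤ ord.symm v := by
  classical
  obtain ⟨w, hw, hmin⟩ := (Finset.univ.filter fun w => em w = em v ∧
    ord.symm u < ord.symm w).exists_min_image ord.symm ⟨v, by simp [hlt]⟩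
  simp only [Finset.mem_filter, Finset.mem_univ, true_and] at hw hmin
  exact ⟨w, ⟨he.trans hw.1.symm, hw.2, fun w' hw' h =>
    not_lt.2 (hmin w' ⟨hw'.trans hw.1, h.1⟩) h.2⟩, hmin v ⟨rfl, hlt⟩⟩

lemma BobChoices.release_lt_of_later {G : SimpleGraph V} [Fintype Qe] [DecidableEq Qe]
    (B : BobChoices G ord em) {u v : V} (he : em u = em v) (hlt : ord.symm u < ord.symm v) :
    B.release u < ord.symm v := by
  obtain ⟨w, hw, hle⟩ := exists_precedes_right he hlt
  exact (B.release_lt u w hw).trans_le hle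

end Order

/-! ### Amplitudes of partially built graph states -/

section Amplitude

variable {V : Type} [Fintype V] [DecidableEq V]

open Classical in
/-- The factor `z` of a product, present under the condition `P`. -/
def factorIf (P : Prop) (z : ℂ) : ℂ := if P then z else 1

lemma factorIf_pos {P : Prop} (h : P) (z : ℂ) : factorIf P z = z := if_pos h

lemma factorIf_neg {P : Prop} (h : ¬ P) (z : ℂ) : factorIf P z = 1 := if_neg h

open Classical in
/-- The (unnormalised) amplitudes of the blind graph state on the vertices in `E`, the others being
in the state `|0⟩`, with the edges in `T`. Each edge is listed in one direction only. -/
def amplitude (θ : V → Angle) (E : V → Prop) (T : V → V → Prop) (y : V → Bool) : ℂ :=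
  if ∀ v, y v = true → E v then
    (∏ v, factorIf (E v) (phase (θ v) (y v))) *
      ∏ p : V × V, factorIf (T p.1 p.2) (sgn (y p.1 && y p.2))
  else 0

variable {θ : V → Angle} {E : V → Prop} {T : V → V → Prop}

lemma amplitude_add_edge {v w : V} (h : ¬ T v w) :
    amplitude θ E (fun a b => T a b ∨ (a = v ∧ b = w)) =
      fun y => amplitude θ E T y * sgn (y v && y w) := by
  classical
  funext y
  have hp : (∏ p : V × V, factorIf (T p.1 p.2 ∨ (p.1 = v ∧ p.2 = w)) (sgn (y p.1 && y p.2))) =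
      (∏ p : V × V, factorIf (T p.1 p.2) (sgn (y p.1 && y p.2))) * sgn (y v && y w) := by
    have h1 : sgn (y v && y w) = ∏ p : V × V, if p = (v, w) then sgn (y p.1 && y p.2) else 1 := by
      rw [Finset.prod_ite_eq' Finset.univ (v, w) fun p => sgn (y p.1 && y p.2)]
      simp
    rw [h1, ← Finset.prod_mul_distrib]
    refine Finset.prod_congr rfl fun p _ => ?_
    obtain ⟨a, b⟩ := p
    by_cases hab : a = v ∧ b = w
    · obtain ⟨rfl, rfl⟩ := hab
      simp [h, factorIf]
    · simp [hab, factorIf]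
  simp only [amplitude, hp]
  split_ifs
  · ring
  · ring

lemma amplitude_add_vertex {v : V} (hv : ¬ E v) (hT : ∀ a b, T a b → a ≠ v ∧ b ≠ v) :
    amplitude θ (fun w => E w ∨ w = v) T =
      fun y => phase (θ v) (y v) * amplitude θ E T (Function.update y v false) := by
  funext y
  have hs : (∀ w, Function.update y v false w = true → E w) ↔
      ∀ w, y w = true → E w ∨ w = v := by
    refine forall_congr' fun w => ?_
    by_cases hw : w = v
    · subst hw; simp
    · simp [hw]
  have hph : (∏ w, factorIf (E w ∨ w = v) (phase (θ w) (y w))) =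
      phase (θ v) (y v) *
        ∏ w, factorIf (E w) (phase (θ w) (Function.update y v false w)) := by
    rw [← Finset.mul_prod_erase _ _ (Finset.mem_univ v),
      ← Finset.mul_prod_erase _ (fun w => factorIf (E w) _) (Finset.mem_univ v),
      factorIf_pos (Or.inr rfl), factorIf_neg hv, one_mul]
    congr 1
    refine Finset.prod_congr rfl fun w hw => ?_
    have hne := Finset.ne_of_mem_erase hw
    simp [hne]
  have hed : (∏ p : V × V, factorIf (T p.1 p.2) (sgn (y p.1 && y p.2))) =
      ∏ p : V × V, factorIf (T p.1 p.2)
        (sgn (Function.update y v false p.1 && Function.update y v false p.2)) := by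
    refine Finset.prod_congr rfl fun p _ => ?_
    by_cases h : T p.1 p.2
    · rw [Function.update_of_ne (hT _ _ h).1, Function.update_of_ne (hT _ _ h).2]
    · rw [factorIf_neg h, factorIf_neg h]
  rw [amplitude, amplitude, hph, hed]
  by_cases h : ∀ w, y w = true → E w ∨ w = v
  · rw [if_pos h, if_pos (hs.2 h)]
    ring
  · rw [if_neg h, if_neg fun h' => h (hs.1 h'), mul_zero]

lemma amplitude_eq_zero {v : V} (hv : ¬ E v) {y : V → Bool} (hy : y v = true) :
    amplitude θ E T y = 0 := by
  rw [amplitude, if_neg fun h => hv (h v hy)]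

/-- Once all vertices and edges are present, the amplitudes are those of the blind graph state. -/
lemma blindGraphState_eq_amplitude (G : SimpleGraph V) (ord : Fin (Fintype.card V) ≃ V)
    (y : V → Bool) :
    blindGraphState G θ y = ((Real.sqrt 2 : ℝ) : ℂ)⁻¹ ^ Fintype.card V *
      amplitude θ (fun _ => True) (fun v w => G.Adj v w ∧ ord.symm w < ord.symm v) y := by
  classical
  have hT : (∏ p : V × V, factorIf (G.Adj p.1 p.2 ∧ ord.symm p.2 < ord.symm p.1)
      (sgn (y p.1 && y p.2))) = ∏ p ∈ (Finset.univ : Finset (V × V)).filter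
        (fun p => ord.symm p.1 < ord.symm p.2 ∧ G.Adj p.1 p.2), sgn (y p.1 && y p.2) := by
    rw [Finset.prod_filter, ← (Equiv.prodComm V V).prod_comp]
    refine Finset.prod_congr rfl fun p _ => ?_
    simp only [factorIf, Equiv.prodComm_apply, Prod.fst_swap, Prod.snd_swap, G.adj_comm p.2 p.1,
      and_comm, Bool.and_comm]
  rw [blindGraphState, prod_edgeFinset_eq G ord, amplitude, if_pos fun _ _ => trivial, hT,
    Finset.prod_const, Finset.card_univ]
  have hph : ∏ v, factorIf True (phase (θ v) (y v)) = ∏ v, rz (angleValue (θ v)) (y v) (y v) :=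
    Finset.prod_congr rfl fun v _ => factorIf_pos trivial _
  rw [hph]
  ring

end Amplitude

/-! ### Blocks of instructions -/

namespace IsWave

variable {V N : Type} [Fintype V] [DecidableEq V] [Fintype N] [DecidableEq N]
  {F : (V → Bool) → ℂ} {st : N → Status V} {M : Set N}
  {ρ : Matrix (V ⊕ N → Bool) (V ⊕ N → Bool) ℂ}

/-- Measuring a copy of a main photon in the basis `|±⟩`, with the correction, decouples it. -/
lemma measX (h : IsWave ρ F st M) {n : N} {v : V} (hs : st n = .copy v) (hn : n ∉ M) :
    IsWave ((run [.had (.inr n), .meas (.inr n), .cz (.inr n) (.inl v)]).toLin ρ) F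
      (Function.update st n .plus) (insert n M) := by
  have h1 := ((h.had_copy hn hs).meas n).cz_dual (Function.update_self ..) (r := .inl v)
    (Or.inl rfl)
  rwa [Function.update_idem] at h1

/-- Fusion of copies of the main photons of `v` and `w` creates an edge between `v` and `w`. -/
lemma fusion (h : IsWave ρ F st M) {n m : N} {v w : V} (hne : n ≠ m) (hn : st n = .copy v)
    (hm : st m = .copy w) (hnM : n ∉ M) (hmM : m ∉ M) :
    IsWave ((run [.cz (.inr n) (.inr m), .had (.inr n), .had (.inr m), .meas (.inr n),
        .meas (.inr m), .cz (.inr n) (.inl v), .cz (.inr m) (.inl w)]).toLin ρ)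
      (fun y => F y * sgn (y v && y w))
      (Function.update (Function.update st n .plus) m .plus) (insert m (insert n M)) := by
  have h1 := (h.cz_carries (Or.inr ⟨n, rfl, hn⟩) (Or.inr ⟨m, rfl, hm⟩)).had_copy hnM hn
  have h2 := h1.had_copy hmM (v := w) (by rw [Function.update_of_ne hne.symm, hm])
  have h3 := ((h2.meas n).meas m).cz_dual (n := n) (v := v) (r := .inl v)
    (by rw [Function.update_of_ne hne, Function.update_self]) (Or.inl rfl)
  have h4 := h3.cz_dual (n := m) (v := w) (r := .inl w)
    (by rw [Function.update_of_ne hne.symm, Function.update_self]) (Or.inl rfl)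
  rwa [Function.update_comm hne.symm, Function.update_idem, Function.update_idem] at h4

/-- Execution of a list of blocks, each of which changes the status of one qubit, and measures at
most this one, and only if it is in `μ`. -/
lemma run_flatMap {ι : Type} {f : ι → N} (hf : Function.Injective f) (c : ι → List (Instr (V ⊕ N)))
    (s : ι → Status V) (μ : Set N) (l : List ι) (hl : l.Nodup) (st₀ : N → Status V)
    (hstep : ∀ i ∈ l, ∀ ρ st M, IsWave ρ F st M → st (f i) = st₀ (f i) → f i ∉ M →
      (∀ n, n ∉ Set.range f → st n = st₀ n) →
      ∃ M', IsWave ((run (c i)).toLin ρ) F (Function.update st (f i) (s i)) M' ∧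
        ∀ n ∈ M', n ∈ M ∨ n = f i ∧ n ∈ μ)
    (h : IsWave ρ F st M) (h₀ : ∀ i ∈ l, st (f i) = st₀ (f i)) (hM : ∀ i ∈ l, f i ∉ M)
    (hr : ∀ n, n ∉ Set.range f → st n = st₀ n) :
    ∃ st' M', IsWave ((run (l.flatMap c)).toLin ρ) F st' M' ∧ (∀ i ∈ l, st' (f i) = s i) ∧
      (∀ n, (∀ i ∈ l, n ≠ f i) → st' n = st n) ∧ ∀ n ∈ M', n ∈ M ∨ n ∈ μ ∧ ∃ i ∈ l, n = f i := by
  induction l generalizing ρ st M with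
  | nil => exact ⟨st, M, h, by simp, fun _ _ => rfl, fun n hn => Or.inl hn⟩
  | cons i l ih =>
    rw [List.nodup_cons] at hl
    obtain ⟨M₁, h₁, hM₁⟩ := hstep i List.mem_cons_self ρ st M h (h₀ i List.mem_cons_self)
      (hM i List.mem_cons_self) hr
    have hne : ∀ j ∈ l, f j ≠ f i := fun j hj e => hl.1 (hf e ▸ hj)
    obtain ⟨st', M', h', hs', hk', hM'⟩ := ih hl.2
      (fun j hj => hstep j (List.mem_cons_of_mem _ hj)) h₁
      (fun j hj => by rw [Function.update_of_ne (hne j hj), h₀ j (List.mem_cons_of_mem _ hj)])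
      (fun j hj hm => (hM₁ _ hm).elim (hM j (List.mem_cons_of_mem _ hj)) fun e => hne j hj e.1)
      (fun n hn => by rw [Function.update_of_ne fun e => hn ⟨i, e.symm⟩, hr n hn])
    refine ⟨st', M', by rwa [List.flatMap_cons, run_append], ?_, ?_, ?_⟩
    · intro j hj
      rcases List.mem_cons.1 hj with rfl | hj
      · rw [hk' _ fun k hk => (hne k hk).symm, Function.update_self]
      · exact hs' j hj
    · intro n hn
      rw [hk' n fun j hj => hn j (List.mem_cons_of_mem _ hj),
        Function.update_of_ne (hn i List.mem_cons_self)]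
    · intro n hn
      rcases hM' n hn with hm | ⟨hμ, j, hj, e⟩
      · rcases hM₁ n hm with hm | ⟨e, hμ⟩
        · exact Or.inl hm
        · exact Or.inr ⟨hμ, i, List.mem_cons_self, e⟩
      · exact Or.inr ⟨hμ, j, List.mem_cons_of_mem _ hj, e⟩

end IsWave

/-! ### Alice's classical register -/

section ClassicalControl

variable {A N K I J O : Type} [Fintype A] [Fintype N] [Fintype K] [Fintype I] [Fintype J]
  [Fintype O] [DecidableEq A] [DecidableEq K]

/-- The joint state of a classical register, which holds `a` with weight `w a`, and of a second
register, which is then in the state `σ a`. -/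
def classicalQuantum (w : A → ℂ) (σ : A → Matrix N N ℂ) : Matrix (A × N) (A × N) ℂ :=
  Matrix.of fun p q => if p.1 = q.1 then w p.1 * σ p.1 p.2 q.2 else 0

lemma classicalQuantum_apply (w : A → ℂ) (σ : A → Matrix N N ℂ) (p q : A × N) :
    classicalQuantum w σ p q = if p.1 = q.1 then w p.1 * σ p.1 p.2 q.2 else 0 := rfl

lemma Channel.toLin_of_ite (Φ : Channel I J) (P : Prop) [Decidable P] (c : ℂ)
    (ρ : Matrix I I ℂ) (j j' : J) :
    Φ.toLin (Matrix.of fun i i' => if P then c * ρ i i' else 0) j j' =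
      if P then c * Φ.toLin ρ j j' else 0 := by
  split_ifs
  · have h : (Matrix.of fun i i' => c * ρ i i') = c • ρ := rfl
    rw [h, map_smul, Matrix.smul_apply, smul_eq_mul]
  · have h : (Matrix.of fun _ _ => 0 : Matrix I I ℂ) = 0 := rfl
    rw [h, map_zero, Matrix.zero_apply]

/-- Alice copies a function of her classical register while Bob applies `Φ`. -/
lemma copy_tensor_apply (f : A → K) (Φ : Channel N (N × I)) (w : A → ℂ) (σ : A → Matrix N N ℂ)
    (p q : (A × K) × (N × I)) :
    ((Channel.classical fun a => (a, f a)).tensor Φ).toLin (classicalQuantum w σ) p q =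
      if p.1.1 = q.1.1 ∧ p.1.2 = f p.1.1 ∧ q.1.2 = f p.1.1 then
        w p.1.1 * Φ.toLin (σ p.1.1) p.2 q.2 else 0 := by
  obtain ⟨⟨a, k⟩, m⟩ := p
  obtain ⟨⟨a', k'⟩, m'⟩ := q
  rw [Channel.tensor_toLin, Channel.onRight_apply, ← Channel.toLin_of_ite]
  refine congrArg (fun M => Φ.toLin M m m') ?_
  ext n n'
  simp only [Matrix.of_apply, Channel.onLeft_apply, Channel.classical_apply, classicalQuantum,
    Prod.mk.injEq, if_true]
  rw [Finset.sum_eq_single a]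
  · simp only [true_and]
    refine if_congr ?_ rfl rfl
    constructor
    · rintro ⟨h1, h2, h3⟩
      exact ⟨h2, h1.symm, h3.symm⟩
    · rintro ⟨h1, h2, h3⟩
      exact ⟨h2.symm, h1, h3.symm⟩
  · rintro b - hb
    rw [if_neg fun h => hb h.1.1]
  · simp

/-- A call to a resource that is controlled by the classical input of Alice: her register selects
the operation on Bob's register. -/
lemma classicalQuantum_call (f : A → K) (ΦS : Channel N (N × I)) (Ψ : K → Channel I (Unit × O))
    (ΦR : Channel (N × O) N) (w : A → ℂ) (σ : A → Matrix N N ℂ) :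
    ((((((Channel.classical fun a => (a, f a)).tensor ΦS).andThen
      (Channel.relabel (regroup _ _ _ _))).andThen
      ((Channel.controlled Ψ).onRight (A × N))).andThen
      (Channel.relabel (regroup _ _ _ _).symm)).andThen
      ((Channel.discardRight : Channel (A × Unit) A).tensor ΦR)).toLin (classicalQuantum w σ) =
    classicalQuantum w fun a => (((ΦS.andThen ((Ψ (f a)).onRight N)).andThen
      (Channel.relabel (Equiv.prodCongr (Equiv.refl _) (Equiv.punitProd _)))).andThen ΦR).toLin
        (σ a) := by
  ext ⟨a, m⟩ ⟨a', m'⟩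
  rw [Channel.andThen_toLin, Channel.tensor_toLin, Channel.onRight_apply,
    classicalQuantum_apply _ _ (a, m)]
  rw [Channel.andThen_toLin ((ΦS.andThen _).andThen _), ← Channel.toLin_of_ite]
  refine congrArg (fun M => ΦR.toLin M m m') ?_
  ext ⟨n, o⟩ ⟨n', o'⟩
  have hr : ∀ p : (A × Unit) × (N × O), (regroup A N Unit O).symm.symm p =
      ((p.1.1, p.2.1), (p.1.2, p.2.2)) := fun _ => rfl
  have hr' : ∀ p : (A × N) × (K × I), (regroup A N K I).symm p =
      ((p.1.1, p.2.1), (p.1.2, p.2.2)) := fun _ => rfl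
  have hp : ∀ p : N × O, (Equiv.prodCongr (Equiv.refl N) (Equiv.punitProd O)).symm p =
      (p.1, ((), p.2)) := fun _ => rfl
  simp only [Matrix.of_apply, Channel.onLeft_apply, Channel.discardRight_apply,
    Channel.andThen_toLin, Channel.relabel_apply, hr, hp, Channel.onRight_apply,
    Channel.controlled_apply, Matrix.sum_apply, hr', copy_tensor_apply, Finset.univ_unique,
    Finset.sum_singleton]
  rw [Finset.sum_eq_single (f a)]
  · simp only [and_true]
    exact Channel.toLin_of_ite (Ψ (f a)) (a = a') (w a)
      (Matrix.of fun i i' => ΦS.toLin (σ a) (n, i) (n', i')) _ _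
  · intro k _ hk
    simp only [hk, and_false, if_false]
    exact congrFun (congrFun (map_zero (Ψ k).toLin) _) _
  · simp

lemma id_tensor_toLin (Φ : Channel Unit N) (ρ : Matrix (A × Unit) (A × Unit) ℂ) :
    ((Channel.classical fun a : A => a).tensor Φ).toLin ρ =
      classicalQuantum (fun a => ρ (a, ()) (a, ())) fun _ => Φ.toLin 1 := by
  ext ⟨a, m⟩ ⟨a', m'⟩
  rw [Channel.tensor_toLin, Channel.onRight_apply, classicalQuantum_apply, ← Channel.toLin_of_ite]
  refine congrArg (fun M => Φ.toLin M m m') ?_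
  ext u u'
  simp only [Matrix.of_apply, Channel.onLeft_apply, Channel.classical_apply, Matrix.one_apply,
    if_true, mul_one]
  rw [Finset.sum_eq_single a]
  · simp only [true_and]
  · rintro b - hb
    rw [if_neg fun h => hb h.1]
  · simp

/-- When Alice's classical register is discarded, Bob's outputs are averaged over its values. -/
lemma forget_tensor_apply (Φ : Channel N J) (w : A → ℂ) (σ : A → Matrix N N ℂ) (u u' : Unit)
    (j j' : J) :
    ((Channel.classical fun _ : A => ()).tensor Φ).toLin (classicalQuantum w σ) (u, j) (u', j') =
      ∑ a, w a * Φ.toLin (σ a) j j' := by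
  rw [Channel.tensor_toLin, Channel.onRight_apply]
  have h : (Matrix.of fun n n' => ((Channel.classical fun _ : A => ()).onLeft N).toLin
      (classicalQuantum w σ) (u, n) (u', n')) = ∑ a, w a • σ a := by
    ext n n'
    simp [Channel.onLeft_apply, Channel.classical_apply, classicalQuantum_apply,
      Matrix.sum_apply]
  rw [h, map_sum, Matrix.sum_apply]
  simp only [map_smul, Matrix.smul_apply, smul_eq_mul]

end ClassicalControl

section Protocol

variable {V : Type} [Fintype V] [DecidableEq V] {Qe : Type} [Fintype Qe] [DecidableEq Qe]
  {G : SimpleGraph V} {ord : Fin (Fintype.card V) ≃ V} {em : V → Qe}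

/-! ### The stages of the protocol -/

/-- Among the vertices in `E`, the last one of its emitter is `u`. -/
def IsCurrent (ord : Fin (Fintype.card V) ≃ V) (em : V → Qe) (E : V → Prop) (u : V) : Prop :=
  E u ∧ ∀ w, em w = em u → E w → ord.symm w ≤ ord.symm u

lemma IsCurrent.unique {E : V → Prop} {u v : V} (hu : IsCurrent ord em E u)
    (hv : IsCurrent ord em E v) (h : em u = em v) : u = v :=
  ord.symm.injective <| le_antisymm (hv.2 u h hu.1) (hu.2 v h.symm hv.1)

lemma idle_or_exists_isCurrent (ord : Fin (Fintype.card V) ≃ V) (em : V → Qe) (E : V → Prop)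
    (q : Qe) : (∀ u, em u = q → ¬ E u) ∨ ∃ u, em u = q ∧ IsCurrent ord em E u := by
  classical
  by_cases h : ∀ u, em u = q → ¬ E u
  · exact Or.inl h
  · push Not at h
    obtain ⟨u, hu, hE⟩ := h
    obtain ⟨w, hw, hmax⟩ := (Finset.univ.filter fun w => em w = q ∧ E w).exists_max_image
      ord.symm ⟨u, by simp [hu, hE]⟩
    simp only [Finset.mem_filter, Finset.mem_univ, true_and] at hw hmax
    exact Or.inr ⟨w, hw.1, hw.2, fun w' h1 h2 => hmax w' ⟨h1.trans hw.1, h2⟩⟩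

namespace BobChoices

variable (B : BobChoices G ord em)

/-- Bob's qubits other than the main photons. -/
abbrev Ancilla : Type := Qe ⊕ ((Σ v : V, Fin (B.extra v)) ⊕ V)

/-- The spin of emitter `q`. -/
abbrev spinAnc (q : Qe) : B.Ancilla := .inl q

/-- The additional photon `s`. -/
abbrev photonAnc (s : Σ v : V, Fin (B.extra v)) : B.Ancilla := .inr (.inl s)

/-- The register of the bit `b_v`. -/
abbrev bitAnc (v : V) : B.Ancilla := .inr (.inr v)

/-- The additional photon `s` is consumed by a fusion that creates one of the edges in `T`. -/
def ConsumedBy (T : V → V → Prop) (s : Σ v, Fin (B.extra v)) : Prop :=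
  ∃ v w p, T v w ∧ IsLink G ord em v w ∧ B.fuse v w = some p ∧ (s = ⟨v, p.1⟩ ∨ s = ⟨w, p.2⟩)

/-- The statuses of Bob's ancillary qubits, and a bound on the set of the measured ones, when the
vertices in `E` have been generated, with their additional photons for those in `A`, the emitters
have left the vertices in `R`, and the edges in `T` have been created. -/
structure Stage (E A R : V → Prop) (T : V → V → Prop) (st : B.Ancilla → Status V)
    (M : Set B.Ancilla) : Prop where
  bit_zero : ∀ v, ¬ E v → st (B.bitAnc v) = .zero
  bit_plus : ∀ v, E v → st (B.bitAnc v) = .plus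
  spin_idle : ∀ q, (∀ u, em u = q → ¬ E u) → st (B.spinAnc q) = .plus
  spin_copy : ∀ u, IsCurrent ord em E u → ¬ R u → st (B.spinAnc (em u)) = .copy u
  spin_dual : ∀ u, IsCurrent ord em E u → R u → st (B.spinAnc (em u)) = .dual u
  photon_zero : ∀ s, ¬ A s.1 → st (B.photonAnc s) = .zero
  photon_copy : ∀ s, A s.1 → ¬ B.ConsumedBy T s → st (B.photonAnc s) = .copy s.1
  photon_plus : ∀ s, A s.1 → B.ConsumedBy T s → st (B.photonAnc s) = .plus
  measured : ∀ n ∈ M, (∃ v, E v ∧ n = B.bitAnc v) ∨ ∃ s, B.ConsumedBy T s ∧ n = B.photonAnc s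

/-- Bob's register is in the state of the given stage, for Alice's angles `θ`. -/
def Reached (θ : V → Angle) (E A R : V → Prop) (T : V → V → Prop)
    (ρ : Matrix (B.Qubit → Bool) (B.Qubit → Bool) ℂ) : Prop :=
  ∃ (st : B.Ancilla → Status V) (M : Set B.Ancilla),
    IsWave ρ (amplitude θ E T) st M ∧ B.Stage E A R T st M

variable {B} {θ : V → Angle} {E A R E' A' R' : V → Prop} {T T' : V → V → Prop}
  {st st' : B.Ancilla → Status V} {M : Set B.Ancilla}
  {ρ : Matrix (B.Qubit → Bool) (B.Qubit → Bool) ℂ}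

lemma Reached.congr (h : B.Reached θ E A R T ρ) (hE : ∀ v, E v ↔ E' v) (hA : ∀ v, A v ↔ A' v)
    (hR : ∀ v, R v ↔ R' v) (hT : ∀ v w, T v w ↔ T' v w) : B.Reached θ E' A' R' T' ρ := by
  obtain rfl : E = E' := funext fun v => propext (hE v)
  obtain rfl : A = A' := funext fun v => propext (hA v)
  obtain rfl : R = R' := funext fun v => propext (hR v)
  obtain rfl : T = T' := funext fun v => funext fun w => propext (hT v w)
  exact h

lemma Stage.spinAnc_notMem (S : B.Stage E A R T st M) (q : Qe) : B.spinAnc q ∉ M := by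
  intro h
  rcases S.measured _ h with ⟨v, -, e⟩ | ⟨s, -, e⟩ <;> simp at e

lemma Stage.photonAnc_notMem (S : B.Stage E A R T st M) {s : Σ v, Fin (B.extra v)}
    (hs : ¬ B.ConsumedBy T s) : B.photonAnc s ∉ M := by
  intro h
  rcases S.measured _ h with ⟨v, -, e⟩ | ⟨s, hs', e⟩
  · simp at e
  · simp only [Sum.inr.injEq, Sum.inl.injEq] at e
    exact hs (e ▸ hs')

lemma Stage.bitAnc_notMem (S : B.Stage E A R T st M) {v : V} (hv : ¬ E v) : B.bitAnc v ∉ M := by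
  intro h
  rcases S.measured _ h with ⟨v', hv', e⟩ | ⟨s, -, e⟩
  · simp only [Sum.inr.injEq] at e
    exact hv (e ▸ hv')
  · simp at e

/-- Only generated vertices occur in the statuses. -/
lemma Stage.fresh (S : B.Stage E E R T st M) {v : V} (hv : ¬ E v) (n : B.Ancilla) :
    st n ≠ .copy v ∧ st n ≠ .dual v := by
  have key : ∀ u, E u → (Status.copy u ≠ .copy v ∧ Status.copy u ≠ .dual v) ∧
      (Status.dual u ≠ .copy v ∧ Status.dual u ≠ .dual v) := by
    intro u hu
    have : u ≠ v := fun e => hv (e ▸ hu)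
    simp [this]
  rcases n with q | s | w
  · rcases idle_or_exists_isCurrent ord em E q with h | ⟨u, rfl, hu⟩
    · rw [S.spin_idle q h]; simp
    · by_cases hR : R u
      · rw [S.spin_dual u hu hR]; exact (key u hu.1).2
      · rw [S.spin_copy u hu hR]; exact (key u hu.1).1
  · by_cases hs : E s.1
    · by_cases hc : B.ConsumedBy T s
      · rw [S.photon_plus s hs hc]; simp
      · rw [S.photon_copy s hs hc]; exact (key _ hs).1
    · rw [S.photon_zero s hs]; simp
  · by_cases hw : E w
    · rw [S.bit_plus w hw]; simp
    · rw [S.bit_zero w hw]; simp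

variable (G ord) in
/-- The edges created when the rounds before that of `v` have been completed, and those from `v`
to the vertices in `P` have been created. Edges are listed from their later vertex. -/
def roundEdges (v : V) (P : V → Prop) (a b : V) : Prop :=
  (ord.symm a < ord.symm v ∧ G.Adj a b ∧ ord.symm b < ord.symm a) ∨ (a = v ∧ P b)

variable (ord) in
/-- `w` is earlier than `v`. -/
def Earlier (v w : V) : Prop := ord.symm w < ord.symm v

variable (ord) in
/-- `w` is `v` or earlier than `v`. -/
def UpTo (v w : V) : Prop := ord.symm w ≤ ord.symm v

lemma upTo_iff {v w : V} : UpTo ord v w ↔ Earlier ord v w ∨ w = v := by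
  rw [UpTo, Earlier, le_iff_lt_or_eq, ord.symm.injective.eq_iff]

lemma consumedBy_roundEdges_precedes {v : V} (s : Σ v, Fin (B.extra v)) :
    B.ConsumedBy (roundEdges G ord v fun b => Precedes ord em b v) s ↔
      B.ConsumedBy (roundEdges G ord v fun _ => False) s := by
  constructor
  · rintro ⟨a, b, p, hT | ⟨rfl, hP⟩, hL, hp, hs⟩
    · exact ⟨a, b, p, Or.inl hT, hL, hp, hs⟩
    · exact absurd hP hL.2.2
  · rintro ⟨a, b, p, hT | ⟨rfl, hP⟩, hL, hp, hs⟩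
    · exact ⟨a, b, p, Or.inl hT, hL, hp, hs⟩
    · exact hP.elim

/-- Before the entangling operations of the round of `v`, the additional photons of `v` have not
been consumed. -/
lemma earlier_of_consumedBy {v : V} {s : Σ v, Fin (B.extra v)}
    (h : B.ConsumedBy (roundEdges G ord v fun _ => False) s) : Earlier ord v s.1 := by
  obtain ⟨a, b, p, ⟨ha, hab⟩ | ⟨-, hP⟩, hL, hp, rfl | rfl⟩ := h
  · exact ha
  · exact hab.2.trans ha
  · exact hP.elim
  · exact hP.elim

lemma Stage.extend {v : V} (S : B.Stage (Earlier ord v) (Earlier ord v) R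
      (roundEdges G ord v fun _ => False) st M) (hR : ¬ R v)
    (h1 : st' (B.spinAnc (em v)) = .copy v) (h2 : st' (B.bitAnc v) = .plus)
    (h3 : ∀ n, n ≠ B.spinAnc (em v) → n ≠ B.bitAnc v → st' n = st n) :
    B.Stage (UpTo ord v) (Earlier ord v) R (roundEdges G ord v fun b => Precedes ord em b v) st'
      (insert (B.bitAnc v) M) := by
  have hcur : ∀ u, IsCurrent ord em (UpTo ord v) u → em u = em v → u = v := fun u hu he =>
    ord.symm.injective (le_antisymm hu.1 (hu.2 v he.symm le_rfl))
  have hcur' : ∀ u, IsCurrent ord em (UpTo ord v) u → em u ≠ em v →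
      IsCurrent ord em (Earlier ord v) u := fun u hu he =>
    ⟨lt_of_le_of_ne hu.1 fun e => he (by rw [ord.symm.injective e]),
      fun w hw hE => hu.2 w hw (le_of_lt hE)⟩
  constructor
  · intro w hw
    have hwv : w ≠ v := fun e => hw (e ▸ le_rfl)
    rw [h3 _ (by simp) (by simpa using hwv), S.bit_zero w fun h => hw (le_of_lt h)]
  · intro w hw
    by_cases hwv : w = v
    · rw [hwv, h2]
    · rw [h3 _ (by simp) (by simpa using hwv), S.bit_plus w ((upTo_iff.1 hw).resolve_right hwv)]
  · intro q hq
    have hqv : q ≠ em v := fun e => hq v e.symm le_rfl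
    rw [h3 _ (by simpa using hqv) (by simp), S.spin_idle q fun u hu h => hq u hu (le_of_lt h)]
  · intro u hu hRu
    by_cases he : em u = em v
    · rw [hcur u hu he, h1]
    · rw [h3 _ (by simpa using he) (by simp), S.spin_copy u (hcur' u hu he) hRu]
  · intro u hu hRu
    by_cases he : em u = em v
    · exact absurd (hcur u hu he ▸ hRu) hR
    · rw [h3 _ (by simpa using he) (by simp), S.spin_dual u (hcur' u hu he) hRu]
  · intro s hs
    rw [h3 _ (by simp) (by simp), S.photon_zero s hs]
  · intro s hs hc
    rw [h3 _ (by simp) (by simp), S.photon_copy s hs fun h =>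
      hc ((consumedBy_roundEdges_precedes s).2 h)]
  · intro s hs hc
    rw [h3 _ (by simp) (by simp), S.photon_plus s hs ((consumedBy_roundEdges_precedes s).1 hc)]
  · intro n hn
    rcases hn with rfl | hn
    · exact Or.inl ⟨v, le_rfl, rfl⟩
    · rcases S.measured n hn with ⟨w, hw, e⟩ | ⟨s, hs, e⟩
      · exact Or.inl ⟨w, le_of_lt hw, e⟩
      · exact Or.inr ⟨s, (consumedBy_roundEdges_precedes s).2 hs, e⟩

end BobChoices

namespace BobChoices

variable {B : BobChoices G ord em} {θ : V → Angle} {E A R E' A' R' : V → Prop}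
  {T T' : V → V → Prop} {st st' : B.Ancilla → Status V} {M : Set B.Ancilla}
  {ρ : Matrix (B.Qubit → Bool) (B.Qubit → Bool) ℂ}

/-! ### A round of the protocol -/

/-- The photons that Bob may use for a correction still carry the bit of their vertex. -/
lemma Stage.carries_photon (S : B.Stage E A R T st M) {u : V} {k : Option (Fin (B.extra u))}
    (hA : A u) (hk : ∀ j, k = some j → ¬ B.ConsumedBy T ⟨u, j⟩) :
    Carries st (photon u k : B.Qubit) u := by
  cases k with
  | none => exact Or.inl rfl
  | some j => exact Or.inr ⟨B.photonAnc ⟨u, j⟩, rfl, S.photon_copy ⟨u, j⟩ hA (hk j rfl)⟩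

lemma _root_.BlindGraph.Carries.congr {N : Type} {st st' : N → Status V} {r : V ⊕ N} {v : V}
    (h : Carries st r v) (hst : ∀ n, st n = .copy v → st' n = st n) : Carries st' r v := by
  rcases h with h | ⟨n, h, hn⟩
  · exact Or.inl h
  · exact Or.inr ⟨n, h, (hst n hn).trans hn⟩

lemma roundEdges_ne {v a b : V} (h : roundEdges G ord v (fun _ => False) a b) :
    a ≠ v ∧ b ≠ v := by
  rcases h with ⟨ha, hab⟩ | ⟨-, h⟩
  · exact ⟨fun e => lt_irrefl _ (e ▸ ha), fun e => lt_asymm (e ▸ hab.2) ha⟩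
  · exact h.elim

lemma roundEdges_precedes_eq_of_idle {v : V} (h : ∀ u, em u = em v → ¬ Earlier ord v u) :
    roundEdges G ord v (fun b => Precedes ord em b v) = roundEdges G ord v fun _ => False := by
  funext a b
  refine propext (or_congr_right ?_)
  simp only [and_false, iff_false, not_and]
  exact fun _ hb => h b hb.1 hb.2.1

lemma roundEdges_precedes_eq {u v : V} (h : Precedes ord em u v) :
    roundEdges G ord v (fun b => Precedes ord em b v) =
      fun a b => roundEdges G ord v (fun _ => False) a b ∨ (a = v ∧ b = u) := by
  funext a b
  refine propext ?_
  have : Precedes ord em b v ↔ b = u := ⟨fun hb => hb.unique h, fun e => e ▸ h⟩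
  simp only [roundEdges, this, and_false, or_false]

lemma amplitude_upTo (v : V) :
    amplitude θ (UpTo ord v) (roundEdges G ord v fun _ => False) = fun y => phase (θ v) (y v) *
      amplitude θ (Earlier ord v) (roundEdges G ord v fun _ => False)
        (Function.update y v false) := by
  have h : UpTo ord v = fun w => Earlier ord v w ∨ w = v :=
    funext fun w => propext upTo_iff
  rw [h]
  exact amplitude_add_vertex (lt_irrefl _) fun a b => roundEdges_ne

/-- The call to the extender in the round of `v`, and the corrections that depend on `b_v`. -/
theorem Reached.correction {v : V} (h : B.Reached θ (Earlier ord v) (Earlier ord v)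
      (fun w => B.release w < ord.symm v) (roundEdges G ord v fun _ => False) ρ)
    (h1 : (spin (em v) : B.Qubit) ≠ mainPhoton v) (h2 : (spin (em v) : B.Qubit) ≠ bitReg v)
    (h3 : (mainPhoton v : B.Qubit) ≠ bitReg v) :
    B.Reached θ (UpTo ord v) (Earlier ord v) (fun w => B.release w < ord.symm v)
      (roundEdges G ord v fun b => Precedes ord em b v)
      ((run (B.correctionCircuit v)).toLin ((extendChannel (θ v) (spin (em v)) (mainPhoton v)
        (bitReg v) h1 h2 h3).toLin ρ)) := by
  classical
  obtain ⟨st, M, hW, S⟩ := h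
  have hv : ¬ Earlier ord v v := lt_irrefl _
  have hR : ¬ B.release v < ord.symm v := not_lt.2 (B.le_release v)
  have hne : B.bitAnc v ≠ B.spinAnc (em v) := by simp
  have hext : (st (B.spinAnc (em v)) = .plus ∨ ∃ u, st (B.spinAnc (em v)) = .dual u) →
      IsWave _ _ _ _ := fun hsp => hW.extend (θ v) (v := v) (sp := B.spinAnc (em v))
    (bi := B.bitAnc v) h1 h2 h3 hsp (S.bit_zero v hv) (S.spinAnc_notMem _) (S.bitAnc_notMem hv)
    (S.fresh hv) fun y hy => amplitude_eq_zero hv hy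
  rw [correctionCircuit, run_append]
  rcases idle_or_exists_isCurrent ord em (Earlier ord v) (em v) with hi | ⟨u, hu, hcur⟩
  · have hl : (vertices ord).filter (fun u => decide (Precedes ord em u v)) = [] :=
      List.filter_eq_nil_iff.2 fun u _ hp => hi u (of_decide_eq_true hp).1 (of_decide_eq_true hp).2.1
    have hs := S.spin_idle _ hi
    have hW' := hext (Or.inl hs)
    rw [hl]
    refine ⟨_, _, ?_, S.extend (st' := Function.update (Function.update st (B.bitAnc v)
      (st (B.spinAnc (em v)))) (B.spinAnc (em v)) (.copy v)) hR ?_ ?_ ?_⟩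
    · rw [roundEdges_precedes_eq_of_idle hi, amplitude_upTo]
      simp only [hs, Status.factor, mul_one] at hW' ⊢
      exact hW'
    · rw [Function.update_self]
    · rw [Function.update_of_ne hne, Function.update_self, hs]
    · intro n hn1 hn2
      rw [Function.update_of_ne hn1, Function.update_of_ne hn2]
  · have hp : Precedes ord em u v := ⟨hu, hcur.1, fun w hw h =>
      not_lt.2 (hcur.2 w (hw.trans hu.symm) h.2) h.1⟩
    have hl : (vertices ord).filter (fun u => decide (Precedes ord em u v)) = [u] :=
      filter_vertices_eq_singleton fun a => by
        rw [decide_eq_true_iff]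
        exact ⟨fun ha => ha.unique hp, fun e => e ▸ hp⟩
    have hs : st (B.spinAnc (em v)) = .dual u := by
      rw [← hu]
      exact S.spin_dual u hcur (B.release_lt u v hp)
    have hW' := hext (Or.inr ⟨u, hs⟩)
    have hcar : Carries st (photon u (B.corr v u) : B.Qubit) u := by
      refine S.carries_photon hcur.1 ?_
      rintro j hj ⟨a, b, p, ⟨ha, -⟩ | ⟨-, hf⟩, hL, hf', hsp⟩
      · refine B.corr_available u v j hp hj a b p hL ha hf' ?_
        simpa using hsp
      · exact hf.elim
    have hW'' := hW'.cz_dual (n := B.bitAnc v) (v := u) (r := photon u (B.corr v u))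
      (by rw [Function.update_of_ne hne, Function.update_self, hs])
      (Carries.congr hcar fun n hn => by
        have hn1 : n ≠ B.spinAnc (em v) := fun e => by
          rw [e, hs] at hn
          cases hn
        have hn2 : n ≠ B.bitAnc v := fun e => by
          rw [e, S.bit_zero v hv] at hn
          cases hn
        rw [Function.update_of_ne hn1, Function.update_of_ne hn2])
    rw [hl]
    refine ⟨_, _, ?_, S.extend (st' := Function.update (Function.update (Function.update st
      (B.bitAnc v) (st (B.spinAnc (em v)))) (B.spinAnc (em v)) (.copy v)) (B.bitAnc v) .plus)
      hR ?_ ?_ ?_⟩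
    · rw [roundEdges_precedes_eq hp, amplitude_add_edge fun h => (roundEdges_ne h).1 rfl,
        amplitude_upTo]
      have hF : ∀ y : V → Bool, phase (θ v) (y v) * (st (B.spinAnc (em v))).factor (y v) y *
          amplitude θ (Earlier ord v) (roundEdges G ord v fun _ => False)
            (Function.update y v false) = phase (θ v) (y v) *
          amplitude θ (Earlier ord v) (roundEdges G ord v fun _ => False)
            (Function.update y v false) * sgn (y v && y u) := fun y => by
        rw [hs, Status.factor]
        ring
      rw [funext hF] at hW''
      exact hW''
    · rw [Function.update_of_ne hne.symm, Function.update_self]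
    · rw [Function.update_self]
    · intro n hn1 hn2
      rw [Function.update_of_ne hn2, Function.update_of_ne hn1, Function.update_of_ne hn2]

/-- The additional photons of `v` become copies of its main photon. -/
theorem Reached.emission {v : V} (h : B.Reached θ (UpTo ord v) (Earlier ord v)
      (fun w => B.release w < ord.symm v) (roundEdges G ord v fun b => Precedes ord em b v) ρ) :
    B.Reached θ (UpTo ord v) (UpTo ord v) (fun w => B.release w < ord.symm v)
      (roundEdges G ord v fun b => Precedes ord em b v) ((run (B.emissionCircuit v)).toLin ρ) := by
  obtain ⟨st, M, hW, S⟩ := h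
  have hv : ¬ Earlier ord v v := lt_irrefl _
  have hcur : IsCurrent ord em (UpTo ord v) v := ⟨le_rfl, fun w _ hw => hw⟩
  have hsp := S.spin_copy v hcur (not_lt.2 (B.le_release v))
  have hc : ∀ k, ¬ B.ConsumedBy (roundEdges G ord v fun b => Precedes ord em b v) ⟨v, k⟩ :=
    fun k h => hv (earlier_of_consumedBy ((consumedBy_roundEdges_precedes _).1 h))
  have hinj : Function.Injective fun k : Fin (B.extra v) => B.photonAnc ⟨v, k⟩ := fun k k' e => by
    simpa using e
  obtain ⟨st', M', hW', h1, h2, h3⟩ := hW.run_flatMap hinj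
    (fun k => [.cnot (spin (em v)) (addPhoton ⟨v, k⟩) (by simp [spin, addPhoton])])
    (fun _ => .copy v) ∅ (List.finRange (B.extra v)) (List.nodup_finRange _) st
    (fun k _ ρ st₁ M₁ hW₁ hs hM hr => ⟨M₁,
      hW₁.cnot_copy (n := B.spinAnc (em v)) (by rw [hr _ (by simp), hsp])
        (hs.trans (S.photon_zero ⟨v, k⟩ hv)) hM (by simp), fun n hn => Or.inl hn⟩)
    (fun _ _ => rfl) (fun k _ => S.photonAnc_notMem (hc k)) (fun _ _ => rfl)
  have hph : ∀ k, st' (B.photonAnc ⟨v, k⟩) = .copy v := fun k => h1 k (List.mem_finRange k)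
  have hoth : ∀ s : Σ v, Fin (B.extra v), s.1 ≠ v → st' (B.photonAnc s) = st (B.photonAnc s) :=
    fun s hs => h2 _ fun k _ e => hs (by simp only [Sum.inr.injEq, Sum.inl.injEq] at e; rw [e])
  have hspin : ∀ q, st' (B.spinAnc q) = st (B.spinAnc q) := fun q => h2 _ fun k _ => by simp
  have hbit : ∀ w, st' (B.bitAnc w) = st (B.bitAnc w) := fun w => h2 _ fun k _ => by simp
  refine ⟨st', M', ?_, ?_⟩
  · rw [emissionCircuit, List.map_eq_flatMap]
    exact hW'
  constructor
  · exact fun w hw => (hbit w).trans (S.bit_zero w hw)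
  · exact fun w hw => (hbit w).trans (S.bit_plus w hw)
  · exact fun q hq => (hspin q).trans (S.spin_idle q hq)
  · exact fun u hu hR => (hspin _).trans (S.spin_copy u hu hR)
  · exact fun u hu hR => (hspin _).trans (S.spin_dual u hu hR)
  · exact fun s hs => (hoth s fun e => hs (e ▸ le_rfl)).trans
      (S.photon_zero s fun h => hs (le_of_lt h))
  · intro s hs hcon
    by_cases e : s.1 = v
    · obtain ⟨w, k⟩ := s
      subst e
      exact hph k
    · exact (hoth s e).trans (S.photon_copy s ((upTo_iff.1 hs).resolve_right e) hcon)
  · intro s hs hcon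
    have hE := earlier_of_consumedBy ((consumedBy_roundEdges_precedes s).1 hcon)
    exact (hoth s fun e => hv (e ▸ hE)).trans (S.photon_plus s hE hcon)
  · exact fun n hn => S.measured n ((h3 n hn).resolve_right fun h => h.1)

/-- When the edge from `v` to `w` is to be created by a `CZ` gate, the emitter of `w` is still
situated at `w`. -/
lemma isCurrent_of_fuse_eq_none {v w : V} (hL : IsLink G ord em v w) (hf : B.fuse v w = none) :
    IsCurrent ord em (UpTo ord v) w := by
  refine ⟨le_of_lt hL.2.1, fun w' he hw' => not_lt.1 fun hlt => ?_⟩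
  exact absurd (B.release_lt_of_later he.symm hlt)
    (not_lt.2 (le_trans hw' (B.still_there v w hL hf)))

lemma consumedBy_or_iff {v w : V} (hL : IsLink G ord em v w) (s : Σ v, Fin (B.extra v)) :
    B.ConsumedBy (fun a b => T a b ∨ (a = v ∧ b = w)) s ↔ B.ConsumedBy T s ∨
      ∃ p, B.fuse v w = some p ∧ (s = ⟨v, p.1⟩ ∨ s = ⟨w, p.2⟩) := by
  constructor
  · rintro ⟨a, b, p, hT | ⟨rfl, rfl⟩, hL', hp, hs⟩
    · exact Or.inl ⟨a, b, p, hT, hL', hp, hs⟩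
    · exact Or.inr ⟨p, hp, hs⟩
  · rintro (⟨a, b, p, hT, hL', hp, hs⟩ | ⟨p, hp, hs⟩)
    · exact ⟨a, b, p, Or.inl hT, hL', hp, hs⟩
    · exact ⟨v, w, p, Or.inr ⟨rfl, rfl⟩, hL, hp, hs⟩

/-- The creation of one edge by Bob. -/
theorem Reached.entangle {v w : V} (h : B.Reached θ (UpTo ord v) (UpTo ord v)
      (fun w => B.release w < ord.symm v) T ρ) (hL : IsLink G ord em v w) (hT : ¬ T v w) :
    B.Reached θ (UpTo ord v) (UpTo ord v) (fun w => B.release w < ord.symm v)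
      (fun a b => T a b ∨ (a = v ∧ b = w)) ((run (B.entangle v w)).toLin ρ) := by
  obtain ⟨st, M, hW, S⟩ := h
  have hcur : IsCurrent ord em (UpTo ord v) v := ⟨le_rfl, fun w _ hw => hw⟩
  have hsp := S.spin_copy v hcur (not_lt.2 (B.le_release v))
  cases hf : B.fuse v w with
  | none =>
    have hw := S.spin_copy w (isCurrent_of_fuse_eq_none hL hf)
      (not_lt.2 (B.still_there v w hL hf))
    have hC : ∀ s, B.ConsumedBy (fun a b => T a b ∨ (a = v ∧ b = w)) s ↔ B.ConsumedBy T s :=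
      fun s => by simp [consumedBy_or_iff hL, hf]
    refine ⟨st, M, ?_, ⟨S.bit_zero, S.bit_plus, S.spin_idle, S.spin_copy, S.spin_dual,
      S.photon_zero, fun s hs hc => S.photon_copy s hs fun h => hc ((hC s).2 h),
      fun s hs hc => S.photon_plus s hs ((hC s).1 hc), fun n hn => ?_⟩⟩
    · rw [amplitude_add_edge hT, BobChoices.entangle, hf]
      exact hW.cz_carries (Or.inr ⟨B.spinAnc (em v), rfl, hsp⟩)
        (Or.inr ⟨B.spinAnc (em w), rfl, hw⟩)
    · exact (S.measured n hn).imp_right fun ⟨s, hs, e⟩ => ⟨s, (hC s).2 hs, e⟩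
  | some p =>
    have hvw : v ≠ w := hL.1.ne
    have hC : ∀ s, B.ConsumedBy (fun a b => T a b ∨ (a = v ∧ b = w)) s ↔
        B.ConsumedBy T s ∨ (s = ⟨v, p.1⟩ ∨ s = ⟨w, p.2⟩) := fun s => by
      simp [consumedBy_or_iff hL, hf]
    -- both photons are still copies, since a photon is consumed at most once
    have hnot : ∀ s : Σ v, Fin (B.extra v), (s = ⟨v, p.1⟩ ∨ s = ⟨w, p.2⟩) →
        ¬ B.ConsumedBy T s := by
      rintro s hs ⟨a, b, p', hT', hL', hp', hs'⟩
      refine B.fuse_once v w a b p p' hL hL' hf hp' ?_ s (by simpa using hs) (by simpa using hs')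
      rintro e
      obtain ⟨rfl, rfl⟩ := Prod.mk.inj e
      exact hT hT'
    have hn1 := hnot ⟨v, p.1⟩ (Or.inl rfl)
    have hn2 := hnot ⟨w, p.2⟩ (Or.inr rfl)
    have hne : B.photonAnc ⟨v, p.1⟩ ≠ B.photonAnc ⟨w, p.2⟩ := by
      intro e
      simp only [Sum.inr.injEq, Sum.inl.injEq, Sigma.mk.injEq] at e
      exact hvw e.1
    have hW' := hW.fusion hne (S.photon_copy ⟨v, p.1⟩ le_rfl hn1)
      (S.photon_copy ⟨w, p.2⟩ (le_of_lt hL.2.1) hn2) (S.photonAnc_notMem hn1)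
      (S.photonAnc_notMem hn2)
    have hst : ∀ n, n ≠ B.photonAnc ⟨v, p.1⟩ → n ≠ B.photonAnc ⟨w, p.2⟩ →
        Function.update (Function.update st (B.photonAnc ⟨v, p.1⟩) .plus)
          (B.photonAnc ⟨w, p.2⟩) .plus n = st n := fun n h1 h2 => by
      rw [Function.update_of_ne h2, Function.update_of_ne h1]
    refine ⟨_, insert (B.photonAnc ⟨w, p.2⟩) (insert (B.photonAnc ⟨v, p.1⟩) M), ?_,
      ⟨fun u hu => (hst _ (by simp) (by simp)).trans (S.bit_zero u hu),
      fun u hu => (hst _ (by simp) (by simp)).trans (S.bit_plus u hu),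
      fun q hq => (hst _ (by simp) (by simp)).trans (S.spin_idle q hq),
      fun u hu hR => (hst _ (by simp) (by simp)).trans (S.spin_copy u hu hR),
      fun u hu hR => (hst _ (by simp) (by simp)).trans (S.spin_dual u hu hR), ?_, ?_, ?_, ?_⟩⟩
    · rw [amplitude_add_edge hT, BobChoices.entangle, hf]
      exact hW'
    · intro s hs
      refine (hst _ ?_ ?_).trans (S.photon_zero s hs) <;> intro e <;>
        simp only [Sum.inr.injEq, Sum.inl.injEq] at e <;> subst e
      · exact hs le_rfl
      · exact hs (le_of_lt hL.2.1)
    · intro s hs hc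
      rw [hC, not_or, not_or] at hc
      refine (hst _ ?_ ?_).trans (S.photon_copy s hs hc.1) <;> intro e <;>
        simp only [Sum.inr.injEq, Sum.inl.injEq] at e
      · exact hc.2.1 e
      · exact hc.2.2 e
    · intro s hs hc
      by_cases h2 : s = ⟨w, p.2⟩
      · rw [h2, Function.update_self]
      · by_cases h1 : s = ⟨v, p.1⟩
        · rw [h1, Function.update_of_ne hne, Function.update_self]
        · refine (hst _ ?_ ?_).trans (S.photon_plus s hs (((hC s).1 hc).resolve_right ?_))
          · simpa using h1
          · simpa using h2
          · exact not_or.2 ⟨h1, h2⟩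
    · intro n hn
      rcases hn with rfl | rfl | hn
      · exact Or.inr ⟨_, (hC _).2 (Or.inr (Or.inr rfl)), rfl⟩
      · exact Or.inr ⟨_, (hC _).2 (Or.inr (Or.inl rfl)), rfl⟩
      · exact (S.measured n hn).imp_right fun ⟨s, hs, e⟩ => ⟨s, (hC s).2 (Or.inl hs), e⟩

lemma Reached.entangle_list {v : V} (l : List V) (hl : l.Nodup) (h : B.Reached θ (UpTo ord v)
      (UpTo ord v) (fun w => B.release w < ord.symm v) T ρ)
    (hL : ∀ w ∈ l, IsLink G ord em v w ∧ ¬ T v w) :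
    B.Reached θ (UpTo ord v) (UpTo ord v) (fun w => B.release w < ord.symm v)
      (fun a b => T a b ∨ (a = v ∧ b ∈ l)) ((run (l.flatMap fun w => B.entangle v w)).toLin ρ) := by
  induction l generalizing T ρ with
  | nil => exact h.congr (fun _ => Iff.rfl) (fun _ => Iff.rfl) (fun _ => Iff.rfl) (by simp)
  | cons w l ih =>
    rw [List.nodup_cons] at hl
    rw [List.flatMap_cons, run_append]
    refine (ih hl.2 (h.entangle (hL w List.mem_cons_self).1 (hL w List.mem_cons_self).2)
      fun u hu => ⟨(hL u (List.mem_cons_of_mem _ hu)).1, ?_⟩).congr (fun _ => Iff.rfl)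
      (fun _ => Iff.rfl) (fun _ => Iff.rfl) ?_
    · rintro (hT | ⟨-, rfl⟩)
      · exact (hL u (List.mem_cons_of_mem _ hu)).2 hT
      · exact hl.1 hu
    · intro a b
      rw [List.mem_cons]
      tauto

/-- All edges from `v` to earlier vertices are created in the round of `v`. -/
theorem Reached.entangling {v : V} (hem : ∀ v w, Precedes ord em v w → G.Adj v w)
    (h : B.Reached θ (UpTo ord v) (UpTo ord v) (fun w => B.release w < ord.symm v)
      (roundEdges G ord v fun b => Precedes ord em b v) ρ) :
    B.Reached θ (UpTo ord v) (UpTo ord v) (fun w => B.release w < ord.symm v)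
      (fun a b => UpTo ord v a ∧ G.Adj a b ∧ Earlier ord a b)
      ((run (B.entanglingCircuit v)).toLin ρ) := by
  classical
  refine (h.entangle_list _ (nodup_vertices.filter _) fun w hw => ?_).congr (fun _ => Iff.rfl)
    (fun _ => Iff.rfl) (fun _ => Iff.rfl) fun a b => ?_
  · have hL : IsLink G ord em v w := of_decide_eq_true (List.mem_filter.1 hw).2
    refine ⟨hL, ?_⟩
    rintro (⟨hlt, -⟩ | ⟨-, hp⟩)
    · exact lt_irrefl _ hlt
    · exact hL.2.2 hp
  · simp only [List.mem_filter, mem_vertices, true_and, decide_eq_true_iff, roundEdges]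
    rw [upTo_iff]
    constructor
    · rintro ((⟨ha, hab⟩ | ⟨rfl, hp⟩) | ⟨rfl, hL⟩)
      · exact ⟨Or.inl ha, hab⟩
      -- the edge from the preceding vertex of the same emitter, created by the extender
      · exact ⟨Or.inr rfl, (hem _ _ hp).symm, hp.2.1⟩
      · exact ⟨Or.inr rfl, hL.1, hL.2.1⟩
    · rintro ⟨ha | rfl, hab⟩
      · exact Or.inl (Or.inl ⟨ha, hab⟩)
      · by_cases hp : Precedes ord em b a
        · exact Or.inl (Or.inr ⟨rfl, hp⟩)
        · exact Or.inr ⟨rfl, hab.1, hab.2, hp⟩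

/-- An emitter leaves its current vertex. -/
lemma Reached.release (h : B.Reached θ E A R T ρ) {u : V} (hu : IsCurrent ord em E u)
    (hR : ¬ R u) :
    B.Reached θ E A (fun w => R w ∨ w = u) T
      ((Instr.had (spin (em u) : B.Qubit)).channel.toLin ρ) := by
  obtain ⟨st, M, hW, S⟩ := h
  refine ⟨_, M, hW.had_copy (n := B.spinAnc (em u)) (S.spinAnc_notMem _) (S.spin_copy u hu hR), ?_⟩
  have hst : ∀ n, n ≠ B.spinAnc (em u) →
      Function.update st (B.spinAnc (em u)) (.dual u) n = st n := fun n hn =>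
    Function.update_of_ne hn ..
  constructor
  · exact fun w hw => (hst _ (by simp)).trans (S.bit_zero w hw)
  · exact fun w hw => (hst _ (by simp)).trans (S.bit_plus w hw)
  · intro q hq
    exact (hst _ fun e => hq u (Sum.inl_injective e).symm hu.1).trans (S.spin_idle q hq)
  · intro w hw hRw
    have hne : em w ≠ em u := fun e => hRw (Or.inr (hw.unique hu e))
    exact (hst _ fun e => hne (Sum.inl_injective e)).trans
      (S.spin_copy w hw fun h => hRw (Or.inl h))
  · intro w hw hRw
    by_cases he : em w = em u
    · rw [hw.unique hu he, Function.update_self]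
    · refine (hst _ fun e => he (Sum.inl_injective e)).trans (S.spin_dual w hw ?_)
      exact hRw.resolve_right fun e => he (by rw [e])
  · exact fun s hs => (hst _ (by simp)).trans (S.photon_zero s hs)
  · exact fun s hs hc => (hst _ (by simp)).trans (S.photon_copy s hs hc)
  · exact fun s hs hc => (hst _ (by simp)).trans (S.photon_plus s hs hc)
  · exact S.measured

lemma Reached.release_list (l : List V) (hl : l.Nodup) (h : B.Reached θ E A R T ρ)
    (hu : ∀ u ∈ l, IsCurrent ord em E u ∧ ¬ R u) :
    B.Reached θ E A (fun w => R w ∨ w ∈ l) T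
      ((run (l.map fun u => Instr.had (spin (em u) : B.Qubit))).toLin ρ) := by
  induction l generalizing R ρ with
  | nil => exact h.congr (fun _ => Iff.rfl) (fun _ => Iff.rfl) (by simp) (fun _ _ => Iff.rfl)
  | cons u l ih =>
    rw [List.nodup_cons] at hl
    refine (ih hl.2 (h.release (hu u List.mem_cons_self).1 (hu u List.mem_cons_self).2)
      fun w hw => ⟨(hu w (List.mem_cons_of_mem _ hw)).1, ?_⟩).congr (fun _ => Iff.rfl)
      (fun _ => Iff.rfl) ?_ (fun _ _ => Iff.rfl)
    · rintro (hR | rfl)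
      · exact (hu w (List.mem_cons_of_mem _ hw)).2 hR
      · exact hl.1 hw
    · intro w
      rw [List.mem_cons]
      tauto

theorem Reached.releases {v : V} (h : B.Reached θ (UpTo ord v) (UpTo ord v)
      (fun w => B.release w < ord.symm v) T ρ) :
    B.Reached θ (UpTo ord v) (UpTo ord v) (fun w => B.release w ≤ ord.symm v) T
      ((run (B.releaseCircuit (ord.symm v))).toLin ρ) := by
  refine (h.release_list _ (nodup_vertices.filter _) fun u hu => ?_).congr (fun _ => Iff.rfl)
    (fun _ => Iff.rfl) (fun w => ?_) (fun _ _ => Iff.rfl)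
  · have hr : B.release u = ord.symm v := of_decide_eq_true (List.mem_filter.1 hu).2
    refine ⟨⟨by simpa only [hr, UpTo] using B.le_release u, fun w he hw => not_lt.1 fun hlt => ?_⟩,
      by rw [hr]; exact lt_irrefl _⟩
    exact absurd (B.release_lt_of_later he.symm hlt) (by rw [hr]; exact not_lt.2 hw)
  · simp [mem_vertices, le_iff_lt_or_eq]

end BobChoices

/-! ### Initialisation, rounds and final measurements -/


namespace BobChoices

variable {B : BobChoices G ord em} {θ : V → Angle}
  {ρ : Matrix (B.Qubit → Bool) (B.Qubit → Bool) ℂ}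

variable (B) in
/-- Bob's register is in the state reached after `k` rounds, for Alice's angles `θ`. -/
def Completed (θ : V → Angle) (k : ℕ) (ρ : Matrix (B.Qubit → Bool) (B.Qubit → Bool) ℂ) : Prop :=
  B.Reached θ (fun w => (ord.symm w : ℕ) < k) (fun w => (ord.symm w : ℕ) < k)
    (fun w => (B.release w : ℕ) < k)
    (fun a b => (ord.symm a : ℕ) < k ∧ G.Adj a b ∧ ord.symm b < ord.symm a) ρ

/-- Round `i`: the call to the extender followed by Bob's operations. -/
theorem Completed.round (hem : ∀ v w, Precedes ord em v w → G.Adj v w)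
    {i : Fin (Fintype.card V)} (h : B.Completed θ i ρ)
    (h1 : (spin (em (ord i)) : B.Qubit) ≠ mainPhoton (ord i))
    (h2 : (spin (em (ord i)) : B.Qubit) ≠ bitReg (ord i))
    (h3 : (mainPhoton (ord i) : B.Qubit) ≠ bitReg (ord i)) :
    B.Completed θ (i + 1) ((run (B.roundCircuit i)).toLin ((extendChannel (θ (ord i))
      (spin (em (ord i))) (mainPhoton (ord i)) (bitReg (ord i)) h1 h2 h3).toLin ρ)) := by
  have hi : ord.symm (ord i) = i := ord.symm_apply_apply i
  have h0 : B.Reached θ (Earlier ord (ord i)) (Earlier ord (ord i))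
      (fun w => B.release w < ord.symm (ord i)) (roundEdges G ord (ord i) fun _ => False) ρ := by
    refine Reached.congr h (fun w => ?_) (fun w => ?_) (fun w => ?_) fun a b => ?_
    · rw [Earlier, hi, Fin.lt_def]
    · rw [Earlier, hi, Fin.lt_def]
    · rw [hi, Fin.lt_def]
    · rw [roundEdges, hi, ← Fin.lt_def, and_false, or_false]
  have h4 := ((h0.correction h1 h2 h3).emission.entangling hem).releases
  rw [hi] at h4
  rw [roundCircuit, run_append, run_append, run_append]
  refine h4.congr (fun w => ?_) (fun w => ?_) (fun w => ?_) fun a b => ?_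
  · rw [UpTo, hi, Fin.le_def, Nat.lt_succ_iff]
  · rw [UpTo, hi, Fin.le_def, Nat.lt_succ_iff]
  · rw [Fin.le_def, Nat.lt_succ_iff]
  · rw [UpTo, hi, Fin.le_def, Nat.lt_succ_iff, Earlier]

variable (B θ) in
/-- Before the first round the graph state is empty and the spins are in the state `|+⟩`. -/
theorem completed_init :
    B.Completed θ 0 ((run B.initCircuit).toLin
      (Matrix.single (fun _ => false) (fun _ => false) 1)) := by
  have h0 : IsWave (V := V) (N := B.Ancilla) (Matrix.single (fun _ => false) (fun _ => false) 1)
      (amplitude θ (fun w => (ord.symm w : ℕ) < 0)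
        (fun a b => (ord.symm a : ℕ) < 0 ∧ G.Adj a b ∧ ord.symm b < ord.symm a))
      (fun _ => .zero) ∅ := by
    have hw : ∀ x : V ⊕ B.Ancilla → Bool, wave (amplitude θ (fun w => (ord.symm w : ℕ) < 0)
        (fun a b => (ord.symm a : ℕ) < 0 ∧ G.Adj a b ∧ ord.symm b < ord.symm a))
        (fun _ => .zero) x = if x = fun _ => false then 1 else 0 := by
      intro x
      split_ifs with hx
      · subst hx
        simp [wave, amplitude, factorIf, Status.factor]
      · obtain ⟨v | n, hq⟩ : ∃ q, x q = true := by
          by_contra hne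
          push Not at hne
          exact hx (funext fun q => by simpa using hne q)
        · rw [wave, amplitude_eq_zero (v := v) (by simp) hq, zero_mul]
        · rw [wave_eq_factor_mul n, hq]
          simp [Status.factor]
    refine ⟨1, ?_⟩
    ext x x'
    rw [dephased, Matrix.of_apply, if_pos (by simp [AgreeOn]), hw, hw, Matrix.single_apply]
    by_cases hx : x = fun _ => false <;> by_cases hx' : x' = fun _ => false <;>
      simp [hx, hx', eq_comm]
  obtain ⟨st, M, hW, hs, hk, hM⟩ := h0.run_flatMap (f := B.spinAnc) Sum.inl_injective
    (fun q => [.had (.inr (B.spinAnc q))]) (fun _ => .plus) ∅ (Finset.univ : Finset Qe).toList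
    (Finset.nodup_toList _) (fun _ => .zero)
    (fun q _ ρ st M hW hst hM _ => ⟨M, hW.had_zero hM hst, fun n hn => Or.inl hn⟩)
    (fun _ _ => rfl) (fun _ _ => Set.notMem_empty _) fun _ _ => rfl
  have hM0 : ∀ n, n ∉ M := fun n hn => by simpa using hM n hn
  refine ⟨st, M, ?_, ?_⟩
  · rw [initCircuit, List.map_eq_flatMap]
    exact hW
  · constructor
    · exact fun v _ => hk _ (by simp)
    · exact fun v hv => absurd hv (by simp)
    · exact fun q _ => hs q (by simp)
    · exact fun u hu => absurd hu.1 (by simp)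
    · exact fun u hu => absurd hu.1 (by simp)
    · exact fun s _ => hk _ (by simp)
    · exact fun s hs => absurd hs (by simp)
    · exact fun s hs => absurd hs (by simp)
    · exact fun n hn => absurd hn (hM0 n)

lemma consumedBy_iff_isConsumed (s : Σ v, Fin (B.extra v)) :
    B.ConsumedBy (fun v w => G.Adj v w ∧ ord.symm w < ord.symm v) s ↔ B.IsConsumed s := by
  constructor
  · rintro ⟨v, w, p, -, hL, h⟩
    exact ⟨v, w, p, hL, h⟩
  · rintro ⟨v, w, p, hL, h⟩
    exact ⟨v, w, p, ⟨hL.1, hL.2.1⟩, hL, h⟩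

/-- The stage reached when all the vertices have been generated and left by their emitters, and all
the edges have been created. -/
lemma Completed.stage (h : B.Completed θ (Fintype.card V) ρ) :
    ∃ st M, IsWave (V := V) (N := B.Ancilla) ρ
        (amplitude θ (fun _ => True) fun v w => G.Adj v w ∧ ord.symm w < ord.symm v) st M ∧
      B.Stage (fun _ => True) (fun _ => True) (fun _ => True)
        (fun v w => G.Adj v w ∧ ord.symm w < ord.symm v) st M :=
  Reached.congr h (fun w => by simp) (fun w => by simp) (fun w => by simp) fun a b => by simp

variable {F : (V → Bool) → ℂ} {st st' : B.Ancilla → Status V} {M M' : Set B.Ancilla}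

/-- The final measurement of a spin decouples it: it is either unused, hence already independent of
the rest, or the state of a copy of its last vertex after a Hadamard gate. -/
lemma Stage.spinCircuit (S : B.Stage (fun _ => True) (fun _ => True) (fun _ => True)
      (fun v w => G.Adj v w ∧ ord.symm w < ord.symm v) st M) {q : Qe}
    (hW : IsWave (V := V) (N := B.Ancilla) ρ F st' M')
    (hst : st' (B.spinAnc q) = st (B.spinAnc q))
    (hr : ∀ n, n ∉ Set.range B.spinAnc → st' n = st n) :
    IsWave (V := V) (N := B.Ancilla) ((run (B.spinCircuit q)).toLin ρ) F
      (Function.update st' (B.spinAnc q) .plus) (insert (B.spinAnc q) M') := by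
  classical
  rcases idle_or_exists_isCurrent ord em (fun _ => True) q with hi | ⟨u, hu, hcur⟩
  · have hl : (vertices ord).filter (fun v => decide (IsLast ord em q v)) = [] :=
      List.filter_eq_nil_iff.2 fun u _ hp => hi u (of_decide_eq_true hp).1 trivial
    have hp : Function.update st' (B.spinAnc q) .plus = st' := by
      rw [← S.spin_idle q hi, ← hst, Function.update_eq_self]
    rw [BobChoices.spinCircuit, hl, hp]
    exact hW.meas (B.spinAnc q)
  · have hl : (vertices ord).filter (fun v => decide (IsLast ord em q v)) = [u] :=
      filter_vertices_eq_singleton fun a => by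
        rw [decide_eq_true_iff]
        refine ⟨fun ha => ord.symm.injective (le_antisymm ?_ (ha.2 u hu)), ?_⟩
        · exact hcur.2 a (ha.1.trans hu.symm) trivial
        · rintro rfl
          exact ⟨hu, fun w hw => hcur.2 w (hw.trans hu.symm) trivial⟩
    have hd : st' (B.spinAnc q) = .dual u := by
      rw [hst, ← hu]
      exact S.spin_dual u hcur trivial
    have hcar : Carries st' (photon u (B.corrLast u) : B.Qubit) u := by
      cases hj : B.corrLast u with
      | none => exact Or.inl rfl
      | some j =>
        refine Or.inr ⟨B.photonAnc ⟨u, j⟩, rfl, ?_⟩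
        rw [hr _ (by simp)]
        refine S.photon_copy ⟨u, j⟩ trivial ?_
        rintro ⟨a, b, p, -, hL, hf, hsp⟩
        exact B.corrLast_available u j hj a b p hL hf (by simpa using hsp)
    have hW' := (hW.meas (B.spinAnc q)).cz_dual hd hcar
    rw [BobChoices.spinCircuit, hl, List.map_cons, List.map_nil, run_cons, run_cons, run_nil]
    exact hW'

/-- After the last round, the final measurements decouple all the ancillary qubits. -/
theorem Completed.final (h : B.Completed θ (Fintype.card V) ρ) :
    ∃ M, IsWave (V := V) (N := B.Ancilla) ((run B.finalCircuit).toLin ρ)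
      (amplitude θ (fun _ => True) fun v w => G.Adj v w ∧ ord.symm w < ord.symm v)
      (fun _ => .plus) M := by
  classical
  obtain ⟨st, M, hW, S⟩ := h.stage
  -- the spins
  obtain ⟨st₁, M₁, hW₁, hs₁, hk₁, hM₁⟩ := hW.run_flatMap (f := B.spinAnc) Sum.inl_injective
    B.spinCircuit (fun _ => .plus) Set.univ (Finset.univ : Finset Qe).toList
    (Finset.nodup_toList _) st
    (fun q _ ρ st' M' hW' hst _ hr => ⟨_, S.spinCircuit hW' hst hr, fun n hn =>
      (Set.mem_insert_iff.1 hn).symm.imp_right fun e => ⟨e, Set.mem_univ n⟩⟩)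
    (fun _ _ => rfl) (fun q _ => S.spinAnc_notMem q) fun _ _ => rfl
  -- the leftover additional photons
  have hph : ∀ s, st₁ (B.photonAnc s) = st (B.photonAnc s) := fun s => hk₁ _ (by simp)
  obtain ⟨st₂, M₂, hW₂, hs₂, hk₂, -⟩ := hW₁.run_flatMap (f := B.photonAnc)
    (Sum.inr_injective.comp Sum.inl_injective)
    (fun s => B.measX (addPhoton s) (mainPhoton s.1)) (fun _ => .plus) Set.univ
    ((Finset.univ : Finset (Σ v, Fin (B.extra v))).toList.filter fun s => ¬ B.IsConsumed s)
    ((Finset.nodup_toList _).filter _) st₁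
    (fun s hs ρ st' M' hW' hst hsM _ => by
      have hc : ¬ B.IsConsumed s := by simpa using hs
      refine ⟨insert (B.photonAnc s) M', hW'.measX (v := s.1) ?_ hsM, fun n hn =>
        (Set.mem_insert_iff.1 hn).symm.imp_right fun e => ⟨e, Set.mem_univ n⟩⟩
      rw [hst, hph, S.photon_copy s trivial ((consumedBy_iff_isConsumed s).not.2 hc)])
    (fun _ _ => rfl)
    (fun s hs hm => by
      have hc : ¬ B.IsConsumed s := by simpa using hs
      rcases hM₁ _ hm with hm | ⟨-, q, -, e⟩
      · exact S.photonAnc_notMem ((consumedBy_iff_isConsumed s).not.2 hc) hm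
      · simp at e)
    fun _ _ => rfl
  have hst₂ : st₂ = fun _ => .plus := by
    funext n
    rcases n with q | s | v
    · rw [hk₂ _ (by simp), hs₁ q (by simp)]
    · by_cases hc : B.IsConsumed s
      · rw [hk₂ _ fun s' hs' e => ?_, hph, S.photon_plus s trivial
          ((consumedBy_iff_isConsumed s).2 hc)]
        simp only [Sum.inr.injEq, Sum.inl.injEq] at e
        subst e
        simp [hc] at hs'
      · exact hs₂ s (by simp [hc])
    · rw [hk₂ _ (by simp), hk₁ _ (by simp), S.bit_plus v trivial]
  refine ⟨M₂, ?_⟩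
  rw [finalCircuit, run_append, leftoverCircuit, ← hst₂]
  exact hW₂

end BobChoices

/-! ### Correctness -/

/-- Bob's output after the last round. The constant is fixed by the trace. -/
lemma BobChoices.Completed.finish_apply {B : BobChoices G ord em} {θ : V → Angle}
    {ρ : Matrix (B.Qubit → Bool) (B.Qubit → Bool) ℂ} (h : B.Completed θ (Fintype.card V) ρ)
    (htr : ρ.trace = 1) (p q : (V → Bool) × SimpleGraph V) :
    (B.converter.finish).toLin ρ p q = if p.2 = G ∧ q.2 = G then
      blindGraphState G θ p.1 * star (blindGraphState G θ q.1) else 0 := by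
  obtain ⟨M, c, hc⟩ := h.final
  let Φ : Channel (B.Qubit → Bool) (V → Bool) := ((run B.finalCircuit).andThen
    (Channel.relabel (Equiv.sumArrowEquivProdArrow _ _ _))).andThen Channel.discardRight
  have hs : ((Real.sqrt 2 : ℝ) : ℂ)⁻¹ ^ Fintype.card V ≠ 0 := by simp
  obtain ⟨κ, hκ⟩ : ∃ κ : ℂ, ∀ y y', Φ.toLin ρ y y' =
      κ * (blindGraphState G θ y * star (blindGraphState G θ y')) := by
    refine ⟨Fintype.card (B.Ancilla → Bool) * (c * star c) /
      (((Real.sqrt 2 : ℝ) : ℂ)⁻¹ ^ Fintype.card V *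
        star (((Real.sqrt 2 : ℝ) : ℂ)⁻¹ ^ Fintype.card V)), fun y y' => ?_⟩
    have hent : ∀ e : B.Ancilla → Bool, (run B.finalCircuit).toLin ρ (Sum.elim y e)
        (Sum.elim y' e) = c * star c *
          (amplitude θ (fun _ => True) (fun v w => G.Adj v w ∧ ord.symm w < ord.symm v) y *
          star (amplitude θ (fun _ => True)
            (fun v w => G.Adj v w ∧ ord.symm w < ord.symm v) y')) := fun e => by
      rw [hc, dephased, Matrix.of_apply, if_pos]
      · simp only [wave, Status.factor, Finset.prod_const_one, mul_one, Sum.elim_inl, star_mul']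
        ring
      · rintro _ ⟨n, -, rfl⟩
        rfl
    have hsum : Φ.toLin ρ y y' = ∑ e : B.Ancilla → Bool, (run B.finalCircuit).toLin ρ
        (Sum.elim y e) (Sum.elim y' e) := rfl
    rw [hsum, Finset.sum_congr rfl fun e _ => hent e, Finset.sum_const, Finset.card_univ,
      nsmul_eq_mul, blindGraphState_eq_amplitude G ord, blindGraphState_eq_amplitude G ord,
      star_mul']
    have hs' : star (((Real.sqrt 2 : ℝ) : ℂ)⁻¹ ^ Fintype.card V) ≠ 0 := star_ne_zero.2 hs
    field_simp
  have hκ1 : κ = 1 := by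
    have h1 := Φ.tracePreserving ρ
    rw [htr, Matrix.trace] at h1
    simp only [Matrix.diag_apply, hκ, ← Finset.mul_sum] at h1
    have h2 := blindGraphState_normalized G θ
    simp only [mul_comm (star _)] at h2
    rwa [h2, mul_one] at h1
  have hf : (B.converter.finish).toLin ρ p q = (Channel.attach G).toLin (Φ.toLin ρ) p q := rfl
  rw [hf, Channel.attach_apply, hκ, hκ1, one_mul]

/-- Round `i` of the honest execution acts on Bob's register by the extender channel, for the angle
of the vertex `ord i`, followed by the circuit of the round. -/
lemma honestRound (B : BobChoices G ord em) (i : Fin (Fintype.card V)) (w : (V → Angle) → ℂ)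
    (σ : (V → Angle) → Matrix (B.Qubit → Bool) (B.Qubit → Bool) ℂ)
    (h1 : (spin (em (ord i)) : B.Qubit) ≠ mainPhoton (ord i))
    (h2 : (spin (em (ord i)) : B.Qubit) ≠ bitReg (ord i))
    (h3 : (mainPhoton (ord i) : B.Qubit) ≠ bitReg (ord i)) :
    ((((((Channel.classical fun θ : V → Angle => (θ, θ (ord i))).tensor
      ((Channel.attach false).andThen
        (Channel.relabel (swapOne (spin (em (ord i)) : B.Qubit))))).andThen
      (Channel.relabel (regroup _ _ _ _))).andThen
      (extender.onRight ((V → Angle) × (B.Qubit → Bool)))).andThen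
      (Channel.relabel (regroup _ _ _ _).symm)).andThen
      ((Channel.discardRight : Channel ((V → Angle) × Unit) (V → Angle)).tensor
        (((Channel.relabel (swapThree (spin (em (ord i)) : B.Qubit) (mainPhoton (ord i))
          (bitReg (ord i)) h1 h2 h3)).andThen Channel.discardRight).andThen
          (run (B.roundCircuit i))))).toLin (classicalQuantum w σ) =
    classicalQuantum w fun θ => (run (B.roundCircuit i)).toLin
      ((extendChannel (θ (ord i)) (spin (em (ord i))) (mainPhoton (ord i)) (bitReg (ord i))
        h1 h2 h3).toLin (σ θ)) :=
  classicalQuantum_call ..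

/-- The joint state after the last round, given the input `ρ`. -/
lemma honestSystem_start (hem : ∀ v w, Precedes ord em v w → G.Adj v w) (B : BobChoices G ord em)
    (ρ : Matrix ((V → Angle) × Unit) ((V → Angle) × Unit) ℂ) :
    ∃ σ : (V → Angle) → Matrix (B.Qubit → Bool) (B.Qubit → Bool) ℂ,
      (∀ θ, B.Completed θ (Fintype.card V) (σ θ) ∧ (σ θ).trace = 1) ∧
      (honestSystem (aliceConverter ord) B.converter extender).start.toLin ρ =
        classicalQuantum (fun θ => ρ (θ, ()) (θ, ())) σ := by
  refine Channel.iterate_induction _ (fun k τ => ∃ σ : (V → Angle) →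
    Matrix (B.Qubit → Bool) (B.Qubit → Bool) ℂ, (∀ θ, B.Completed θ k (σ θ) ∧ (σ θ).trace = 1) ∧
      τ = classicalQuantum (fun θ => ρ (θ, ()) (θ, ())) σ) ?_ ?_
  · rintro i τ ⟨σ, hσ, rfl⟩
    refine ⟨_, fun θ => ⟨(hσ θ).1.round hem (by simp [spin, mainPhoton]) (by simp [spin, bitReg])
      (by simp [mainPhoton, bitReg]), ?_⟩, honestRound B i _ σ _ _ _⟩
    rw [Channel.tracePreserving, Channel.tracePreserving, (hσ θ).2]
  · refine ⟨fun θ => (run B.initCircuit).toLin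
      (Matrix.single (fun _ => false) (fun _ => false) 1), fun θ => ⟨B.completed_init θ, ?_⟩, ?_⟩
    · rw [Channel.tracePreserving, Matrix.trace_single_eq_same]
    · have hc : (Channel.classical fun (_ : Unit) (_ : B.Qubit) => false).toLin 1 =
          Matrix.single (fun _ => false) (fun _ => false) 1 := by
        ext x x'
        simp [Channel.classical_apply, Matrix.single_apply]
      rw [← hc]
      exact id_tensor_toLin ((Channel.classical fun (_ : Unit) (_ : B.Qubit) => false).andThen
        (run B.initCircuit)) ρ

/-- Correctness holds perfectly, for all of Bob's choices. -/
theorem isCorrect_rspFor (hem : ∀ v w, Precedes ord em v w → G.Adj v w) (B : BobChoices G ord em) :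
    IsCorrect 0 (aliceConverter ord) B.converter extender (rspFor G) := by
  refine indistinguishable_of_toLin_eq fun ρ => ?_
  obtain ⟨σ, hσ, hρ⟩ := honestSystem_start hem B ρ
  rw [hρ]
  ext ⟨u, x, g⟩ ⟨u', x', g'⟩
  refine Eq.trans ?_ (rspFor_apply G ρ u u' x x' g g').symm
  refine (forget_tensor_apply B.converter.finish (fun θ => ρ (θ, ()) (θ, ())) σ u u' (x, g)
    (x', g')).trans ?_
  simp only [(hσ _).1.finish_apply (hσ _).2]
  by_cases hg : g = G ∧ g' = G
  · simp only [if_pos hg, mul_comm]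
  · simp only [if_neg hg, mul_zero, Finset.sum_const_zero]

end Protocol

end BlindGraph

end

theorem mainTheorem4 {V : Type} [Fintype V] [DecidableEq V] {Qe : Type} [Fintype Qe]
    [DecidableEq Qe] (G : SimpleGraph V) (ord : Fin (Fintype.card V) ≃ V) (em : V → Qe)
    (hem : ∀ v w, BlindGraph.Precedes ord em v w → G.Adj v w)
    (B : BlindGraph.BobChoices G ord em) :
    BlindGraph.Constructs 0 (BlindGraph.aliceConverter ord) B.converter
        BlindGraph.extender (BlindGraph.rspFor G) ∧
      BlindGraph.IsSimulatedBy 0 (BlindGraph.aliceConverter ord)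
        BlindGraph.extender (BlindGraph.rspFor G) (BlindGraph.graphSimulator ord) := by
  have h := BlindGraph.isSimulatedBy_graphSimulator ord G
  exact ⟨⟨BlindGraph.isCorrect_rspFor hem B, BlindGraph.graphSimulator ord, h⟩, h⟩
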